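/- Let $G$ be a finite group. *Semigroups* are commutative monoids, written additively, and *semirings* are commutative semirings with $0$ and $1$. Maps of $G$-sets are equivariant. **Mackey functors.** A Mackey functor $M$ assigns to each finite $G$-set $X$ a set $M(X)$, and to each map $f\colon X\to Y$ of finite $G$-sets a restriction $R_f\colon M(Y)\to M(X)$ and a transfer $T_f\colon M(X)\to M(Y)$, such that: (i) $R_1=1$, $T_1=1$, $R_{gf}=R_fR_g$, $T_{gf}=T_gT_f$; (ii) for every cartesian square with sides $f\colon W\to X$, $g\colon W\to Y$, $h\colon X\to Z$, $k\colon Y\to Z$ (so $hf=kg$) we have $T_gR_f=R_kT_h$; (iii) restriction along the two inclusions gives a bijection $M(X\amalg Y)\to M(X)\times M(Y)$, and $M(\emptyset)$ has exactly one element. (Equivalently, $M$ is a product-preserving functor to sets from the category of isomorphism classes of spans of finite $G$-sets.) Morphisms are families of maps $M(X)\to M'(X)$ commuting with all $R_f$ and $T_f$. Each $M(X)$ is a semigroup under $a+b=T_s(a,b)$, where $s\colon X\amalg X\to X$ is the fold map; the zero element is the transfer of the unique element of $M(\emptyset)$ along $\emptyset\to X$. **Tambara functors.** A Tambara functor $S$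 is a Mackey functor equipped with norms $N_f\colon S(X)\to S(Y)$ for all maps $f\colon X\to Y$ of finite $G$-sets, such that $(R,N)$ is also a Mackey functor and, for all $X\xrightarrow{g}Y\xrightarrow{h}Z$, we have $N_hT_g=T_rN_qR_p$. Here $X\xleftarrow{p}A\xrightarrow{q}B\xrightarrow{r}Z$ is the distributor: $B$ is the $G$-set of pairs $(z,s)$ with $z\in Z$ and $s\colon h^{-1}\{z\}\to X$ a function with $gs=1$, $A$ is the set of pairs $(y,(z,s))$ with $(z,s)\in B$ and $h(y)=z$, and $p(y,(z,s))=s(y)$, $q(y,(z,s))=(z,s)$, $r(z,s)=z$. (Equivalently, $S$ is a product-preserving functor to sets from the category of isomorphism classes of bispans of finite $G$-sets.) Morphisms commute with all $R_f$, $T_f$, $N_f$. Each $S(X)$ is a semiring, with the addition above and with product $ab=N_s(a,b)$. **Coefficient systems.** A coefficient system is a functor $N$ from the groupoid of finite transitive (nonempty) $G$-sets and isomorphisms to semigroups. A multiplicative coefficient system is a functor $R$ from the category of finite transitive $G$-sets and all $G$-maps to semirings; we write $N_f\colon R(U)\to R(V)$ for the map induced by $f\colon U\to V$. **The functor $q$.**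 For a Mackey functor $M$ and a transitive $G$-set $U$, let $(qM)(U)$ be the quotient of the semigroup $M(U)$ by the smallest congruence that identifies with $0$ all elements of the sum of the subsemigroups $T_u(M(U'))$, where $u\colon U'\to U$ runs over the maps of transitive $G$-sets that are not isomorphisms; an isomorphism $f\colon U\to V$ acts by the map induced by $T_f$. For a Tambara functor $S$, the same quotient $(qS)(U)$ of $S(U)$ inherits a semiring structure, and a map $f\colon U\to V$ of transitive $G$-sets acts on it by the map induced by $N_f$. This defines functors $q$ from Mackey functors to coefficient systems and from Tambara functors to multiplicative coefficient systems. **The functor $r$.** For a coefficient system $N$ and a finite $G$-set $X$, let $(rN)(X)$ be the inverse limit of $N(U)$ over the groupoid of pairs $(U,x)$ with $U$ a transitive $G$-set and $x\colon U\to X$ a $G$-map. Its elements are the families $m(U,x)\in N(U)$ with $f_*(m(U,xf))=m(V,x)$ for every isomorphism $f\colon U\to V$ and every $x\colon V\to X$. For $f\colon X\to Y$, put $(R_fn)(U,x)=n(U,fx)$ and $(T_fm)(U,y)=\sum_{x\colon U\to X,\ fx=y}m(U,x)$. If $N$ underlies a multiplicative coefficient system $R$, put in addition $$(N_fm)(T,y)=\prod_{U}N_{v_U}\bigl(m(U,u_U)\bigr),$$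 where $U$ runs over the orbits of the pullback $X\times_YT$ of $f$ and $y\colon T\to Y$, with projections $u_U\colon U\to X$ and $v_U\colon U\to T$. This defines functors $r$ from coefficient systems to Mackey functors and from multiplicative coefficient systems to Tambara functors. **Rational objects.** A semigroup $A$ is rational if every element has an additive inverse and $a\mapsto na$ is bijective on $A$ for every integer $n\ge1$. A Mackey functor, Tambara functor, coefficient system or multiplicative coefficient system is rational if the additive semigroups of all its values are rational. **Theorem.** 1. The functor $q$ from Mackey functors to coefficient systems is left adjoint to $r$. The functors $q$ and $r$ send rational objects to rational objects, the unit $M\to rqM$ is an isomorphism for every rational Mackey functor $M$, and the counit $qrN\to N$ is an isomorphism for every rational coefficient system $N$. The restrictions of $q$ and $r$ to the full subcategories of rational objects form an equivalence between rational Mackey functors and rational coefficient systems. 2. The functor $q$ from Tambara functors to multiplicative coefficient systems is left adjoint to $r$. The functors $q$ and $r$ send rational objects to rational objects, the unit $S\to rqS$ is an isomorphism for every rational Tambara functor $S$, and the counit $qrR\to R$ is an isomorphism for every rational multiplicative coefficient system $R$. The restrictions of $q$ and $r$ to the full subcategories of rational objects form an equivalence between rational Tambara functors and rational multiplicative coefficient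 systems. -/

import Mathlib

universe u v w

open CategoryTheory

/-- A finite `G`-set. -/
structure FinGSet (G : Type u) [Group G] where
  carrier : Type u
  [action : MulAction G carrier]
  [finite : Finite carrier]

namespace FinGSet

variable {G : Type u} [Group G]

instance : CoeSort (FinGSet.{u} G) (Type u) := ⟨carrier⟩

attribute [instance] action finite

instance finiteMaps (X Y : FinGSet.{u} G) : Finite (X →[G] Y) := DFunLike.finite _

noncomputable instance fintypeMaps (X Y : FinGSet.{u} G) : Fintype (X →[G] Y) :=
  Fintype.ofFinite _

/-- The disjoint union of two finite `G`-sets. -/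
def coprod (X Y : FinGSet.{u} G) : FinGSet.{u} G := ⟨X ⊕ Y⟩

def inl (X Y : FinGSet.{u} G) : X →[G] coprod X Y := ⟨Sum.inl, fun _ _ => rfl⟩

def inr (X Y : FinGSet.{u} G) : Y →[G] coprod X Y := ⟨Sum.inr, fun _ _ => rfl⟩

/-- The map out of a disjoint union with given restrictions to the two summands. -/
def copair {X Y Z : FinGSet.{u} G} (f : X →[G] Z) (g : Y →[G] Z) : coprod X Y →[G] Z :=
  ⟨Sum.elim f g, by
    rintro γ (x | y)
    · exact map_smul f γ x
    · exact map_smul g γ y⟩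

/-- The disjoint union of two maps. -/
def coprodMap {X Y X' Y' : FinGSet.{u} G} (f : X →[G] X') (g : Y →[G] Y') :
    coprod X Y →[G] coprod X' Y' :=
  copair ((inl X' Y').comp f) ((inr X' Y').comp g)

/-- The fold map `X ⨿ X → X`, given by the identity on both copies of `X`. -/
def fold (X : FinGSet.{u} G) : coprod X X →[G] X :=
  copair (MulActionHom.id G) (MulActionHom.id G)

/-- The empty `G`-set. -/
def empty (G : Type u) [Group G] : FinGSet.{u} G :=
  letI : MulAction G PEmpty.{u + 1} :=
    { smul := fun _ x => x.elim, one_smul := fun x => x.elim, mul_smul := fun _ _ x => x.elim }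
  ⟨PEmpty.{u + 1}⟩

/-- The inclusion of the empty set. -/
def fromEmpty (X : FinGSet.{u} G) : empty G →[G] X := ⟨fun x => x.elim, fun _ x => x.elim⟩

/-- The subset `S ⊆ X` as a `G`-set, where `S` is closed under the action. -/
def sub (X : FinGSet.{u} G) (S : Set X) (hS : ∀ (γ : G), ∀ x ∈ S, γ • x ∈ S) : FinGSet.{u} G :=
  letI : MulAction G S :=
    { smul := fun γ x => ⟨γ • x.1, hS γ x.1 x.2⟩
      one_smul := fun x => Subtype.ext (one_smul G x.1)
      mul_smul := fun γ δ x => Subtype.ext (mul_smul γ δ x.1) }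
  ⟨S⟩

/-- The inclusion of a closed subset. -/
def subIncl (X : FinGSet.{u} G) (S : Set X) (hS : ∀ (γ : G), ∀ x ∈ S, γ • x ∈ S) :
    X.sub S hS →[G] X :=
  ⟨Subtype.val, fun _ _ => rfl⟩

/-- The pullback `X ×_Z Y` of `f : X → Z` and `g : Y → Z`. -/
def pullback {X Y Z : FinGSet.{u} G} (f : X →[G] Z) (g : Y →[G] Z) : FinGSet.{u} G :=
  letI : MulAction G {p : X × Y // f p.1 = g p.2} :=
    { smul := fun γ p => ⟨γ • p.1, by
        rw [Prod.smul_fst, Prod.smul_snd, map_smul, map_smul, p.2]⟩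
      one_smul := fun p => Subtype.ext (one_smul G p.1)
      mul_smul := fun γ δ p => Subtype.ext (mul_smul γ δ p.1) }
  ⟨{p : X × Y // f p.1 = g p.2}⟩

def pullbackFst {X Y Z : FinGSet.{u} G} (f : X →[G] Z) (g : Y →[G] Z) :
    pullback f g →[G] X :=
  ⟨fun p => p.1.1, fun _ _ => rfl⟩

def pullbackSnd {X Y Z : FinGSet.{u} G} (f : X →[G] Z) (g : Y →[G] Z) :
    pullback f g →[G] Y :=
  ⟨fun p => p.1.2, fun _ _ => rfl⟩

/-- The square with sides `f : W → X`, `g : W → Y`, `h : X → Z`, `k : Y → Z` is commutative and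
cartesian. -/
structure IsCartesian {W X Y Z : FinGSet.{u} G} (f : W →[G] X) (g : W →[G] Y)
    (h : X →[G] Z) (k : Y →[G] Z) : Prop where
  comm : ∀ w, h (f w) = k (g w)
  lift : ∀ x y, h x = k y → ∃! w, f w = x ∧ g w = y

theorem isCartesian_pullback {X Y Z : FinGSet.{u} G} (h : X →[G] Z) (k : Y →[G] Z) :
    IsCartesian (pullbackFst h k) (pullbackSnd h k) h k where
  comm p := p.2
  lift x y e := ⟨⟨(x, y), e⟩, ⟨rfl, rfl⟩, by
    rintro ⟨⟨a, b⟩, _⟩ ⟨rfl, rfl⟩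
    rfl⟩

theorem isCartesian_of_bijective {X Y X' Y' : FinGSet.{u} G} {f : X →[G] X'} {g : X →[G] Y}
    {h : X' →[G] Y'} {k : Y →[G] Y'} (hf : Function.Bijective f) (hk : Function.Bijective k)
    (comm : ∀ x, h (f x) = k (g x)) : IsCartesian f g h k where
  comm := comm
  lift x y e := by
    obtain ⟨w, rfl⟩ := hf.2 x
    refine ⟨w, ⟨rfl, hk.1 ((comm w).symm.trans e)⟩, ?_⟩
    rintro w' ⟨h1, -⟩
    exact hf.1 h1

theorem isCartesian_coprodMap_inl {X Y X' Y' : FinGSet.{u} G} (f : X →[G] X') (g : Y →[G] Y') :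
    IsCartesian (inl X Y) f (coprodMap f g) (inl X' Y') where
  comm _ := rfl
  lift := by
    rintro (x | y) z h
    · cases h
      exact ⟨x, ⟨rfl, rfl⟩, fun w hw => Sum.inl_injective hw.1⟩
    · cases h

theorem isCartesian_coprodMap_inr {X Y X' Y' : FinGSet.{u} G} (f : X →[G] X') (g : Y →[G] Y') :
    IsCartesian (inr X Y) g (coprodMap f g) (inr X' Y') where
  comm _ := rfl
  lift := by
    rintro (x | y) z h
    · cases h
    · cases h
      exact ⟨y, ⟨rfl, rfl⟩, fun w hw => Sum.inr_injective hw.1⟩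

theorem isCartesian_fold {X Y : FinGSet.{u} G} (f : X →[G] Y) :
    IsCartesian (coprodMap f f) (fold X) (fold Y) f where
  comm := by rintro (x | x) <;> rfl
  lift := by
    rintro (y | y) x rfl
    · refine ⟨Sum.inl x, ⟨rfl, rfl⟩, ?_⟩
      rintro (w | w) ⟨h1, h2⟩
      · exact congrArg Sum.inl h2
      · cases h1
    · refine ⟨Sum.inr x, ⟨rfl, rfl⟩, ?_⟩
      rintro (w | w) ⟨h1, h2⟩
      · cases h1
      · exact congrArg Sum.inr h2

theorem isCartesian_fromEmpty {X Y : FinGSet.{u} G} (f : X →[G] Y) :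
    IsCartesian (MulActionHom.id G) (fromEmpty X) (fromEmpty Y) f where
  comm x := x.elim
  lift x := x.elim

/-- The equivariant inverse of an equivariant bijection. -/
noncomputable def inv {X Y : FinGSet.{u} G} (f : X →[G] Y) (hf : Function.Bijective f) : Y →[G] X :=
  MulActionHom.inverse f (Equiv.ofBijective f hf).symm
    (Equiv.ofBijective f hf).left_inv (Equiv.ofBijective f hf).right_inv

theorem apply_inv {X Y : FinGSet.{u} G} (f : X →[G] Y) (hf : Function.Bijective f) (y : Y) :
    f (inv f hf y) = y :=
  (Equiv.ofBijective f hf).right_inv y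

theorem inv_apply {X Y : FinGSet.{u} G} (f : X →[G] Y) (hf : Function.Bijective f) (x : X) :
    inv f hf (f x) = x :=
  (Equiv.ofBijective f hf).left_inv x

variable {X Y Z : FinGSet.{u} G}

/-- Pairs `(z, s)` where `z ∈ Z` and `s : h⁻¹{z} → X` is a (not necessarily equivariant)
section of `g` over the fibre. -/
structure DistPt (g : X →[G] Y) (h : Y →[G] Z) where
  base : Z
  sec : ∀ y : Y, h y = base → X
  sec_spec : ∀ y hy, g (sec y hy) = y

namespace DistPt

variable {g : X →[G] Y} {h : Y →[G] Z}

theorem ext' {a b : DistPt g h} (h1 : a.base = b.base)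
    (h2 : ∀ y hy hy', a.sec y hy = b.sec y hy') : a = b := by
  obtain ⟨z, s, hs⟩ := a
  obtain ⟨z', s', hs'⟩ := b
  obtain rfl : z = z' := h1
  obtain rfl : s = s' := funext fun y => funext fun hy => h2 y hy hy
  rfl

theorem sec_congr (a : DistPt g h) {y y' : Y} (e : y = y') (hy : h y = a.base)
    (hy' : h y' = a.base) : a.sec y hy = a.sec y' hy' := by
  subst e; rfl

theorem sec_congr_pt {a b : DistPt g h} (e : a = b) (y : Y) (hy : h y = a.base)
    (hy' : h y = b.base) : a.sec y hy = b.sec y hy' := by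
  subst e; rfl

theorem smul_aux (γ : G) {y : Y} {z : Z} (hy : h y = γ • z) : h (γ⁻¹ • y) = z := by
  rw [map_smul, hy, inv_smul_smul]

/-- The action `γ • (z, s) = (γ • z, γ ∘ s ∘ γ⁻¹)`. -/
instance : MulAction G (DistPt g h) where
  smul γ a :=
    { base := γ • a.base
      sec := fun y hy => γ • a.sec (γ⁻¹ • y) (smul_aux γ hy)
      sec_spec := fun y hy => by rw [map_smul, a.sec_spec, smul_inv_smul] }
  one_smul a := ext' (one_smul G a.base) fun y hy hy' =>
    (one_smul G _).trans (a.sec_congr (by rw [inv_one, one_smul]) _ _)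
  mul_smul γ δ a := ext' (mul_smul γ δ a.base) fun y hy hy' =>
    (mul_smul γ δ _).trans (congrArg (γ • δ • ·)
      (a.sec_congr (by rw [mul_inv_rev, mul_smul]) _ _))

theorem smul_base (γ : G) (a : DistPt g h) : (γ • a).base = γ • a.base := rfl

theorem smul_sec (γ : G) (a : DistPt g h) (y : Y) (hy : h y = (γ • a).base) :
    (γ • a).sec y hy = γ • a.sec (γ⁻¹ • y) (smul_aux γ hy) := rfl

instance : Finite (DistPt g h) := by
  let φ : DistPt g h → Σ z : Z, ({y : Y // h y = z} → X) :=
    fun a => ⟨a.base, fun y => a.sec y.1 y.2⟩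
  refine Finite.of_injective φ ?_
  rintro ⟨z, s, hs⟩ ⟨z', s', hs'⟩ e
  simp only [φ, Sigma.mk.injEq] at e
  obtain ⟨rfl, e2⟩ := e
  obtain rfl : s = s' := funext fun y => funext fun hy => congrFun (eq_of_heq e2) ⟨y, hy⟩
  rfl

end DistPt

/-- The set `B` in the distributor `(p : A → X, q : A → B, r : B → Z)` of maps `g : X → Y` and
`h : Y → Z`. -/
def distB (g : X →[G] Y) (h : Y →[G] Z) : FinGSet.{u} G := ⟨DistPt g h⟩

/-- The map `r (z, s) = z`. -/
def distR (g : X →[G] Y) (h : Y →[G] Z) : distB g h →[G] Z := ⟨DistPt.base, fun _ _ => rfl⟩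

/-- The set `A = Y ×_Z B` in the distributor. -/
def distA (g : X →[G] Y) (h : Y →[G] Z) : FinGSet.{u} G := pullback h (distR g h)

/-- The map `q (y, s) = (h y, s)`. -/
def distQ (g : X →[G] Y) (h : Y →[G] Z) : distA g h →[G] distB g h := pullbackSnd h (distR g h)

/-- The map `p (y, s) = s y`. -/
def distP (g : X →[G] Y) (h : Y →[G] Z) : distA g h →[G] X where
  toFun a := DistPt.sec a.1.2 a.1.1 a.2
  map_smul' γ a := by
    refine (DistPt.smul_sec γ a.1.2 (γ • a.1.1) _).trans ?_
    exact congrArg (γ • ·) (DistPt.sec_congr _ (inv_smul_smul γ a.1.1) _ _)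

end FinGSet

/-- A Mackey functor for `G`, with values in sets: restrictions `res f` and transfers `tr f` for all
maps of finite `G`-sets, subject to functoriality and the cartesian-square relation, such that
disjoint unions are sent to products. -/
structure MackeyFunctor (G : Type u) [Group G] where
  obj : FinGSet.{u} G → Type w
  res : ∀ {X Y : FinGSet.{u} G}, (X →[G] Y) → obj Y → obj X
  tr : ∀ {X Y : FinGSet.{u} G}, (X →[G] Y) → obj X → obj Y
  res_id : ∀ {X : FinGSet.{u} G} (m : obj X), res (MulActionHom.id G) m = m
  res_comp : ∀ {X Y Z : FinGSet.{u} G} (g : Y →[G] Z) (f : X →[G] Y) (m : obj Z),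
    res (g.comp f) m = res f (res g m)
  tr_id : ∀ {X : FinGSet.{u} G} (m : obj X), tr (MulActionHom.id G) m = m
  tr_comp : ∀ {X Y Z : FinGSet.{u} G} (g : Y →[G] Z) (f : X →[G] Y) (m : obj X),
    tr (g.comp f) m = tr g (tr f m)
  tr_res : ∀ {W X Y Z : FinGSet.{u} G} {f : W →[G] X} {g : W →[G] Y} {h : X →[G] Z}
    {k : Y →[G] Z}, FinGSet.IsCartesian f g h k → ∀ m : obj X, tr g (res f m) = res k (tr h m)
  coprod_bijective : ∀ X Y : FinGSet.{u} G, Function.Bijective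
    fun m : obj (FinGSet.coprod X Y) => (res (FinGSet.inl X Y) m, res (FinGSet.inr X Y) m)
  existsUnique_empty : ∃! _m : obj (FinGSet.empty G), True

namespace MackeyFunctor

open FinGSet

variable {G : Type u} [Group G] (M : MackeyFunctor.{u, w} G) {X Y Z : FinGSet.{u} G}

/-- The unique element of `M(∅)`. -/
noncomputable def pt : M.obj (FinGSet.empty G) := M.existsUnique_empty.choose

theorem eq_pt (m : M.obj (FinGSet.empty G)) : m = M.pt :=
  M.existsUnique_empty.unique trivial trivial

/-- The element of `M(X ⨿ Y)` with given restrictions to `X` and `Y`. -/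
noncomputable def glue (a : M.obj X) (b : M.obj Y) : M.obj (coprod X Y) :=
  (Equiv.ofBijective _ (M.coprod_bijective X Y)).symm (a, b)

theorem glue_spec (a : M.obj X) (b : M.obj Y) :
    (M.res (inl X Y) (M.glue a b), M.res (inr X Y) (M.glue a b)) = (a, b) :=
  (Equiv.ofBijective _ (M.coprod_bijective X Y)).right_inv (a, b)

theorem res_inl_glue (a : M.obj X) (b : M.obj Y) : M.res (inl X Y) (M.glue a b) = a :=
  congrArg Prod.fst (M.glue_spec a b)

theorem res_inr_glue (a : M.obj X) (b : M.obj Y) : M.res (inr X Y) (M.glue a b) = b :=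
  congrArg Prod.snd (M.glue_spec a b)

theorem eq_glue {m : M.obj (coprod X Y)} {a : M.obj X} {b : M.obj Y}
    (h1 : M.res (inl X Y) m = a) (h2 : M.res (inr X Y) m = b) : m = M.glue a b :=
  (M.coprod_bijective X Y).1 (by
    rw [Prod.mk.injEq]
    exact ⟨h1.trans (M.res_inl_glue a b).symm, h2.trans (M.res_inr_glue a b).symm⟩)

theorem tr_res_of_bijective {X' Y' : FinGSet.{u} G} {f : X →[G] X'} {g : X →[G] Y} {h : X' →[G] Y'}
    {k : Y →[G] Y'} (hf : Function.Bijective f) (hk : Function.Bijective k)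
    (comm : ∀ x, h (f x) = k (g x)) (m : M.obj X') : M.tr g (M.res f m) = M.res k (M.tr h m) :=
  M.tr_res (isCartesian_of_bijective hf hk comm) m

theorem tr_res_self (f : X →[G] Y) (hf : Function.Bijective f) (m : M.obj Y) :
    M.tr f (M.res f m) = m := by
  rw [M.tr_res_of_bijective (h := MulActionHom.id G) (k := MulActionHom.id G) hf
    Function.bijective_id (fun _ => rfl), M.res_id, M.tr_id]

theorem res_tr_self (f : X →[G] Y) (hf : Function.Bijective f) (m : M.obj X) :
    M.res f (M.tr f m) = m := by
  rw [← M.tr_res_of_bijective (f := MulActionHom.id G) (g := MulActionHom.id G)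
    Function.bijective_id hf (fun _ => rfl), M.res_id, M.tr_id]

theorem tr_eq_res_inv (f : X →[G] Y) (hf : Function.Bijective f) (m : M.obj X) :
    M.tr f m = M.res (inv f hf) m := by
  conv_lhs => rw [← M.res_id m]
  rw [show (MulActionHom.id G : X →[G] X) = (inv f hf).comp f from
    MulActionHom.ext fun x => (inv_apply f hf x).symm, M.res_comp, M.tr_res_self f hf]

theorem glue_res_res (m : M.obj (coprod X Y)) :
    M.glue (M.res (inl X Y) m) (M.res (inr X Y) m) = m :=
  (M.eq_glue rfl rfl).symm

theorem tr_coprodMap_glue {X' Y' : FinGSet.{u} G} (f : X →[G] X') (g : Y →[G] Y')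
    (a : M.obj X) (b : M.obj Y) :
    M.tr (coprodMap f g) (M.glue a b) = M.glue (M.tr f a) (M.tr g b) := by
  apply M.eq_glue
  · rw [← M.tr_res (isCartesian_coprodMap_inl f g), M.res_inl_glue]
  · rw [← M.tr_res (isCartesian_coprodMap_inr f g), M.res_inr_glue]

theorem res_coprodMap_glue {X' Y' : FinGSet.{u} G} (f : X →[G] X') (g : Y →[G] Y')
    (a : M.obj X') (b : M.obj Y') :
    M.res (coprodMap f g) (M.glue a b) = M.glue (M.res f a) (M.res g b) := by
  apply M.eq_glue
  · rw [← M.res_comp, show (coprodMap f g).comp (inl X Y) = (inl X' Y').comp f from rfl,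
      M.res_comp, M.res_inl_glue]
  · rw [← M.res_comp, show (coprodMap f g).comp (inr X Y) = (inr X' Y').comp g from rfl,
      M.res_comp, M.res_inr_glue]

/-- The addition `a + b = T_s (a, b)`, where `s : X ⨿ X → X` is the fold map. -/
noncomputable def add (a b : M.obj X) : M.obj X := M.tr (fold X) (M.glue a b)

/-- The zero element `T_z ()`, where `z : ∅ → X` is the inclusion. -/
noncomputable def zero (X : FinGSet.{u} G) : M.obj X := M.tr (fromEmpty X) M.pt

theorem tr_copair_glue (f : X →[G] Z) (g : Y →[G] Z) (a : M.obj X) (b : M.obj Y) :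
    M.tr (copair f g) (M.glue a b) = M.add (M.tr f a) (M.tr g b) := by
  rw [add, ← M.tr_coprodMap_glue, ← M.tr_comp]
  congr 1
  ext (x | y) <;> rfl

theorem tr_add (f : X →[G] Y) (a b : M.obj X) :
    M.tr f (M.add a b) = M.add (M.tr f a) (M.tr f b) := by
  rw [← M.tr_copair_glue, add, ← M.tr_comp]
  congr 1
  ext (x | y) <;> rfl

theorem tr_zero (f : X →[G] Y) : M.tr f (M.zero X) = M.zero Y := by
  rw [zero, zero, ← M.tr_comp]
  congr 1
  ext x
  exact x.elim

theorem res_add (f : X →[G] Y) (a b : M.obj Y) :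
    M.res f (M.add a b) = M.add (M.res f a) (M.res f b) := by
  rw [add, add, ← M.tr_res (isCartesian_fold f), M.res_coprodMap_glue]

theorem res_zero (f : X →[G] Y) : M.res f (M.zero Y) = M.zero X := by
  rw [zero, zero, ← M.tr_res (isCartesian_fromEmpty f), M.res_id]

theorem add_comm_aux (a b : M.obj X) : M.add a b = M.add b a := by
  let sw : coprod X X →[G] coprod X X := copair (inr X X) (inl X X)
  have hsw : Function.Bijective sw := by
    refine Function.bijective_iff_has_inverse.2 ⟨sw, ?_, ?_⟩ <;> rintro (x | x) <;> rfl
  have h1 : M.glue b a = M.res sw (M.glue a b) := by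
    symm
    apply M.eq_glue
    · rw [← M.res_comp, show sw.comp (inl X X) = inr X X from rfl, M.res_inr_glue]
    · rw [← M.res_comp, show sw.comp (inr X X) = inl X X from rfl, M.res_inl_glue]
  have h2 : (fold X).comp sw = fold X := by ext (x | x) <;> rfl
  rw [add, add, h1]
  conv_rhs => rw [← h2]
  rw [M.tr_comp, M.tr_res_self sw hsw]

theorem add_assoc_aux (a b c : M.obj X) : M.add (M.add a b) c = M.add a (M.add b c) := by
  let as : coprod X (coprod X X) →[G] coprod (coprod X X) X :=
    copair ((inl _ _).comp (inl X X)) (copair ((inl _ _).comp (inr X X)) (inr _ _))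
  have has : Function.Bijective as := by
    refine Function.bijective_iff_has_inverse.2 ⟨(Equiv.sumAssoc X X X), ?_, ?_⟩
    · rintro (x | x | x) <;> rfl
    · rintro ((x | x) | x) <;> rfl
  have h1 : M.glue a (M.glue b c) = M.res as (M.glue (M.glue a b) c) := by
    symm
    apply M.eq_glue
    · rw [← M.res_comp, show as.comp (inl _ _) = (inl _ _).comp (inl X X) from rfl, M.res_comp,
        M.res_inl_glue, M.res_inl_glue]
    · apply M.eq_glue
      · rw [← M.res_comp, ← M.res_comp, show as.comp ((inr X _).comp (inl X X)) =
          (inl _ _).comp (inr X X) from rfl, M.res_comp, M.res_inl_glue, M.res_inr_glue]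
      · rw [← M.res_comp, ← M.res_comp, show as.comp ((inr X _).comp (inr X X)) =
          (inr _ _) from rfl, M.res_inr_glue]
  have h2 : (copair (fold X) (MulActionHom.id G)).comp as =
      copair (MulActionHom.id G) (fold X) := by
    ext (x | x | x) <;> rfl
  have h3 : M.add (M.add a b) c =
      M.tr (copair (fold X) (MulActionHom.id G)) (M.glue (M.glue a b) c) := by
    rw [M.tr_copair_glue, M.tr_id]; rfl
  have h4 : M.add a (M.add b c) =
      M.tr (copair (MulActionHom.id G) (fold X)) (M.glue a (M.glue b c)) := by
    rw [M.tr_copair_glue, M.tr_id]; rfl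
  rw [h3, h4, h1, ← h2, M.tr_comp, M.tr_res_self as has]

theorem zero_add_aux (a : M.obj X) : M.add (M.zero X) a = a := by
  let e : coprod (FinGSet.empty G) X →[G] X := copair (fromEmpty X) (MulActionHom.id G)
  have he : Function.Bijective e := by
    refine Function.bijective_iff_has_inverse.2 ⟨inr _ _, ?_, ?_⟩
    · rintro (x | x)
      · exact x.elim
      · rfl
    · intro x
      rfl
  have h1 : M.glue M.pt a = M.res e a := by
    symm
    apply M.eq_glue
    · exact M.eq_pt _
    · rw [← M.res_comp, show e.comp (inr _ X) = MulActionHom.id G from rfl, M.res_id]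
  have h2 := M.tr_copair_glue (fromEmpty X) (MulActionHom.id G) M.pt a
  rw [M.tr_id] at h2
  rw [zero, ← h2, h1]
  exact M.tr_res_self e he a

/-- The canonical semigroup (commutative additive monoid) structure on `M(X)`. -/
noncomputable instance (X : FinGSet.{u} G) : AddCommMonoid (M.obj X) where
  add a b := M.add a b
  zero := M.zero X
  add_assoc := M.add_assoc_aux
  zero_add := M.zero_add_aux
  add_zero a := (M.add_comm_aux a _).trans (M.zero_add_aux a)
  add_comm := M.add_comm_aux
  nsmul := letI : Zero (M.obj X) := ⟨M.zero X⟩; letI : Add (M.obj X) := ⟨M.add⟩; nsmulRec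
  nsmul_zero _ := rfl
  nsmul_succ _ _ := rfl

theorem add_def (a b : M.obj X) : a + b = M.tr (fold X) (M.glue a b) := rfl

theorem zero_def : (0 : M.obj X) = M.tr (fromEmpty X) M.pt := rfl

/-- Transfers are additive. -/
noncomputable def trHom (f : X →[G] Y) : M.obj X →+ M.obj Y where
  toFun := M.tr f
  map_zero' := M.tr_zero f
  map_add' := M.tr_add f

/-- Morphisms of Mackey functors: natural families of maps. -/
@[ext]
structure Hom (M M' : MackeyFunctor.{u, w} G) where
  app : ∀ X : FinGSet.{u} G, M.obj X → M'.obj X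
  app_res : ∀ {X Y : FinGSet.{u} G} (f : X →[G] Y) (m : M.obj Y),
    app X (M.res f m) = M'.res f (app Y m)
  app_tr : ∀ {X Y : FinGSet.{u} G} (f : X →[G] Y) (m : M.obj X),
    app Y (M.tr f m) = M'.tr f (app X m)

instance : Category (MackeyFunctor.{u, w} G) where
  Hom := Hom
  id M := ⟨fun _ m => m, fun _ _ => rfl, fun _ _ => rfl⟩
  comp φ ψ := ⟨fun X m => ψ.app X (φ.app X m),
    fun f m => by rw [φ.app_res, ψ.app_res], fun f m => by rw [φ.app_tr, ψ.app_tr]⟩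

variable {M}

theorem Hom.app_add {M' : MackeyFunctor.{u, w} G} (φ : Hom M M') (a b : M.obj X) :
    φ.app X (a + b) = φ.app X a + φ.app X b := by
  rw [add_def, φ.app_tr, add_def]
  congr 1
  apply M'.eq_glue
  · rw [← φ.app_res, M.res_inl_glue]
  · rw [← φ.app_res, M.res_inr_glue]

theorem Hom.app_zero {M' : MackeyFunctor.{u, w} G} (φ : Hom M M') :
    φ.app X 0 = 0 := by
  rw [zero_def, φ.app_tr, zero_def, M'.eq_pt (φ.app _ _)]

/-- The components of a morphism are additive. -/
def Hom.appHom {M' : MackeyFunctor.{u, w} G} (φ : Hom M M') (X : FinGSet.{u} G) :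
    M.obj X →+ M'.obj X where
  toFun := φ.app X
  map_zero' := φ.app_zero
  map_add' := φ.app_add

end MackeyFunctor

/-- A Tambara functor for `G`: a set `obj X` for each finite `G`-set `X`, with restrictions `res f`,
transfers `tr f` and norms `nm f`, such that restrictions and transfers form a Mackey functor,
restrictions and norms form a Mackey functor, and norms of transfers are given by distributors. -/
structure TambaraFunctor (G : Type u) [Group G] extends MackeyFunctor.{u, w} G where
  nm : ∀ {X Y : FinGSet.{u} G}, (X →[G] Y) → obj X → obj Y
  nm_id : ∀ {X : FinGSet.{u} G} (m : obj X), nm (MulActionHom.id G) m = m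
  nm_comp : ∀ {X Y Z : FinGSet.{u} G} (g : Y →[G] Z) (f : X →[G] Y) (m : obj X),
    nm (g.comp f) m = nm g (nm f m)
  nm_res : ∀ {W X Y Z : FinGSet.{u} G} {f : W →[G] X} {g : W →[G] Y} {h : X →[G] Z}
    {k : Y →[G] Z}, FinGSet.IsCartesian f g h k → ∀ m : obj X, nm g (res f m) = res k (nm h m)
  nm_tr : ∀ {X Y Z : FinGSet.{u} G} (g : X →[G] Y) (h : Y →[G] Z) (m : obj X),
    nm h (tr g m) = tr (FinGSet.distR g h) (nm (FinGSet.distQ g h) (res (FinGSet.distP g h) m))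

namespace TambaraFunctor

open FinGSet

variable {G : Type u} [Group G] (S : TambaraFunctor.{u, w} G) {X Y Z : FinGSet.{u} G}

/-- The Mackey functor formed by the restrictions and the norms. -/
def mulMackey : MackeyFunctor.{u, w} G where
  obj := S.obj
  res := S.res
  tr := S.nm
  res_id := S.res_id
  res_comp := S.res_comp
  tr_id := S.nm_id
  tr_comp := S.nm_comp
  tr_res := S.nm_res
  coprod_bijective := S.coprod_bijective
  existsUnique_empty := S.existsUnique_empty

/-- The multiplication `a * b = N_s (a, b)`, where `s : X ⨿ X → X` is the fold map. -/
noncomputable def mul (a b : S.obj X) : S.obj X := S.nm (fold X) (S.glue a b)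

/-- The unit element `N_z ()`, where `z : ∅ → X` is the inclusion. -/
noncomputable def one (X : FinGSet.{u} G) : S.obj X := S.nm (fromEmpty X) S.pt

/-- Norms of transfers may be computed by any bispan isomorphic to the distributor. -/
theorem nm_tr_of_iso {A B : FinGSet.{u} G} {g : X →[G] Y} {h : Y →[G] Z} (p : A →[G] X)
    (q : A →[G] B) (r : B →[G] Z) (α : A →[G] distA g h) (β : B →[G] distB g h)
    (hα : Function.Bijective α) (hβ : Function.Bijective β) (hp : ∀ a, distP g h (α a) = p a)
    (hq : ∀ a, distQ g h (α a) = β (q a)) (hr : ∀ b, distR g h (β b) = r b) (m : S.obj X) :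
    S.nm h (S.tr g m) = S.tr r (S.nm q (S.res p m)) := by
  obtain rfl : (distP g h).comp α = p := MulActionHom.ext hp
  obtain rfl : (distR g h).comp β = r := MulActionHom.ext hr
  rw [S.nm_tr, S.tr_comp, S.res_comp,
    S.nm_res (isCartesian_of_bijective hα hβ hq), S.tr_res_self β hβ]

/-- The section used in the Frobenius relation. -/
def frobPt (f : X →[G] Y) (x : X) :
    DistPt (coprodMap f (MulActionHom.id G : Y →[G] Y)) (fold Y) where
  base := f x
  sec y _ := Sum.elim (fun _ => Sum.inl x) (fun y' => Sum.inr y') y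
  sec_spec := by
    rintro (y | y) hy
    · exact congrArg Sum.inl (Eq.symm hy)
    · rfl

theorem nm_copair_glue (f : X →[G] Z) (g : Y →[G] Z) (a : S.obj X) (b : S.obj Y) :
    S.nm (copair f g) (S.glue a b) = S.mul (S.nm f a) (S.nm g b) :=
  S.mulMackey.tr_copair_glue f g a b

/-- Frobenius reciprocity. -/
theorem frobenius (f : X →[G] Y) (a : S.obj X) (b : S.obj Y) :
    S.mul (S.tr f a) b = S.tr f (S.mul a (S.res f b)) := by
  let β : X →[G] distB (coprodMap f (MulActionHom.id G : Y →[G] Y)) (fold Y) :=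
    { toFun := frobPt f
      map_smul' := fun γ x => by
        refine DistPt.ext' (map_smul f γ x) ?_
        intro y hy hy'
        rcases y with y | y
        · rfl
        · exact congrArg Sum.inr (smul_inv_smul γ y).symm }
  have hβ : Function.Bijective β := by
    constructor
    · intro x x' e
      have := DistPt.sec_congr_pt e (Sum.inl (f x)) rfl (congrArg DistPt.base e)
      exact Sum.inl_injective this
    · intro b
      have h1 := b.sec_spec (Sum.inl b.base) rfl
      rcases hx : b.sec (Sum.inl b.base) rfl with x | y
      · rw [hx] at h1
        have hfx : f x = b.base := Sum.inl_injective h1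
        refine ⟨x, DistPt.ext' hfx ?_⟩
        rintro (y | y) hy hy'
        · exact hx.symm.trans (b.sec_congr (congrArg Sum.inl (Eq.symm hy')) _ _)
        · have h2 := b.sec_spec (Sum.inr y) hy'
          rcases h3 : b.sec (Sum.inr y) hy' with x' | y'
          · rw [h3] at h2
            cases h2
          · rw [h3] at h2
            exact congrArg Sum.inr (Sum.inr_injective h2).symm
      · rw [hx] at h1
        cases h1
  let α : coprod X X →[G] distA (coprodMap f (MulActionHom.id G : Y →[G] Y)) (fold Y) :=
    { toFun := fun x => ⟨(coprodMap f f x, β (fold X x)), by rcases x with x | x <;> rfl⟩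
      map_smul' := fun γ x => Subtype.ext (Prod.ext (map_smul (coprodMap f f) γ x)
        ((congrArg β (map_smul (fold X) γ x)).trans (map_smul β γ _))) }
  have hα : Function.Bijective α := by
    constructor
    · rintro x x' e
      have e1 : coprodMap f f x = coprodMap f f x' := congrArg (fun a => a.1.1) e
      have e2 : fold X x = fold X x' := hβ.1 (congrArg (fun a => a.1.2) e)
      rcases x with x | x <;> rcases x' with x' | x'
      · exact congrArg Sum.inl e2
      · cases e1
      · cases e1
      · exact congrArg Sum.inr e2
    · rintro ⟨⟨y, b⟩, e⟩
      obtain ⟨x, rfl⟩ := hβ.2 b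
      rcases y with y | y
      · refine ⟨Sum.inl x, Subtype.ext (Prod.ext ?_ rfl)⟩
        exact congrArg Sum.inl (Eq.symm e)
      · refine ⟨Sum.inr x, Subtype.ext (Prod.ext ?_ rfl)⟩
        exact congrArg Sum.inr (Eq.symm e)
  have key := S.nm_tr_of_iso (g := coprodMap f (MulActionHom.id G : Y →[G] Y)) (h := fold Y)
    (coprodMap (MulActionHom.id G) f) (fold X) f α β hα hβ
    (by rintro (x | x) <;> rfl) (fun _ => rfl) (fun _ => rfl) (S.glue a b)
  rw [S.tr_coprodMap_glue, S.tr_id, S.res_coprodMap_glue, S.res_id] at key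
  exact key

theorem mul_comm_aux (a b : S.obj X) : S.mul a b = S.mul b a := S.mulMackey.add_comm_aux a b

theorem add_mul_aux (a b c : S.obj X) : S.mul (a + b) c = S.mul a c + S.mul b c := by
  rw [S.add_def, S.frobenius, S.add_def]
  congr 1
  apply S.eq_glue
  · refine (S.mulMackey.res_add (inl X X) _ _).trans ?_
    change S.mul (S.res _ _) (S.res _ _) = _
    rw [S.res_inl_glue, ← S.res_comp, show (fold X).comp (inl X X) = MulActionHom.id G from rfl,
      S.res_id]
  · refine (S.mulMackey.res_add (inr X X) _ _).trans ?_
    change S.mul (S.res _ _) (S.res _ _) = _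
    rw [S.res_inr_glue, ← S.res_comp, show (fold X).comp (inr X X) = MulActionHom.id G from rfl,
      S.res_id]

theorem zero_mul_aux (a : S.obj X) : S.mul 0 a = 0 := by
  rw [S.zero_def, S.frobenius, S.eq_pt (S.mul _ _)]

/-- The canonical commutative semiring structure on `S(X)`. -/
noncomputable instance (X : FinGSet.{u} G) : CommSemiring (S.obj X) where
  __ := (inferInstance : AddCommMonoid (S.toMackeyFunctor.obj X))
  mul a b := S.mul a b
  one := S.one X
  mul_assoc := S.mulMackey.add_assoc_aux
  one_mul := S.mulMackey.zero_add_aux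
  mul_one a := (S.mul_comm_aux a _).trans (S.mulMackey.zero_add_aux a)
  mul_comm := S.mul_comm_aux
  left_distrib a b c := by
    change S.mul a (b + c) = S.mul a b + S.mul a c
    rw [S.mul_comm_aux, S.add_mul_aux, S.mul_comm_aux b, S.mul_comm_aux c]
  right_distrib := S.add_mul_aux
  zero_mul := S.zero_mul_aux
  mul_zero a := (S.mul_comm_aux a _).trans (S.zero_mul_aux a)

theorem mul_def (a b : S.obj X) : a * b = S.nm (fold X) (S.glue a b) := rfl

theorem one_def : (1 : S.obj X) = S.nm (fromEmpty X) S.pt := rfl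

theorem nm_mul (f : X →[G] Y) (a b : S.obj X) : S.nm f (a * b) = S.nm f a * S.nm f b :=
  S.mulMackey.tr_add f a b

theorem nm_one (f : X →[G] Y) : S.nm f (1 : S.obj X) = 1 := S.mulMackey.tr_zero f

theorem res_mul (f : X →[G] Y) (a b : S.obj Y) : S.res f (a * b) = S.res f a * S.res f b :=
  S.mulMackey.res_add f a b

theorem res_one (f : X →[G] Y) : S.res f (1 : S.obj Y) = 1 := S.mulMackey.res_zero f

theorem tr_mul (f : X →[G] Y) (a : S.obj X) (b : S.obj Y) :
    S.tr f a * b = S.tr f (a * S.res f b) := S.frobenius f a b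

/-- Morphisms of Tambara functors: natural families of maps. -/
@[ext]
structure Hom (S S' : TambaraFunctor.{u, w} G) extends
    MackeyFunctor.Hom S.toMackeyFunctor S'.toMackeyFunctor where
  app_nm : ∀ {X Y : FinGSet.{u} G} (f : X →[G] Y) (m : S.obj X),
    app Y (S.nm f m) = S'.nm f (app X m)

instance : Category (TambaraFunctor.{u, w} G) where
  Hom := Hom
  id S := { MackeyFunctor.Hom.mk (fun _ m => m) (fun _ _ => rfl) (fun _ _ => rfl) with
    app_nm := fun _ _ => rfl }
  comp φ ψ := { MackeyFunctor.Hom.mk (fun X m => ψ.app X (φ.app X m))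
      (fun f m => by rw [φ.app_res, ψ.app_res]) (fun f m => by rw [φ.app_tr, ψ.app_tr]) with
    app_nm := fun f m => by
      change ψ.app _ (φ.app _ _) = _
      rw [φ.app_nm, ψ.app_nm] }

variable {S}

theorem Hom.app_mul {S' : TambaraFunctor.{u, w} G} (φ : Hom S S') (a b : S.obj X) :
    φ.app X (a * b) = φ.app X a * φ.app X b := by
  rw [mul_def, φ.app_nm, mul_def]
  congr 1
  apply S'.eq_glue
  · rw [← φ.app_res, S.res_inl_glue]
  · rw [← φ.app_res, S.res_inr_glue]

theorem Hom.app_one {S' : TambaraFunctor.{u, w} G} (φ : Hom S S') :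
    φ.app X (1 : S.obj X) = 1 := by
  rw [one_def, φ.app_nm, one_def, S'.eq_pt (φ.app _ _)]

/-- The components of a morphism of Tambara functors are semiring homomorphisms. -/
def Hom.appRingHom {S' : TambaraFunctor.{u, w} G} (φ : Hom S S') (X : FinGSet.{u} G) :
    S.obj X →+* S'.obj X where
  toFun := φ.app X
  map_zero' := φ.app_zero
  map_add' := φ.app_add
  map_one' := φ.app_one
  map_mul' := φ.app_mul

end TambaraFunctor

/-- A finite transitive (in particular nonempty) `G`-set. -/
structure Orb (G : Type u) [Group G] where
  toFinGSet : FinGSet.{u} G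
  [nonempty : Nonempty toFinGSet]
  [isPretransitive : MulAction.IsPretransitive G toFinGSet]

namespace Orb

variable {G : Type u} [Group G]

attribute [instance] nonempty isPretransitive

/-- The category of transitive `G`-sets and equivariant maps. -/
instance : Category (Orb.{u} G) where
  Hom U V := U.toFinGSet →[G] V.toFinGSet
  id U := MulActionHom.id G
  comp f g := MulActionHom.comp g f

/-- The equivariant map underlying a morphism. -/
abbrev toMap {U V : Orb.{u} G} (f : U ⟶ V) : U.toFinGSet →[G] V.toFinGSet := f

/-- An equivariant map, as a morphism. -/
abbrev ofMap {U V : Orb.{u} G} (f : U.toFinGSet →[G] V.toFinGSet) : U ⟶ V := f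

theorem isIso_iff {U V : Orb.{u} G} (f : U ⟶ V) : IsIso f ↔ Function.Bijective (toMap f) := by
  constructor
  · intro h
    refine Function.bijective_iff_has_inverse.2 ⟨toMap (CategoryTheory.inv f), fun x => ?_,
      fun x => ?_⟩
    · exact DFunLike.congr_fun (show toMap (f ≫ CategoryTheory.inv f) = toMap (𝟙 U) from IsIso.hom_inv_id f) x
    · exact DFunLike.congr_fun (show toMap (CategoryTheory.inv f ≫ f) = toMap (𝟙 V) from IsIso.inv_hom_id f) x
  · intro h
    exact ⟨ofMap (FinGSet.inv (toMap f) h),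
      MulActionHom.ext fun x => FinGSet.inv_apply (toMap f) h x,
      MulActionHom.ext fun x => FinGSet.apply_inv (toMap f) h x⟩

theorem bijective {U V : Orb.{u} G} (e : U ≅ V) : Function.Bijective (toMap e.hom) :=
  (isIso_iff e.hom).1 inferInstance

/-- The isomorphism given by an equivariant bijection. -/
noncomputable def isoOfBijective {U V : Orb.{u} G} (f : U.toFinGSet →[G] V.toFinGSet)
    (hf : Function.Bijective f) : U ≅ V where
  hom := f
  inv := FinGSet.inv f hf
  hom_inv_id := MulActionHom.ext fun x => FinGSet.inv_apply f hf x
  inv_hom_id := MulActionHom.ext fun x => FinGSet.apply_inv f hf x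

theorem surjective {X : FinGSet.{u} G} {U : Orb.{u} G} [Nonempty X] (f : X →[G] U.toFinGSet) :
    Function.Surjective f := by
  intro y
  obtain ⟨x⟩ := (inferInstance : Nonempty X)
  obtain ⟨γ, h⟩ := MulAction.exists_smul_eq G (f x) y
  exact ⟨γ • x, (map_smul f γ x).trans h⟩

theorem hom_ext_of_apply {U : Orb.{u} G} {X : FinGSet.{u} G} {f g : U.toFinGSet →[G] X}
    (x : U.toFinGSet) (h : f x = g x) : f = g := by
  ext y
  obtain ⟨γ, rfl⟩ := MulAction.exists_smul_eq G x y
  rw [map_smul, map_smul, h]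

theorem orbit_smul_mem {X : FinGSet.{u} G} (x : X) (γ : G) (y : X) (hy : y ∈ MulAction.orbit G x) :
    γ • y ∈ MulAction.orbit G x :=
  (MulAction.mem_orbit_of_mem_orbit γ hy)

/-- The orbit of a point of a finite `G`-set. -/
def orbit {X : FinGSet.{u} G} (x : X) : Orb.{u} G where
  toFinGSet := X.sub (MulAction.orbit G x) (orbit_smul_mem x)
  nonempty := ⟨⟨x, MulAction.mem_orbit_self x⟩⟩
  isPretransitive := by
    constructor
    rintro ⟨a, γ, rfl⟩ ⟨b, δ, rfl⟩
    refine ⟨δ * γ⁻¹, Subtype.ext ?_⟩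
    change (δ * γ⁻¹) • γ • x = δ • x
    rw [mul_smul, inv_smul_smul]

/-- The inclusion of an orbit. -/
def orbitIncl {X : FinGSet.{u} G} (x : X) : (orbit x).toFinGSet →[G] X := FinGSet.subIncl X _ (orbit_smul_mem x)

end Orb

/-- The category of coefficient systems: functors to commutative additive monoids from the groupoid
of transitive `G`-sets and equivariant isomorphisms. -/
abbrev CSys (G : Type u) [Group G] := Core (Orb.{u} G) ⥤ AddCommMonCat.{w}

/-- The category of multiplicative coefficient systems: covariant functors to commutative semirings
from the category of transitive `G`-sets and equivariant maps. -/
abbrev MCSys (G : Type u) [Group G] := Orb.{u} G ⥤ CommSemiRingCat.{w}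

/-- The set of equivariant sections of a map. -/
def Sections {G : Type u} [Group G] {X Y : FinGSet.{u} G} (f : X →[G] Y) : Type u :=
  {s : Y →[G] X // ∀ y, f (s y) = y}

noncomputable instance {G : Type u} [Group G] {X Y : FinGSet.{u} G} (f : X →[G] Y) :
    Fintype (Sections f) :=
  @Fintype.ofFinite _ (inferInstanceAs (Finite {s : Y →[G] X // ∀ y, f (s y) = y}))

namespace MackeyFunctor

open FinGSet

variable {G : Type u} [Group G] (M : MackeyFunctor.{u, w} G)

/-- The sum of all the images `T_f M(V)`, where `f : V → U` is a map of transitive `G`-sets that is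
not an isomorphism. -/
noncomputable def transfers (U : Orb.{u} G) : AddSubmonoid (M.obj U.toFinGSet) :=
  ⨆ (V : Orb.{u} G) (f : V ⟶ U) (_ : ¬ IsIso f), AddMonoidHom.mrange (M.trHom (Orb.toMap f))

/-- The smallest congruence on `M(U)` identifying all elements of `M.transfers U` with `0`. -/
noncomputable def qCon (U : Orb.{u} G) : AddCon (M.obj U.toFinGSet) :=
  addConGen fun a b => a ∈ M.transfers U ∧ b = 0

theorem tr_mem_transfers {U V : Orb.{u} G} (f : V ⟶ U) (hf : ¬ IsIso f)
    (n : M.obj V.toFinGSet) : M.tr (Orb.toMap f) n ∈ M.transfers U := by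
  refine (le_iSup_of_le V (le_iSup_of_le f (le_iSup_of_le hf le_rfl)) :
    AddMonoidHom.mrange (M.trHom (Orb.toMap f)) ≤ M.transfers U) ⟨n, rfl⟩

theorem mk_tr_eq_zero {U V : Orb.{u} G} (f : V ⟶ U) (hf : ¬ IsIso f)
    (n : M.obj V.toFinGSet) : (M.qCon U).mk' (M.tr (Orb.toMap f) n) = 0 := by
  rw [← map_zero (M.qCon U).mk']
  exact (AddCon.eq (M.qCon U)).2 (AddConGen.Rel.of _ _ ⟨M.tr_mem_transfers f hf n, rfl⟩)

theorem qCon_le_ker {U : Orb.{u} G} {P : Type*} [AddCommMonoid P] (φ : M.obj U.toFinGSet →+ P)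
    (hφ : ∀ (V : Orb.{u} G) (f : V ⟶ U), ¬ IsIso f → ∀ n, φ (M.tr (Orb.toMap f) n) = 0) :
    M.qCon U ≤ AddCon.ker φ := by
  have h : M.transfers U ≤ AddMonoidHom.mker φ := by
    refine iSup_le fun V => iSup_le fun f => iSup_le fun hf => ?_
    rintro _ ⟨n, rfl⟩
    exact hφ V f hf n
  refine AddCon.addConGen_le.2 ?_
  rintro a b ⟨ha, rfl⟩
  exact (AddMonoidHom.mem_mker.1 (h ha)).trans (map_zero φ).symm

/-- Additive maps that kill transfers factor through the quotient. -/
noncomputable def qLift {U : Orb.{u} G} {P : Type*} [AddCommMonoid P] (φ : M.obj U.toFinGSet →+ P)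
    (hφ : ∀ (V : Orb.{u} G) (f : V ⟶ U), ¬ IsIso f → ∀ n, φ (M.tr (Orb.toMap f) n) = 0) :
    (M.qCon U).Quotient →+ P :=
  (M.qCon U).lift φ (M.qCon_le_ker φ hφ)

theorem qCon_hom_ext {U : Orb.{u} G} {P : Type*} [AddCommMonoid P]
    {φ ψ : (M.qCon U).Quotient →+ P}
    (h : ∀ m, φ ((M.qCon U).mk' m) = ψ ((M.qCon U).mk' m)) : φ = ψ :=
  AddMonoidHom.ext fun x => by
    obtain ⟨m, rfl⟩ := AddCon.mk'_surjective x
    exact h m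

/-- The map `f_*` on quotients induced by an isomorphism `f`. -/
noncomputable def qIso {U V : Orb.{u} G} (e : U ≅ V) : (M.qCon U).Quotient →+ (M.qCon V).Quotient :=
  M.qLift ((M.qCon V).mk'.comp (M.trHom (Orb.toMap e.hom))) (by
    intro W f hf n
    have h : ¬ IsIso (f ≫ e.hom) := fun h => hf (IsIso.of_isIso_comp_right f e.hom)
    have := M.mk_tr_eq_zero (f ≫ e.hom) h n
    rw [← this]
    exact congrArg _ (M.tr_comp (Orb.toMap e.hom) (Orb.toMap f) n).symm)

theorem qIso_mk {U V : Orb.{u} G} (e : U ≅ V) (m : M.obj U.toFinGSet) :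
    M.qIso e ((M.qCon U).mk' m) = (M.qCon V).mk' (M.tr (Orb.toMap e.hom) m) := rfl

/-- The coefficient system `qM`: the quotient of `M` by transfers along non-isomorphisms. -/
noncomputable def toCSys : CSys.{u, w} G where
  obj U := AddCommMonCat.of (M.qCon U.of).Quotient
  map f := AddCommMonCat.ofHom (M.qIso f.iso)
  map_id U := by
    ext m
    exact congrArg _ (M.tr_id m)
  map_comp f g := by
    ext m
    exact congrArg _ (M.tr_comp (Orb.toMap g.iso.hom) (Orb.toMap f.iso.hom) m)

/-- The map on quotients induced by a morphism of Mackey functors. -/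
noncomputable def Hom.qMap {M M' : MackeyFunctor.{u, w} G} (φ : Hom M M') (U : Orb.{u} G) :
    (M.qCon U).Quotient →+ (M'.qCon U).Quotient :=
  M.qLift ((M'.qCon U).mk'.comp (φ.appHom U.toFinGSet)) (by
    intro V f hf n
    rw [← M'.mk_tr_eq_zero f hf (φ.app _ n), ← φ.app_tr]
    rfl)

theorem Hom.qMap_mk {M M' : MackeyFunctor.{u, w} G} (φ : Hom M M') (U : Orb.{u} G)
    (m : M.obj U.toFinGSet) :
    φ.qMap U ((M.qCon U).mk' m) = (M'.qCon U).mk' (φ.app U.toFinGSet m) := rfl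

/-- The functor `q` from Mackey functors to coefficient systems. -/
noncomputable def q (G : Type u) [Group G] : MackeyFunctor.{u, w} G ⥤ CSys.{u, w} G where
  obj M := M.toCSys
  map {M M'} φ :=
    { app := fun U => AddCommMonCat.ofHom (Hom.qMap φ U.of)
      naturality := fun U V f => by
        ext x
        obtain ⟨m, rfl⟩ := AddCon.mk'_surjective x
        exact congrArg _ (Hom.app_tr φ (Orb.toMap f.iso.hom) m) }
  map_id M := by
    ext U x
    obtain ⟨m, rfl⟩ := AddCon.mk'_surjective x
    rfl
  map_comp φ ψ := by
    ext U x
    obtain ⟨m, rfl⟩ := AddCon.mk'_surjective x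
    rfl

theorem mk_tr_of_isEmpty {U : Orb.{u} G} {B : FinGSet.{u} G} [IsEmpty B] (r : B →[G] U.toFinGSet)
    (m : M.obj B) : (M.qCon U).mk' (M.tr r m) = 0 := by
  have hb : Function.Bijective (fromEmpty B) :=
    ⟨fun x => x.elim, fun x => (IsEmpty.false x).elim⟩
  rw [← M.tr_res_self _ hb m, ← M.tr_comp, M.eq_pt (M.res _ m),
    show r.comp (fromEmpty B) = fromEmpty _ from MulActionHom.ext fun x => x.elim,
    ← M.zero_def, map_zero]

theorem mk_tr_orbit {U V : Orb.{u} G} (r : V.toFinGSet →[G] U.toFinGSet)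
    (m : M.obj V.toFinGSet) :
    (M.qCon U).mk' (M.tr r m) = ∑ s : Sections r, (M.qCon U).mk' (M.res s.1 m) := by
  by_cases h : Function.Bijective r
  · have hs : ∀ s : Sections r, s = ⟨FinGSet.inv r h, FinGSet.apply_inv r h⟩ := fun s =>
      Subtype.ext (MulActionHom.ext fun y => h.1 ((s.2 y).trans (FinGSet.apply_inv r h y).symm))
    let _ : Unique (Sections r) := ⟨⟨⟨FinGSet.inv r h, FinGSet.apply_inv r h⟩⟩, hs⟩
    rw [Fintype.sum_unique, M.tr_eq_res_inv r h, hs default]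
  · have : IsEmpty (Sections r) := by
      refine ⟨fun s => h ⟨fun x y e => ?_, Orb.surjective r⟩⟩
      obtain ⟨x', rfl⟩ := Orb.surjective s.1 x
      obtain ⟨y', rfl⟩ := Orb.surjective s.1 y
      rw [s.2, s.2] at e
      rw [e]
    rw [Fintype.sum_empty]
    exact M.mk_tr_eq_zero (Orb.ofMap r) (fun h' => h ((Orb.isIso_iff _).1 h')) m

theorem mk_tr (U : Orb.{u} G) (n : ℕ) : ∀ (B : FinGSet.{u} G), Nat.card B ≤ n →
    ∀ (r : B →[G] U.toFinGSet) (m : M.obj B),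
    (M.qCon U).mk' (M.tr r m) = ∑ s : Sections r, (M.qCon U).mk' (M.res s.1 m) := by
  have empty_case : ∀ (B : FinGSet.{u} G), IsEmpty B →
      ∀ (r : B →[G] U.toFinGSet) (m : M.obj B),
      (M.qCon U).mk' (M.tr r m) = ∑ s : Sections r, (M.qCon U).mk' (M.res s.1 m) := by
    intro B hB r m
    have : IsEmpty (Sections r) :=
      ⟨fun s => hB.false (s.1 (Classical.arbitrary U.toFinGSet))⟩
    rw [Fintype.sum_empty, M.mk_tr_of_isEmpty]
  induction n with
  | zero =>
    intro B hB
    exact empty_case B (Finite.card_eq_zero_iff.1 (Nat.le_zero.1 hB))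
  | succ n ih =>
    intro B hB r m
    rcases isEmpty_or_nonempty B with hE | ⟨⟨b⟩⟩
    · exact empty_case B hE r m
    have hC : ∀ (γ : G), ∀ x ∈ (MulAction.orbit G b)ᶜ, γ • x ∈ (MulAction.orbit G b)ᶜ := by
      intro γ x hx hx'
      exact hx (by simpa using Orb.orbit_smul_mem b γ⁻¹ _ hx')
    let O := Orb.orbit b
    let iO : O.toFinGSet →[G] B := Orb.orbitIncl b
    let C := B.sub (MulAction.orbit G b)ᶜ hC
    let iC : C →[G] B := B.subIncl _ hC
    have hiO : ∀ x : O.toFinGSet, iO x ∈ MulAction.orbit G b := fun x => x.2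
    have hiC : ∀ x : C, iC x ∉ MulAction.orbit G b := fun x => x.2
    have hcard : Nat.card C ≤ n := by
      have h1 : Nat.card C < Nat.card B :=
        Finite.card_subtype_lt (x := b) (p := fun x => x ∈ (MulAction.orbit G b)ᶜ)
          (fun h => h (MulAction.mem_orbit_self b))
      omega
    let ι := copair iO iC
    have hι : Function.Bijective ι := by
      constructor
      · rintro (x | x) (y | y) e
        · exact congrArg Sum.inl (Subtype.ext e)
        · exact (hiC y (by rw [← show iO x = iC y from e]; exact hiO x)).elim
        · exact (hiC x (by rw [show iC x = iO y from e]; exact hiO y)).elim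
        · exact congrArg Sum.inr (Subtype.ext e)
      · intro x
        by_cases hx : x ∈ MulAction.orbit G b
        · exact ⟨Sum.inl ⟨x, hx⟩, rfl⟩
        · exact ⟨Sum.inr ⟨x, hx⟩, rfl⟩
    have hm : M.res ι m = M.glue (M.res iO m) (M.res iC m) := by
      apply M.eq_glue
      · rw [← M.res_comp]; rfl
      · rw [← M.res_comp]; rfl
    have h1 : M.tr r m = M.tr (r.comp iO) (M.res iO m) + M.tr (r.comp iC) (M.res iC m) := by
      conv_lhs => rw [← M.tr_res_self ι hι m]
      rw [← M.tr_comp, hm, show r.comp ι = copair (r.comp iO) (r.comp iC) from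
        MulActionHom.ext (by rintro (x | x) <;> rfl), M.tr_copair_glue]
      rfl
    let Φ : Sections (r.comp iO) ⊕ Sections (r.comp iC) → Sections r :=
      Sum.elim (fun s => ⟨iO.comp s.1, s.2⟩) (fun s => ⟨iC.comp s.1, s.2⟩)
    have hΦ : Function.Bijective Φ := by
      obtain ⟨u0⟩ := U.nonempty
      constructor
      · rintro (s | s) (t | t) e
        · refine congrArg Sum.inl (Subtype.ext (MulActionHom.ext fun y => Subtype.ext ?_))
          exact DFunLike.congr_fun (congrArg Subtype.val e) y
        · have : iO (s.1 u0) = iC (t.1 u0) := DFunLike.congr_fun (congrArg Subtype.val e) u0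
          exact (hiC (t.1 u0) (by rw [← this]; exact hiO _)).elim
        · have : iC (s.1 u0) = iO (t.1 u0) := DFunLike.congr_fun (congrArg Subtype.val e) u0
          exact (hiC (s.1 u0) (by rw [this]; exact hiO _)).elim
        · refine congrArg Sum.inr (Subtype.ext (MulActionHom.ext fun y => Subtype.ext ?_))
          exact DFunLike.congr_fun (congrArg Subtype.val e) y
      · intro s
        by_cases hs : s.1 u0 ∈ MulAction.orbit G b
        · have hs' : ∀ y, s.1 y ∈ MulAction.orbit G b := by
            intro y
            obtain ⟨γ, rfl⟩ := MulAction.exists_smul_eq G u0 y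
            rw [map_smul]
            exact Orb.orbit_smul_mem b γ _ hs
          refine ⟨Sum.inl ⟨⟨fun y => ⟨s.1 y, hs' y⟩, fun γ y => Subtype.ext (map_smul s.1 γ y)⟩,
            s.2⟩, rfl⟩
        · have hs' : ∀ y, s.1 y ∈ (MulAction.orbit G b)ᶜ := by
            intro y
            obtain ⟨γ, rfl⟩ := MulAction.exists_smul_eq G u0 y
            rw [map_smul]
            exact hC γ _ hs
          refine ⟨Sum.inr ⟨⟨fun y => ⟨s.1 y, hs' y⟩, fun γ y => Subtype.ext (map_smul s.1 γ y)⟩,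
            s.2⟩, rfl⟩
    rw [h1, map_add, M.mk_tr_orbit (r.comp iO), ih C hcard (r.comp iC),
      ← (Equiv.ofBijective Φ hΦ).sum_comp, Fintype.sum_sum_type]
    congr 1
    · refine Finset.sum_congr rfl fun s _ => congrArg _ ?_
      exact (M.res_comp iO s.1 m).symm
    · refine Finset.sum_congr rfl fun s _ => congrArg _ ?_
      exact (M.res_comp iC s.1 m).symm

end MackeyFunctor

namespace TambaraFunctor

open FinGSet

variable {G : Type u} [Group G] (S : TambaraFunctor.{u, w} G)

theorem qCon_mul_right {U : Orb.{u} G} (c : S.obj U.toFinGSet) {a b : S.obj U.toFinGSet}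
    (h : S.qCon U a b) : S.qCon U (a * c) (b * c) := by
  let φ : S.obj U.toFinGSet →+ (S.qCon U).Quotient :=
    (S.qCon U).mk'.comp
      { toFun := fun a => a * c, map_zero' := zero_mul c, map_add' := fun a b => add_mul a b c }
  have hφ : S.qCon U ≤ AddCon.ker φ := by
    refine S.qCon_le_ker φ fun V f hf n => ?_
    rw [← S.mk_tr_eq_zero f hf (n * S.res (Orb.toMap f) c), ← S.tr_mul]
    rfl
  exact (AddCon.eq _).1 (hφ h)

/-- The congruence `qCon` is compatible with multiplication. -/
noncomputable def qRingCon (U : Orb.{u} G) : RingCon (S.obj U.toFinGSet) where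
  toSetoid := (S.qCon U).toSetoid
  add' := (S.qCon U).add'
  mul' {a b c d} h1 h2 := by
    refine (S.qCon U).trans (S.qCon_mul_right c h1) ?_
    rw [mul_comm b c, mul_comm b d]
    exact S.qCon_mul_right b h2

theorem qRingCon_eq {U : Orb.{u} G} {a b : S.obj U.toFinGSet} :
    (S.qRingCon U).mk' a = (S.qRingCon U).mk' b ↔ (S.qCon U).mk' a = (S.qCon U).mk' b :=
  Iff.rfl

/-- The norm of a transfer, modulo transfers along non-isomorphisms. -/
theorem mk_nm_tr {T U : Orb.{u} G} {X : FinGSet.{u} G} (f : T.toFinGSet →[G] U.toFinGSet)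
    (g : X →[G] T.toFinGSet) (m : S.obj X) :
    (S.qCon U).mk' (S.nm f (S.tr g m)) =
      ∑ k : Sections g, (S.qCon U).mk' (S.nm f (S.res k.1 m)) := by
  let Ψ : Sections (distR g f) → Sections g := fun s =>
    { val :=
        { toFun := fun t => (s.1 (f t)).sec t (s.2 (f t)).symm
          map_smul' := fun γ t => by
            have h1 : s.1 (f (γ • t)) = γ • s.1 (f t) := by rw [map_smul, map_smul]
            refine (DistPt.sec_congr_pt h1 _ _
              (((congrArg DistPt.base h1).symm.trans (s.2 _)).symm)).trans ?_
            refine (DistPt.smul_sec γ (s.1 (f t)) (γ • t) _).trans ?_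
            exact congrArg (γ • ·) (DistPt.sec_congr _ (inv_smul_smul γ t) _ _) }
      property := fun t => (s.1 (f t)).sec_spec t _ }
  have hΨ : Function.Bijective Ψ := by
    constructor
    · intro s s' e
      refine Subtype.ext (MulActionHom.ext fun u => ?_)
      refine DistPt.ext' ((s.2 u).trans (s'.2 u).symm) fun t ht ht' => ?_
      have hu : f t = u := ht.trans (s.2 u)
      subst hu
      exact DFunLike.congr_fun (congrArg Subtype.val e) t
    · intro k
      refine ⟨⟨⟨fun u => ⟨u, fun t _ => k.1 t, fun t _ => k.2 t⟩, fun γ u => ?_⟩, fun u => rfl⟩, ?_⟩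
      · refine DistPt.ext' rfl fun t ht ht' => ?_
        refine Eq.trans ?_ (map_smul k.1 γ (γ⁻¹ • t))
        exact congrArg k.1 (smul_inv_smul γ t).symm
      · exact Subtype.ext (MulActionHom.ext fun t => rfl)
  rw [S.nm_tr, S.mk_tr U _ _ le_rfl, ← (Equiv.ofBijective Ψ hΨ).sum_comp]
  refine Finset.sum_congr rfl fun s _ => congrArg _ ?_
  let k2 : T.toFinGSet →[G] distA g f :=
    { toFun := fun t => ⟨(t, s.1 (f t)), (s.2 (f t)).symm⟩
      map_smul' := fun γ t => Subtype.ext (Prod.ext rfl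
        ((congrArg s.1 (map_smul f γ t)).trans (map_smul s.1 γ (f t)))) }
  have hk : IsCartesian k2 f (distQ g f) s.1 :=
    { comm := fun _ => rfl
      lift := by
        rintro ⟨⟨t, b⟩, ht⟩ u (hb : b = s.1 u)
        subst hb
        obtain rfl : f t = u := ht.trans (s.2 u)
        exact ⟨t, ⟨rfl, rfl⟩, fun t' h => congrArg (fun a => a.1.1) h.1⟩ }
  rw [← S.nm_res hk, ← S.res_comp]
  rfl

theorem mk_nm_zero {T U : Orb.{u} G} (f : T.toFinGSet →[G] U.toFinGSet) :
    (S.qCon U).mk' (S.nm f 0) = 0 := by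
  have : IsEmpty (Sections (fromEmpty T.toFinGSet)) :=
    ⟨fun s => (s.1 (Classical.arbitrary T.toFinGSet)).elim⟩
  rw [S.zero_def, S.mk_nm_tr, Fintype.sum_empty]

theorem mk_nm_add {T U : Orb.{u} G} (f : T.toFinGSet →[G] U.toFinGSet)
    (a b : S.obj T.toFinGSet) :
    (S.qCon U).mk' (S.nm f (a + b)) = (S.qCon U).mk' (S.nm f a) + (S.qCon U).mk' (S.nm f b) := by
  classical
  let Φ : Bool → Sections (fold T.toFinGSet) := fun i =>
    bif i then ⟨inl _ _, fun _ => rfl⟩ else ⟨inr _ _, fun _ => rfl⟩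
  obtain ⟨t0⟩ := T.nonempty
  have hΦ : Function.Bijective Φ := by
    constructor
    · rintro (_ | _) (_ | _) e
      · rfl
      · cases DFunLike.congr_fun (congrArg Subtype.val e) t0
      · cases DFunLike.congr_fun (congrArg Subtype.val e) t0
      · rfl
    · intro s
      have h0 := s.2 t0
      rcases hs : s.1 t0 with t | t
      · refine ⟨true, Subtype.ext (Orb.hom_ext_of_apply t0 ?_)⟩
        rw [hs] at h0
        exact (congrArg Sum.inl (Eq.symm h0)).trans hs.symm
      · refine ⟨false, Subtype.ext (Orb.hom_ext_of_apply t0 ?_)⟩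
        rw [hs] at h0
        exact (congrArg Sum.inr (Eq.symm h0)).trans hs.symm
  rw [S.add_def, S.mk_nm_tr, ← (Equiv.ofBijective Φ hΦ).sum_comp, Fintype.sum_bool]
  congr 3
  · exact S.res_inl_glue a b
  · exact S.res_inr_glue a b

/-- The semiring map `S(T) → qS(U)` given by the norm of `f : T → U`. -/
noncomputable def mkNm {T U : Orb.{u} G} (f : T ⟶ U) :
    S.obj T.toFinGSet →+* (S.qRingCon U).Quotient where
  toFun m := (S.qRingCon U).mk' (S.nm (Orb.toMap f) m)
  map_zero' := S.mk_nm_zero (Orb.toMap f)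
  map_add' := S.mk_nm_add (Orb.toMap f)
  map_one' := by rw [S.nm_one, map_one]
  map_mul' a b := by rw [S.nm_mul, map_mul]

theorem mkNm_tr {T U V : Orb.{u} G} (f : T ⟶ U) (g : V ⟶ T) (hg : ¬ IsIso g)
    (n : S.obj V.toFinGSet) : S.mkNm f (S.tr (Orb.toMap g) n) = 0 := by
  refine (S.mk_nm_tr (Orb.toMap f) (Orb.toMap g) n).trans ?_
  have : IsEmpty (Sections (Orb.toMap g)) := by
    refine ⟨fun s => hg ((Orb.isIso_iff g).2 ⟨fun x y e => ?_, Orb.surjective (Orb.toMap g)⟩)⟩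
    obtain ⟨x', rfl⟩ := Orb.surjective s.1 x
    obtain ⟨y', rfl⟩ := Orb.surjective s.1 y
    rw [s.2, s.2] at e
    rw [e]
  rw [Fintype.sum_empty]
  rfl

theorem qRingCon_le_ker {T : Orb.{u} G} {P : Type*} [CommSemiring P] (φ : S.obj T.toFinGSet →+* P)
    (hφ : ∀ (V : Orb.{u} G) (g : V ⟶ T), ¬ IsIso g → ∀ n, φ (S.tr (Orb.toMap g) n) = 0)
    {a b : S.obj T.toFinGSet} (h : S.qRingCon T a b) : φ a = φ b :=
  S.qCon_le_ker (U := T) φ.toAddMonoidHom hφ h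

/-- The norm map on quotients. -/
noncomputable def qNm {T U : Orb.{u} G} (f : T ⟶ U) :
    (S.qRingCon T).Quotient →+* (S.qRingCon U).Quotient :=
  (S.qRingCon T).lift (S.mkNm f) fun _ _ h =>
    S.qRingCon_le_ker (S.mkNm f) (fun _ g hg n => S.mkNm_tr f g hg n) h

theorem qNm_mk {T U : Orb.{u} G} (f : T ⟶ U) (m : S.obj T.toFinGSet) :
    S.qNm f ((S.qRingCon T).mk' m) = (S.qRingCon U).mk' (S.nm (Orb.toMap f) m) := rfl

/-- The multiplicative coefficient system `qS`. -/
noncomputable def toMCSys : MCSys.{u, w} G where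
  obj U := CommSemiRingCat.of (S.qRingCon U).Quotient
  map f := CommSemiRingCat.ofHom (S.qNm f)
  map_id U := by
    ext m
    exact congrArg _ (S.nm_id m)
  map_comp f g := by
    ext m
    exact congrArg _ (S.nm_comp (Orb.toMap g) (Orb.toMap f) m)

/-- The map on quotients induced by a morphism of Tambara functors. -/
noncomputable def Hom.qRingMap {S S' : TambaraFunctor.{u, w} G} (φ : Hom S S') (U : Orb.{u} G) :
    (S.qRingCon U).Quotient →+* (S'.qRingCon U).Quotient :=
  (S.qRingCon U).lift ((S'.qRingCon U).mk'.comp (φ.appRingHom U.toFinGSet)) fun _ _ h =>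
    S.qRingCon_le_ker ((S'.qRingCon U).mk'.comp (φ.appRingHom U.toFinGSet)) (fun V g hg n => by
      refine Eq.trans ?_ (S'.mk_tr_eq_zero g hg (φ.app _ n))
      exact congrArg (S'.qRingCon U).mk' (φ.app_tr (Orb.toMap g) n)) h

/-- The functor `q` from Tambara functors to multiplicative coefficient systems. -/
noncomputable def q (G : Type u) [Group G] : TambaraFunctor.{u, w} G ⥤ MCSys.{u, w} G where
  obj S := S.toMCSys
  map {S S'} φ :=
    { app := fun U => CommSemiRingCat.ofHom (Hom.qRingMap φ U)
      naturality := fun U V f => by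
        ext x
        obtain ⟨m, rfl⟩ := RingCon.mk'_surjective _ x
        exact congrArg (S'.qRingCon V).mk' (Hom.app_nm φ (Orb.toMap f) m) }
  map_id S := by
    ext U x
    obtain ⟨m, rfl⟩ := RingCon.mk'_surjective _ x
    rfl
  map_comp φ ψ := by
    ext U x
    obtain ⟨m, rfl⟩ := RingCon.mk'_surjective _ x
    rfl

end TambaraFunctor

namespace MackeyFunctor

variable {G : Type u} [Group G]

/-- Transport of a Mackey functor along bijections of its values with types in another universe. -/
noncomputable def shrink (M : MackeyFunctor.{u, v} G) [∀ X, Small.{w} (M.obj X)] :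
    MackeyFunctor.{u, w} G where
  obj X := Shrink.{w} (M.obj X)
  res f m := equivShrink _ (M.res f ((equivShrink _).symm m))
  tr f m := equivShrink _ (M.tr f ((equivShrink _).symm m))
  res_id m := by rw [M.res_id, Equiv.apply_symm_apply]
  res_comp g f m := by rw [M.res_comp, Equiv.symm_apply_apply]
  tr_id m := by rw [M.tr_id, Equiv.apply_symm_apply]
  tr_comp g f m := by rw [M.tr_comp, Equiv.symm_apply_apply]
  tr_res h m := by rw [Equiv.symm_apply_apply, Equiv.symm_apply_apply, M.tr_res h]
  coprod_bijective X Y := by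
    have h := M.coprod_bijective X Y
    exact (((equivShrink (M.obj X)).prodCongr (equivShrink (M.obj Y))).bijective.comp h).comp
      (equivShrink _).symm.bijective
  existsUnique_empty := ⟨equivShrink _ M.pt, trivial, fun m _ => by
    rw [← M.eq_pt ((equivShrink _).symm m), Equiv.apply_symm_apply]⟩

/-- Transport of a morphism of Mackey functors. -/
noncomputable def Hom.shrink {M M' : MackeyFunctor.{u, v} G} [∀ X, Small.{w} (M.obj X)]
    [∀ X, Small.{w} (M'.obj X)] (φ : Hom M M') : Hom M.shrink.{u, v, w} M'.shrink.{u, v, w} where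
  app X m := equivShrink.{w} (M'.obj X) (φ.app X ((equivShrink.{w} (M.obj X)).symm m))
  app_res {X Y} f m := by
    change equivShrink.{w} (M'.obj X) (φ.app X ((equivShrink.{w} (M.obj X)).symm
      (equivShrink.{w} (M.obj X) _))) = equivShrink.{w} (M'.obj X) (M'.res f
      ((equivShrink.{w} (M'.obj Y)).symm (equivShrink.{w} (M'.obj Y) _)))
    rw [Equiv.symm_apply_apply, Equiv.symm_apply_apply, φ.app_res]
  app_tr {X Y} f m := by
    change equivShrink.{w} (M'.obj Y) (φ.app Y ((equivShrink.{w} (M.obj Y)).symm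
      (equivShrink.{w} (M.obj Y) _))) = equivShrink.{w} (M'.obj Y) (M'.tr f
      ((equivShrink.{w} (M'.obj X)).symm (equivShrink.{w} (M'.obj X) _)))
    rw [Equiv.symm_apply_apply, Equiv.symm_apply_apply, φ.app_tr]

theorem Hom.shrink_id (M : MackeyFunctor.{u, v} G) [∀ X, Small.{w} (M.obj X)] :
    Hom.shrink.{u, v, w} (𝟙 M : M ⟶ M) = 𝟙 M.shrink.{u, v, w} :=
  Hom.ext (funext fun X => funext fun m => (equivShrink.{w} (M.obj X)).apply_symm_apply m)

theorem Hom.shrink_comp {M M' M'' : MackeyFunctor.{u, v} G} [∀ X, Small.{w} (M.obj X)]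
    [∀ X, Small.{w} (M'.obj X)] [∀ X, Small.{w} (M''.obj X)] (φ : M ⟶ M') (ψ : M' ⟶ M'') :
    Hom.shrink.{u, v, w} (φ ≫ ψ) = (show M.shrink.{u, v, w} ⟶ M'.shrink from Hom.shrink φ) ≫
      (show M'.shrink.{u, v, w} ⟶ M''.shrink from Hom.shrink ψ) := by
  refine Hom.ext (funext fun X => funext fun m => ?_)
  change _ = equivShrink.{w} (M''.obj X) (Hom.app ψ X
    ((equivShrink.{w} (M'.obj X)).symm (equivShrink.{w} (M'.obj X) _)))
  rw [Equiv.symm_apply_apply]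
  rfl

end MackeyFunctor

namespace CSys

open FinGSet

variable {G : Type u} [Group G] (N : CSys.{u, w} G) {X Y Z : FinGSet.{u} G}

/-- The map `f_* : N(U) → N(V)` induced by an isomorphism `f : U → V`. -/
def push {U V : Orb.{u} G} (e : U ≅ V) : N.obj ⟨U⟩ →+ N.obj ⟨V⟩ :=
  (N.map (CoreHom.mk e : (⟨U⟩ : Core (Orb.{u} G)) ⟶ ⟨V⟩)).hom

/-- The inverse limit of `N(U)` over the category of all pairs `(U, x)`, where `U` is a transitive
`G`-set and `x : U → X` is an equivariant map, and all isomorphisms between such pairs. -/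
def Fam (X : FinGSet.{u} G) : Type (max (u + 1) w) :=
  {n : ∀ U : Orb.{u} G, (U.toFinGSet →[G] X) → N.obj ⟨U⟩ //
    ∀ (U V : Orb.{u} G) (e : U ≅ V) (x : V.toFinGSet →[G] X),
      N.push e (n U (x.comp (Orb.toMap e.hom))) = n V x}

variable {N}

theorem Fam.ext {m n : N.Fam X} (h : ∀ U x, m.1 U x = n.1 U x) : m = n :=
  Subtype.ext (funext fun U => funext fun x => h U x)

/-- The set of lifts of `y : U → Y` along `f : X → Y`. -/
def Lifts {U : FinGSet.{u} G} (f : X →[G] Y) (y : U →[G] Y) : Type u :=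
  {x : U →[G] X // f.comp x = y}

noncomputable instance {U : FinGSet.{u} G} (f : X →[G] Y) (y : U →[G] Y) : Fintype (Lifts f y) :=
  @Fintype.ofFinite _ (inferInstanceAs (Finite {x : U →[G] X // f.comp x = y}))

/-- The restriction `(R_f n)(U, x) = n(U, f x)`. -/
def Fam.res (f : X →[G] Y) (n : N.Fam Y) : N.Fam X :=
  ⟨fun U x => n.1 U (f.comp x), fun U V e x => n.2 U V e (f.comp x)⟩

/-- The transfer: `(T_f m)(U, y)` is the sum of `m(U, x)` over all lifts `x` of `y` along `f`. -/
noncomputable def Fam.tr (f : X →[G] Y) (m : N.Fam X) : N.Fam Y :=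
  ⟨fun U y => ∑ x : Lifts f y, m.1 U x.1, fun U V e y => by
    rw [map_sum]
    let Φ : Lifts f y → Lifts f (y.comp (Orb.toMap e.hom)) := fun x =>
      ⟨x.1.comp (Orb.toMap e.hom), congrArg (fun z => z.comp (Orb.toMap e.hom)) x.2⟩
    have hΦ : Function.Bijective Φ := by
      have he := Orb.bijective e
      constructor
      · intro x x' h
        refine Subtype.ext (MulActionHom.ext fun v => ?_)
        obtain ⟨u, rfl⟩ := he.2 v
        exact DFunLike.congr_fun (congrArg Subtype.val h) u
      · intro x
        refine ⟨⟨x.1.comp (FinGSet.inv _ he), MulActionHom.ext fun v => ?_⟩,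
          Subtype.ext (MulActionHom.ext fun u => ?_)⟩
        · refine (DFunLike.congr_fun x.2 (FinGSet.inv _ he v)).trans ?_
          exact congrArg y (FinGSet.apply_inv _ he v)
        · exact congrArg x.1 (FinGSet.inv_apply _ he u)
    rw [← (Equiv.ofBijective Φ hΦ).sum_comp]
    exact Finset.sum_congr rfl fun x _ => m.2 U V e x.1⟩

theorem Fam.tr_id (m : N.Fam X) : Fam.tr (MulActionHom.id G) m = m := by
  refine Fam.ext fun U y => ?_
  let _ : Unique (Lifts (MulActionHom.id G : X →[G] X) y) :=
    ⟨⟨⟨y, rfl⟩⟩, fun x => Subtype.ext x.2⟩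
  exact Fintype.sum_unique _

theorem Fam.tr_comp (g : Y →[G] Z) (f : X →[G] Y) (m : N.Fam X) :
    Fam.tr (g.comp f) m = Fam.tr g (Fam.tr f m) := by
  refine Fam.ext fun U z => ?_
  let Φ : (Σ y : Lifts g z, Lifts f y.1) → Lifts (g.comp f) z := fun p =>
    ⟨p.2.1, by
      change g.comp (f.comp p.2.1) = z
      rw [show f.comp p.2.1 = p.1.1 from p.2.2]
      exact p.1.2⟩
  have hΦ : Function.Bijective Φ := by
    constructor
    · rintro ⟨⟨y, hy⟩, ⟨x, hx⟩⟩ ⟨⟨y', hy'⟩, ⟨x', hx'⟩⟩ e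
      obtain rfl : x = x' := congrArg Subtype.val e
      obtain rfl : f.comp x = y := hx
      obtain rfl : f.comp x = y' := hx'
      rfl
    · rintro ⟨x, rfl⟩
      exact ⟨⟨⟨f.comp x, rfl⟩, ⟨x, rfl⟩⟩, rfl⟩
  refine ((Equiv.ofBijective Φ hΦ).sum_comp _).symm.trans ?_
  exact Fintype.sum_sigma _

theorem Fam.tr_res {W : FinGSet.{u} G} {f : W →[G] X} {g : W →[G] Y} {h : X →[G] Z}
    {k : Y →[G] Z} (hc : IsCartesian f g h k) (m : N.Fam X) :
    Fam.tr g (Fam.res f m) = Fam.res k (Fam.tr h m) := by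
  refine Fam.ext fun U y => ?_
  let Φ : Lifts g y → Lifts h (k.comp y) := fun w =>
    ⟨f.comp w.1, MulActionHom.ext fun u => (hc.comm (w.1 u)).trans
      (congrArg k (DFunLike.congr_fun w.2 u))⟩
  have hΦ : Function.Bijective Φ := by
    constructor
    · intro w w' e
      refine Subtype.ext (MulActionHom.ext fun u => ?_)
      have h1 : f (w.1 u) = f (w'.1 u) := DFunLike.congr_fun (congrArg Subtype.val e) u
      have h2 : g (w.1 u) = g (w'.1 u) :=
        (DFunLike.congr_fun w.2 u).trans (DFunLike.congr_fun w'.2 u).symm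
      exact (hc.lift _ _ (hc.comm (w.1 u))).unique ⟨rfl, rfl⟩ ⟨h1.symm, h2.symm⟩
    · intro x
      have hx : ∀ u, ∃! w, f w = x.1 u ∧ g w = y u := fun u =>
        hc.lift _ _ (DFunLike.congr_fun x.2 u)
      choose w hw1 hw2 using hx
      refine ⟨⟨⟨w, fun γ u => ?_⟩, MulActionHom.ext fun u => (hw1 u).2⟩,
        Subtype.ext (MulActionHom.ext fun u => (hw1 u).1)⟩
      refine (hw2 (γ • u) (γ • w u) ⟨?_, ?_⟩).symm
      · exact (map_smul f γ _).trans ((congrArg (γ • ·) (hw1 u).1).trans (map_smul x.1 γ u).symm)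
      · exact (map_smul g γ _).trans ((congrArg (γ • ·) (hw1 u).2).trans (map_smul y γ u).symm)
  exact (Equiv.ofBijective Φ hΦ).sum_comp (fun x => m.1 U x.1)

theorem exists_factor {U : Orb.{u} G} (x : U.toFinGSet →[G] coprod X Y) :
    (∃ a, (inl X Y).comp a = x) ∨ ∃ b, (inr X Y).comp b = x := by
  obtain ⟨u0⟩ := U.nonempty
  rcases h : x u0 with a | b
  · left
    have hx : ∀ u, ∃ a, Sum.inl a = x u := by
      intro u
      obtain ⟨γ, rfl⟩ := MulAction.exists_smul_eq G u0 u
      exact ⟨γ • a, ((map_smul x γ u0).trans (congrArg (γ • ·) h)).symm⟩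
    choose a ha using hx
    exact ⟨⟨a, fun γ u => Sum.inl_injective ((ha (γ • u)).trans ((map_smul x γ u).trans
      (congrArg (γ • ·) (ha u).symm)))⟩, MulActionHom.ext ha⟩
  · right
    have hx : ∀ u, ∃ b, Sum.inr b = x u := by
      intro u
      obtain ⟨γ, rfl⟩ := MulAction.exists_smul_eq G u0 u
      exact ⟨γ • b, ((map_smul x γ u0).trans (congrArg (γ • ·) h)).symm⟩
    choose b hb using hx
    exact ⟨⟨b, fun γ u => Sum.inr_injective ((hb (γ • u)).trans ((map_smul x γ u).trans
      (congrArg (γ • ·) (hb u).symm)))⟩, MulActionHom.ext hb⟩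

theorem Fam.coprod_bijective (X Y : FinGSet.{u} G) : Function.Bijective
    fun m : N.Fam (coprod X Y) => (Fam.res (inl X Y) m, Fam.res (inr X Y) m) := by
  classical
  constructor
  · intro m m' e
    refine Fam.ext fun U x => ?_
    rcases exists_factor x with ⟨a, rfl⟩ | ⟨b, rfl⟩
    · exact congrFun (congrFun (congrArg (fun p => p.1.1) e) U) a
    · exact congrFun (congrFun (congrArg (fun p => p.2.1) e) U) b
  · rintro ⟨m, n⟩
    let val : ∀ U : Orb.{u} G, (U.toFinGSet →[G] coprod X Y) → N.obj ⟨U⟩ := fun U x =>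
      if h : ∃ a, (inl X Y).comp a = x then m.1 U h.choose
      else if h : ∃ b, (inr X Y).comp b = x then n.1 U h.choose else 0
    have hl : ∀ U (a : U.toFinGSet →[G] X), val U ((inl X Y).comp a) = m.1 U a := by
      intro U a
      have h : ∃ a', (inl X Y).comp a' = (inl X Y).comp a := ⟨a, rfl⟩
      refine (dif_pos h).trans (congrArg (m.1 U) (MulActionHom.ext fun u => ?_))
      exact Sum.inl_injective (DFunLike.congr_fun h.choose_spec u)
    have hr : ∀ U (b : U.toFinGSet →[G] Y), val U ((inr X Y).comp b) = n.1 U b := by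
      intro U b
      have h0 : ¬ ∃ a', (inl X Y).comp a' = (inr X Y).comp b := by
        rintro ⟨a', h⟩
        cases DFunLike.congr_fun h (Classical.arbitrary U.toFinGSet)
      have h : ∃ b', (inr X Y).comp b' = (inr X Y).comp b := ⟨b, rfl⟩
      refine (dif_neg h0).trans ((dif_pos h).trans
        (congrArg (n.1 U) (MulActionHom.ext fun u => ?_)))
      exact Sum.inr_injective (DFunLike.congr_fun h.choose_spec u)
    refine ⟨⟨val, fun U V e x => ?_⟩, Prod.ext (Fam.ext hl) (Fam.ext hr)⟩
    rcases exists_factor x with ⟨a, rfl⟩ | ⟨b, rfl⟩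
    · exact (congrArg (N.push e) (hl U (a.comp (Orb.toMap e.hom)))).trans
        ((m.2 U V e a).trans (hl V a).symm)
    · exact (congrArg (N.push e) (hr U (b.comp (Orb.toMap e.hom)))).trans
        ((n.2 U V e b).trans (hr V b).symm)

theorem Fam.existsUnique_empty : ∃! _m : N.Fam (FinGSet.empty G), True := by
  refine ⟨⟨fun U x => (x (Classical.arbitrary U.toFinGSet)).elim, fun U V e x =>
    (x (Classical.arbitrary V.toFinGSet)).elim⟩, trivial, fun m _ => Fam.ext fun U x =>
    (x (Classical.arbitrary U.toFinGSet)).elim⟩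

variable (N) in
/-- The Mackey functor `X ↦ N.Fam X`. -/
noncomputable def famMackey : MackeyFunctor.{u, max (u + 1) w} G where
  obj X := N.Fam X
  res := Fam.res
  tr := Fam.tr
  res_id _ := rfl
  res_comp _ _ _ := rfl
  tr_id := Fam.tr_id
  tr_comp := Fam.tr_comp
  tr_res := Fam.tr_res
  coprod_bijective := Fam.coprod_bijective
  existsUnique_empty := Fam.existsUnique_empty

/-- The transitive `G`-set `G/H`. -/
def _root_.Orb.coset [Finite G] (H : Subgroup G) : Orb.{u} G where
  toFinGSet := ⟨G ⧸ H⟩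
  nonempty := inferInstanceAs (Nonempty (G ⧸ H))
  isPretransitive := inferInstanceAs (MulAction.IsPretransitive G (G ⧸ H))

theorem _root_.Orb.exists_coset_iso [Finite G] (U : Orb.{u} G) :
    ∃ H : Subgroup G, Nonempty (Orb.coset H ≅ U) := by
  obtain ⟨x⟩ := U.nonempty
  let f : (Orb.coset (MulAction.stabilizer G x)).toFinGSet →[G] U.toFinGSet :=
    ⟨MulAction.ofQuotientStabilizer G x, fun γ y => MulAction.ofQuotientStabilizer_smul G x γ y⟩
  exact ⟨_, ⟨Orb.isoOfBijective f
    ⟨MulAction.injective_ofQuotientStabilizer G x, Orb.surjective f⟩⟩⟩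

instance [Finite G] (X : FinGSet.{u} G) : Small.{w} (N.famMackey.obj X) := by
  let φ : N.Fam X → ∀ (H : Subgroup G), ((Orb.coset H).toFinGSet →[G] X) → N.obj ⟨Orb.coset H⟩ :=
    fun n H x => n.1 (Orb.coset H) x
  refine small_of_injective (f := φ) fun m n e => Fam.ext fun U x => ?_
  obtain ⟨H, ⟨i⟩⟩ := U.exists_coset_iso
  rw [← m.2 _ _ i x, ← n.2 _ _ i x]
  exact congrArg (N.push i) (congrFun (congrFun e H) _)

theorem push_naturality {N N' : CSys.{u, w} G} (α : N ⟶ N') {U V : Orb.{u} G} (e : U ≅ V)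
    (a : N.obj ⟨U⟩) :
    (α.app ⟨V⟩).hom (N.push e a) = N'.push e ((α.app ⟨U⟩).hom a) :=
  ConcreteCategory.congr_hom
    (α.naturality (CoreHom.mk e : (⟨U⟩ : Core (Orb.{u} G)) ⟶ ⟨V⟩)) a

/-- The map of families induced by a morphism of coefficient systems. -/
def Fam.map {N N' : CSys.{u, w} G} (α : N ⟶ N') (n : N.Fam X) : N'.Fam X :=
  ⟨fun U x => (α.app ⟨U⟩).hom (n.1 U x), fun U V e x => by
    rw [← push_naturality, n.2 U V e x]⟩

/-- The morphism of Mackey functors induced by a morphism of coefficient systems. -/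
def famMap {N N' : CSys.{u, w} G} (α : N ⟶ N') : MackeyFunctor.Hom N.famMackey N'.famMackey where
  app _ := Fam.map α
  app_res _ _ := rfl
  app_tr _ _ := Fam.ext fun _ _ => map_sum _ _ _

/-- The functor `r` from coefficient systems to Mackey functors. Up to the bijections `equivShrink`,
the set `(r N)(X)` is the inverse limit `N.Fam X`, with the restrictions `Fam.res` and the transfers
`Fam.tr`. -/
noncomputable def r (G : Type u) [Group G] [Finite G] :
    CSys.{u, w} G ⥤ MackeyFunctor.{u, w} G where
  obj N := N.famMackey.shrink
  map α := (famMap α).shrink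
  map_id N := MackeyFunctor.Hom.shrink_id N.famMackey
  map_comp α β := MackeyFunctor.Hom.shrink_comp (famMap α) (famMap β)

end CSys

namespace TambaraFunctor

variable {G : Type u} [Group G]

/-- Transport of a Tambara functor along bijections of its values with types in another universe. -/
noncomputable def shrink (S : TambaraFunctor.{u, v} G) [∀ X, Small.{w} (S.obj X)] :
    TambaraFunctor.{u, w} G where
  toMackeyFunctor := S.toMackeyFunctor.shrink
  nm f m := equivShrink _ (S.nm f ((equivShrink _).symm m))
  nm_id {X} m := (congrArg (equivShrink _) (S.nm_id _)).trans
    ((equivShrink.{w} (S.obj X)).apply_symm_apply m)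
  nm_comp g f m := by rw [Equiv.symm_apply_apply, S.nm_comp]
  nm_res {W X Y Z f g h k} hc m := by
    change equivShrink _ (S.nm g ((equivShrink _).symm (equivShrink _ _))) =
      equivShrink _ (S.res k ((equivShrink _).symm (equivShrink _ _)))
    rw [Equiv.symm_apply_apply, Equiv.symm_apply_apply, S.nm_res hc]
  nm_tr g h m := by
    change equivShrink _ (S.nm h ((equivShrink _).symm (equivShrink _ _))) =
      equivShrink _ (S.tr _ ((equivShrink _).symm (equivShrink _ (S.nm _ ((equivShrink _).symm
        (equivShrink _ _))))))
    rw [Equiv.symm_apply_apply, Equiv.symm_apply_apply, Equiv.symm_apply_apply, S.nm_tr]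

/-- Transport of a morphism of Tambara functors. -/
noncomputable def Hom.shrink {S S' : TambaraFunctor.{u, v} G} [∀ X, Small.{w} (S.obj X)]
    [∀ X, Small.{w} (S'.obj X)] (φ : Hom S S') :
    TambaraFunctor.Hom S.shrink.{u, v, w} S'.shrink.{u, v, w} where
  toHom := MackeyFunctor.Hom.shrink.{u, v, w} φ.toHom
  app_nm {X Y} f m := by
    change equivShrink.{w} (S'.obj Y) (φ.app Y ((equivShrink.{w} (S.obj Y)).symm
      (equivShrink.{w} (S.obj Y) _))) = equivShrink.{w} (S'.obj Y) (S'.nm f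
      ((equivShrink.{w} (S'.obj X)).symm (equivShrink.{w} (S'.obj X) _)))
    rw [Equiv.symm_apply_apply, Equiv.symm_apply_apply, φ.app_nm]

theorem Hom.shrink_id (S : TambaraFunctor.{u, v} G) [∀ X, Small.{w} (S.obj X)] :
    Hom.shrink.{u, v, w} (𝟙 S : S ⟶ S) = 𝟙 S.shrink.{u, v, w} :=
  Hom.ext (funext fun X => funext fun m => (equivShrink.{w} (S.obj X)).apply_symm_apply m)

theorem Hom.shrink_comp {S S' S'' : TambaraFunctor.{u, v} G} [∀ X, Small.{w} (S.obj X)]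
    [∀ X, Small.{w} (S'.obj X)] [∀ X, Small.{w} (S''.obj X)] (φ : S ⟶ S') (ψ : S' ⟶ S'') :
    Hom.shrink.{u, v, w} (φ ≫ ψ) = (show S.shrink.{u, v, w} ⟶ S'.shrink from Hom.shrink φ) ≫
      (show S'.shrink.{u, v, w} ⟶ S''.shrink from Hom.shrink ψ) := by
  refine Hom.ext (funext fun X => funext fun m => ?_)
  change _ = equivShrink.{w} (S''.obj X) (TambaraFunctor.Hom.toHom ψ |>.app X
    ((equivShrink.{w} (S'.obj X)).symm (equivShrink.{w} (S'.obj X) _)))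
  rw [Equiv.symm_apply_apply]
  rfl

end TambaraFunctor

namespace MCSys

open FinGSet

variable {G : Type u} [Group G]

/-- The underlying coefficient system of a multiplicative coefficient system: forget the products
and the maps that are not isomorphisms. -/
def toCSys (G : Type u) [Group G] : MCSys.{u, w} G ⥤ CSys.{u, w} G :=
  (Functor.whiskeringLeft _ _ _).obj (Core.inclusion _) ⋙ (Functor.whiskeringRight _ _ _).obj
    (forget₂ CommSemiRingCat.{w} SemiRingCat.{w} ⋙ forget₂ SemiRingCat.{w} AddCommMonCat.{w})

variable (R : MCSys.{u, w} G)

/-- The elements of `rR(X)`. -/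
abbrev Fam (X : FinGSet.{u} G) := CSys.Fam ((toCSys G).obj R) X

variable {R} {X Y Z : FinGSet.{u} G}

/-- The value `m(U, x)`, as an element of the semiring `R(U)`. -/
def val (m : R.Fam X) (U : Orb.{u} G) (x : U.toFinGSet →[G] X) : R.obj U := m.1 U x

variable (R) in
/-- The semiring map `N_f : R(U) → R(V)`. -/
def nrm {U V : Orb.{u} G} (f : U.toFinGSet →[G] V.toFinGSet) : R.obj U →+* R.obj V :=
  (R.map (Orb.ofMap f)).hom

theorem nrm_id {U : Orb.{u} G} (a : R.obj U) : R.nrm (MulActionHom.id G) a = a :=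
  ConcreteCategory.congr_hom (R.map_id U) a

theorem nrm_comp {U V W : Orb.{u} G} (g : V.toFinGSet →[G] W.toFinGSet)
    (f : U.toFinGSet →[G] V.toFinGSet) (a : R.obj U) :
    R.nrm (g.comp f) a = R.nrm g (R.nrm f a) :=
  ConcreteCategory.congr_hom (R.map_comp (Orb.ofMap f) (Orb.ofMap g)) a

theorem nrm_val (m : R.Fam X) {U V : Orb.{u} G} (e : U.toFinGSet →[G] V.toFinGSet)
    (he : Function.Bijective e) (x : V.toFinGSet →[G] X) :
    R.nrm e (val m U (x.comp e)) = val m V x :=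
  m.2 U V (Orb.isoOfBijective e he) x

theorem ext_val {m n : R.Fam X} (h : ∀ U x, val m U x = val n U x) : m = n :=
  CSys.Fam.ext h

/-- The set of orbits of a finite `G`-set. -/
abbrev Orbits (W : FinGSet.{u} G) : Type u := MulAction.orbitRel.Quotient G W

noncomputable instance (W : FinGSet.{u} G) : Fintype (Orbits W) :=
  @Fintype.ofFinite _ (Quotient.finite _)

/-- The orbit of a point. -/
def cls {W : FinGSet.{u} G} (x : W) : Orbits W := Quotient.mk'' x

theorem cls_eq {W : FinGSet.{u} G} {x y : W} : cls x = cls y ↔ ∃ γ : G, γ • y = x :=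
  Quotient.eq''

/-- An orbit, as a transitive `G`-set. -/
def orb {W : FinGSet.{u} G} (o : Orbits W) : Orb.{u} G where
  toFinGSet := ⟨o.orbit⟩
  nonempty := (MulAction.orbitRel.Quotient.nonempty_orbit o).to_subtype
  isPretransitive := inferInstanceAs (MulAction.IsPretransitive G o.orbit)

/-- The inclusion of an orbit. -/
def incl {W : FinGSet.{u} G} (o : Orbits W) : (orb o).toFinGSet →[G] W :=
  ⟨Subtype.val, fun _ _ => rfl⟩

theorem cls_incl {W : FinGSet.{u} G} {o : Orbits W} (x : (orb o).toFinGSet) :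
    cls (incl o x) = o :=
  MulAction.orbitRel.Quotient.mem_orbit.1 x.2

theorem incl_injective {W : FinGSet.{u} G} (o : Orbits W) : Function.Injective (incl o) :=
  Subtype.val_injective

/-- A point of the orbit `o`. -/
def orbMk {W : FinGSet.{u} G} {o : Orbits W} (x : W) (hx : cls x = o) : (orb o).toFinGSet :=
  ⟨x, MulAction.orbitRel.Quotient.mem_orbit.2 hx⟩

theorem incl_bijective (W : FinGSet.{u} G) :
    Function.Bijective fun p : Σ o : Orbits W, (orb o).toFinGSet => incl p.1 p.2 := by
  constructor
  · rintro ⟨o, x⟩ ⟨o', x'⟩ (e : incl o x = incl o' x')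
    obtain rfl : o = o' := (cls_incl x).symm.trans ((congrArg cls e).trans (cls_incl x'))
    rw [incl_injective o e]
  · intro x
    exact ⟨⟨cls x, orbMk x rfl⟩, rfl⟩

/-- For `v : W → T` and `u : W → X`, the product over all orbits `U ⊆ W` of `N_v (m(U, u))`. -/
noncomputable def orbProd (m : R.Fam X) {W : FinGSet.{u} G} {T : Orb.{u} G}
    (v : W →[G] T.toFinGSet) (u : W →[G] X) : R.obj T :=
  ∏ o : Orbits W, R.nrm (v.comp (incl o)) (val m (orb o) (u.comp (incl o)))

theorem term_eq (m : R.Fam X) {W : FinGSet.{u} G} {T U : Orb.{u} G} (v : W →[G] T.toFinGSet)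
    (u : W →[G] X) (j : U.toFinGSet →[G] W) (hj : Function.Injective j) (o : Orbits W)
    (x0 : U.toFinGSet) (ho : cls (j x0) = o) :
    R.nrm (v.comp (incl o)) (val m (orb o) (u.comp (incl o))) =
      R.nrm (v.comp j) (val m U (u.comp j)) := by
  have hmem : ∀ x, cls (j x) = o := by
    intro x
    obtain ⟨γ, rfl⟩ := MulAction.exists_smul_eq G x0 x
    rw [← ho]
    exact cls_eq.2 ⟨γ, (map_smul j γ x0).symm⟩
  let e : U.toFinGSet →[G] (orb o).toFinGSet :=
    ⟨fun x => orbMk (j x) (hmem x), fun γ x => incl_injective o (map_smul j γ x)⟩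
  have he : Function.Bijective e :=
    ⟨fun x y h => hj (congrArg (incl o) h), Orb.surjective e⟩
  change _ = R.nrm ((v.comp (incl o)).comp e) (val m U ((u.comp (incl o)).comp e))
  rw [nrm_comp, nrm_val m e he]

theorem orbProd_eq (m : R.Fam X) {W : FinGSet.{u} G} {T : Orb.{u} G} (v : W →[G] T.toFinGSet)
    (u : W →[G] X) {I : Type*} [Fintype I] (U : I → Orb.{u} G)
    (j : ∀ i, (U i).toFinGSet →[G] W)
    (hj : Function.Bijective fun p : Σ i, (U i).toFinGSet => j p.1 p.2) :
    orbProd m v u = ∏ i, R.nrm (v.comp (j i)) (val m (U i) (u.comp (j i))) := by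
  let c : I → Orbits W := fun i => cls (j i (Classical.arbitrary (U i).toFinGSet))
  have hc : Function.Bijective c := by
    constructor
    · intro i i' e
      obtain ⟨γ, h⟩ := cls_eq.1 e
      rw [← map_smul] at h
      exact (congrArg Sigma.fst (@hj.1 ⟨i', _⟩ ⟨i, _⟩ h)).symm
    · intro o
      induction o using Quotient.inductionOn' with
      | h w =>
        obtain ⟨⟨i, x⟩, rfl⟩ := hj.2 w
        obtain ⟨γ, h⟩ := MulAction.exists_smul_eq G x (Classical.arbitrary (U i).toFinGSet)
        refine ⟨i, cls_eq.2 ⟨γ, ?_⟩⟩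
        change γ • j i x = _
        rw [← map_smul, h]
  rw [orbProd, ← (Equiv.ofBijective c hc).prod_comp]
  refine Finset.prod_congr rfl fun i _ => ?_
  exact term_eq m v u (j i) (fun x y h => eq_of_heq (Sigma.mk.inj (@hj.1 ⟨i, x⟩ ⟨i, y⟩ h)).2) _ _ rfl

theorem orbProd_bij (m : R.Fam X) {W W' : FinGSet.{u} G} {T : Orb.{u} G}
    (v : W' →[G] T.toFinGSet) (u : W' →[G] X) (φ : W →[G] W') (hφ : Function.Bijective φ) :
    orbProd m (v.comp φ) (u.comp φ) = orbProd m v u :=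
  (orbProd_eq m v u orb (fun o => φ.comp (incl o)) (hφ.comp (incl_bijective W))).symm

theorem nrm_orbProd (m : R.Fam X) {W : FinGSet.{u} G} {T T' : Orb.{u} G}
    (f : T.toFinGSet →[G] T'.toFinGSet) (v : W →[G] T.toFinGSet) (u : W →[G] X) :
    R.nrm f (orbProd m v u) = orbProd m (f.comp v) u := by
  rw [orbProd, map_prod]
  exact Finset.prod_congr rfl fun o _ => (nrm_comp f _ _).symm

theorem orbProd_cart (m : R.Fam X) {W : FinGSet.{u} G} {T : Orb.{u} G} {v : W →[G] T.toFinGSet}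
    {u : W →[G] X} {f : X →[G] Y} {y : T.toFinGSet →[G] Y} (hc : IsCartesian u v f y) :
    orbProd m v u = orbProd m (pullbackSnd f y) (pullbackFst f y) := by
  let φ : W →[G] pullback f y :=
    ⟨fun w => ⟨(u w, v w), hc.comm w⟩, fun γ w =>
      Subtype.ext (Prod.ext (map_smul u γ w) (map_smul v γ w))⟩
  refine orbProd_bij m (pullbackSnd f y) (pullbackFst f y) φ ⟨fun w w' e => ?_, fun p => ?_⟩
  · have h1 : u w = u w' := congrArg (fun p => p.1.1) e
    have h2 : v w = v w' := congrArg (fun p => p.1.2) e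
    exact (hc.lift _ _ (hc.comm w)).unique ⟨rfl, rfl⟩ ⟨h1.symm, h2.symm⟩
  · obtain ⟨⟨a, b⟩, hp⟩ := p
    obtain ⟨w, ⟨rfl, rfl⟩, -⟩ := hc.lift a b hp
    exact ⟨w, rfl⟩

/-- The norm: `(N_f m)(T, y)` is the product of the elements `N_v (m(U, u))`, where `U` runs over the
orbits of the pullback of `f : X → Y` and `y : T → Y`, and `u`, `v` are the projections to `X`
and `T`. -/
noncomputable def nm (f : X →[G] Y) (m : R.Fam X) : R.Fam Y :=
  ⟨fun T y => orbProd m (pullbackSnd f y) (pullbackFst f y), fun U V e y => by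
    refine (nrm_orbProd m (Orb.toMap e.hom) _ _).trans (orbProd_cart m ?_)
    refine ⟨fun w => w.2, fun x t h => ?_⟩
    obtain ⟨t', rfl⟩ := (Orb.bijective e).2 t
    refine ⟨⟨(x, t'), h⟩, ⟨rfl, rfl⟩, ?_⟩
    rintro ⟨⟨a, b⟩, _⟩ ⟨rfl, hb⟩
    obtain rfl : b = t' := (Orb.bijective e).1 hb
    rfl⟩

theorem val_nm (f : X →[G] Y) (m : R.Fam X) {W : FinGSet.{u} G} {T : Orb.{u} G}
    {v : W →[G] T.toFinGSet} {u : W →[G] X} {y : T.toFinGSet →[G] Y} (hc : IsCartesian u v f y) :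
    val (nm f m) T y = orbProd m v u :=
  (orbProd_cart m hc).symm

theorem nm_id (m : R.Fam X) : nm (MulActionHom.id G) m = m := by
  refine ext_val fun T y => ?_
  rw [val_nm (u := y) (v := MulActionHom.id G) _ m ⟨fun _ => rfl, fun x t h =>
    ⟨t, ⟨Eq.symm h, rfl⟩, fun t' h' => h'.2⟩⟩,
    orbProd_eq m _ _ (fun _ : Unit => T) (fun _ => MulActionHom.id G)
      ⟨by rintro ⟨⟨⟩, x⟩ ⟨⟨⟩, x'⟩ (rfl : x = x'); rfl, fun x => ⟨⟨(), x⟩, rfl⟩⟩,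
    Fintype.prod_unique]
  exact nrm_id _

theorem nm_comp (g : Y →[G] Z) (f : X →[G] Y) (m : R.Fam X) :
    nm (g.comp f) m = nm g (nm f m) := by
  refine ext_val fun T z => ?_
  let P := pullback g z
  let F : Orbits P → FinGSet.{u} G := fun o => pullback f ((pullbackFst g z).comp (incl o))
  let j : ∀ p : Σ o : Orbits P, Orbits (F o), (orb p.2).toFinGSet →[G] pullback (g.comp f) z :=
    fun p =>
      { toFun := fun a => ⟨((incl p.2 a).1.1, (incl p.1 (incl p.2 a).1.2).1.2),
          (congrArg g (incl p.2 a).2).trans (incl p.1 (incl p.2 a).1.2).2⟩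
        map_smul' := fun _ _ => rfl }
  have hj : Function.Bijective fun q : Σ p : (Σ o : Orbits P, Orbits (F o)),
      (orb p.2).toFinGSet => j q.1 q.2 := by
    constructor
    · rintro ⟨⟨o, o'⟩, a⟩ ⟨⟨l, l'⟩, b⟩ e
      have e1 : (incl o' a).1.1 = (incl l' b).1.1 := congrArg (fun p => p.1.1) e
      have e2 : (incl o (incl o' a).1.2).1.2 = (incl l (incl l' b).1.2).1.2 :=
        congrArg (fun p => p.1.2) e
      have e3 : incl o (incl o' a).1.2 = incl l (incl l' b).1.2 := by
        refine Subtype.ext (Prod.ext ?_ e2)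
        exact (Eq.symm (incl o' a).2).trans ((congrArg f e1).trans (incl l' b).2)
      have e4 := (incl_bijective P).1 (a₁ := ⟨o, (incl o' a).1.2⟩) (a₂ := ⟨l, (incl l' b).1.2⟩) e3
      obtain rfl : o = l := congrArg Sigma.fst e4
      have e5 : (incl o' a).1.2 = (incl l' b).1.2 := incl_injective o e3
      have e6 := (incl_bijective (F o)).1 (a₁ := ⟨o', a⟩) (a₂ := ⟨l', b⟩)
        (Subtype.ext (Prod.ext e1 e5))
      cases e6
      rfl
    · rintro ⟨⟨x, t⟩, h⟩
      obtain ⟨⟨o, q⟩, hq⟩ := (incl_bijective P).2 ⟨(f x, t), h⟩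
      obtain ⟨⟨o', a⟩, ha⟩ := (incl_bijective (F o)).2
        ⟨(x, q), (congrArg (fun p => p.1.1) hq).symm⟩
      refine ⟨⟨⟨o, o'⟩, a⟩, Subtype.ext (Prod.ext ?_ ?_)⟩
      · exact congrArg (fun p => p.1.1) ha
      · have h2 : (incl o' a).1.2 = q := congrArg (fun p => p.1.2) ha
        exact (congrArg (fun q => (incl o q).1.2) h2).trans (congrArg (fun p => p.1.2) hq)
  rw [val_nm _ m (isCartesian_pullback (g.comp f) z), orbProd_eq m _ _ _ j hj,
    val_nm _ (nm f m) (isCartesian_pullback g z), orbProd, Fintype.prod_sigma]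
  refine Finset.prod_congr rfl fun o _ => ?_
  rw [val_nm f m (isCartesian_pullback _ _), nrm_orbProd]
  rfl

theorem nm_res {W : FinGSet.{u} G} {f : W →[G] X} {g : W →[G] Y} {h : X →[G] Z}
    {k : Y →[G] Z} (hc : IsCartesian f g h k) (m : R.Fam X) :
    nm g (CSys.Fam.res f m) = CSys.Fam.res k (nm h m) := by
  refine ext_val fun T y => ?_
  change val (nm g (CSys.Fam.res f m)) T y = val (nm h m) T (k.comp y)
  have hc' : IsCartesian (f.comp (pullbackFst g y)) (pullbackSnd g y) h (k.comp y) := by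
    refine ⟨fun p => (hc.comm p.1.1).trans (congrArg k p.2), fun x t e => ?_⟩
    obtain ⟨w, ⟨rfl, hw⟩, huniq⟩ := hc.lift x (y t) e
    refine ⟨⟨(w, t), hw⟩, ⟨rfl, rfl⟩, ?_⟩
    rintro ⟨⟨w', t'⟩, hp⟩ ⟨h1, rfl⟩
    obtain rfl : w' = w := huniq w' ⟨h1, hp⟩
    rfl
  rw [val_nm g _ (isCartesian_pullback g y), val_nm h m hc']
  rfl

theorem val_tr (f : X →[G] Y) (m : R.Fam X) (U : Orb.{u} G) (y : U.toFinGSet →[G] Y) :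
    val (CSys.Fam.tr f m) U y = ∑ x : CSys.Lifts f y, val m U x.1 := rfl

theorem nm_tr (g : X →[G] Y) (h : Y →[G] Z) (m : R.Fam X) :
    nm h (CSys.Fam.tr g m) =
      CSys.Fam.tr (distR g h) (nm (distQ g h) (CSys.Fam.res (distP g h) m)) := by
  classical
  refine ext_val fun T z => ?_
  let W := pullback h z
  let u : W →[G] Y := pullbackFst h z
  let v : W →[G] T.toFinGSet := pullbackSnd h z
  have hbase : ∀ (t : CSys.Lifts (distR g h) z) (τ : T.toFinGSet), (t.1 τ).base = z τ :=
    fun t τ => DFunLike.congr_fun t.2 τ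
  let a : CSys.Lifts (distR g h) z → (W →[G] distA g h) := fun t =>
    { toFun := fun w => ⟨(u w, t.1 (v w)), w.2.trans (hbase t (v w)).symm⟩
      map_smul' := fun γ w => Subtype.ext (Prod.ext rfl (map_smul t.1 γ (v w))) }
  have ha : ∀ t, IsCartesian (a t) v (distQ g h) t.1 := fun t =>
    { comm := fun _ => rfl
      lift := by
        rintro ⟨⟨y, b⟩, hb⟩ τ (rfl : b = t.1 τ)
        refine ⟨⟨(y, τ), hb.trans (hbase t τ)⟩, ⟨rfl, rfl⟩, ?_⟩
        rintro ⟨⟨y', τ'⟩, hp⟩ ⟨h1, rfl⟩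
        obtain rfl : y' = y := congrArg (fun p => p.1.1) h1
        rfl }
  have key : ∀ p : (∀ o : Orbits W, CSys.Lifts g (u.comp (incl o))), ∀ (o o' : Orbits W)
      (_ : o = o') (w : W) (hw : cls w = o) (hw' : cls w = o'),
      (p o).1 (orbMk w hw) = (p o').1 (orbMk w hw') := by
    rintro p o _ rfl w hw hw'
    rfl
  let Ψ : CSys.Lifts (distR g h) z → ∀ o : Orbits W, CSys.Lifts g (u.comp (incl o)) :=
    fun t o => ⟨((distP g h).comp (a t)).comp (incl o), MulActionHom.ext fun w =>
      DistPt.sec_spec _ _ _⟩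
  have hΨ : Function.Bijective Ψ := by
    constructor
    · intro t t' e
      refine Subtype.ext (MulActionHom.ext fun τ => ?_)
      refine DistPt.ext' ((hbase t τ).trans (hbase t' τ).symm) fun y hy hy' => ?_
      let w : W := ⟨(y, τ), hy.trans (hbase t τ)⟩
      exact DFunLike.congr_fun (congrArg Subtype.val (congrFun e (cls w))) (orbMk w rfl)
    · intro p
      let σ : W →[G] X :=
        { toFun := fun w => (p (cls w)).1 (orbMk w rfl)
          map_smul' := fun γ w => by
            have hw : cls (γ • w) = cls w := cls_eq.2 ⟨γ, rfl⟩
            exact (key p _ _ hw (γ • w) rfl hw).trans (map_smul (p (cls w)).1 γ (orbMk w rfl)) }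
      have hσ : ∀ w, g (σ w) = u w := fun w =>
        DFunLike.congr_fun (p (cls w)).2 (orbMk w rfl)
      let t : T.toFinGSet →[G] distB g h :=
        { toFun := fun τ => ⟨z τ, fun y hy => σ ⟨(y, τ), hy⟩, fun y hy => hσ _⟩
          map_smul' := fun γ τ => by
            refine DistPt.ext' (map_smul z γ τ) fun y hy hy' => ?_
            refine Eq.trans ?_ (map_smul σ γ _)
            exact congrArg σ (Subtype.ext (Prod.ext (smul_inv_smul γ y).symm rfl)) }
      refine ⟨⟨t, MulActionHom.ext fun _ => rfl⟩, funext fun o => Subtype.ext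
        (MulActionHom.ext fun w => ?_)⟩
      exact key p _ _ (cls_incl w) (incl o w) rfl (cls_incl w)
  rw [val_nm h _ (isCartesian_pullback h z), orbProd, val_tr]
  calc
    _ = ∏ o : Orbits W, ∑ x : CSys.Lifts g (u.comp (incl o)),
          R.nrm (v.comp (incl o)) (val m (orb o) x.1) :=
        Finset.prod_congr rfl fun o _ => (congrArg _ (val_tr g m _ _)).trans (map_sum _ _ _)
    _ = ∑ p : (∀ o : Orbits W, CSys.Lifts g (u.comp (incl o))), ∏ o : Orbits W,
          R.nrm (v.comp (incl o)) (val m (orb o) (p o).1) := by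
        rw [Finset.prod_univ_sum, Fintype.piFinset_univ]
    _ = ∑ t : CSys.Lifts (distR g h) z, ∏ o : Orbits W,
          R.nrm (v.comp (incl o)) (val m (orb o) (Ψ t o).1) :=
        ((Equiv.ofBijective Ψ hΨ).sum_comp _).symm
    _ = ∑ t : CSys.Lifts (distR g h) z,
          val (nm (distQ g h) (CSys.Fam.res (distP g h) m)) T t.1 :=
        Finset.sum_congr rfl fun t _ =>
          (val_nm (distQ g h) (CSys.Fam.res (distP g h) m) (ha t)).symm

variable (R) in
/-- The Tambara functor `X ↦ R.Fam X`. -/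
noncomputable def famTambara : TambaraFunctor.{u, max (u + 1) w} G where
  toMackeyFunctor := CSys.famMackey ((toCSys G).obj R)
  nm := nm
  nm_id := nm_id
  nm_comp := nm_comp
  nm_res := nm_res
  nm_tr := nm_tr

instance [Finite G] (X : FinGSet.{u} G) : Small.{w} (R.famTambara.obj X) :=
  inferInstanceAs (Small.{w} ((CSys.famMackey ((toCSys G).obj R)).obj X))

theorem val_map {R R' : MCSys.{u, w} G} (α : R ⟶ R') (m : R.Fam X) (U : Orb.{u} G)
    (x : U.toFinGSet →[G] X) :
    val (CSys.Fam.map ((toCSys G).map α) m) U x = (α.app U).hom (val m U x) := rfl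

theorem nrm_naturality {R R' : MCSys.{u, w} G} (α : R ⟶ R') {U V : Orb.{u} G}
    (f : U.toFinGSet →[G] V.toFinGSet) (a : R.obj U) :
    (α.app V).hom (R.nrm f a) = R'.nrm f ((α.app U).hom a) :=
  ConcreteCategory.congr_hom (α.naturality (Orb.ofMap f)) a

/-- The morphism of Tambara functors induced by a morphism of multiplicative coefficient systems. -/
noncomputable def famMap {R R' : MCSys.{u, w} G} (α : R ⟶ R') :
    TambaraFunctor.Hom R.famTambara R'.famTambara where
  toHom := CSys.famMap ((toCSys G).map α)
  app_nm {X Y} f m := by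
    refine ext_val (m := CSys.Fam.map ((toCSys G).map α) (nm f m)) fun T y => ?_
    refine (map_prod (α.app T).hom _ _).trans (Finset.prod_congr rfl fun o _ => ?_)
    exact nrm_naturality α _ _

/-- The functor `r` from multiplicative coefficient systems to Tambara functors. Up to the
bijections `equivShrink`, the set `(r R)(X)` is the inverse limit `R.Fam X`, with the restrictions
`CSys.Fam.res`, the transfers `CSys.Fam.tr` and the norms `MCSys.nm`. -/
noncomputable def r (G : Type u) [Group G] [Finite G] :
    MCSys.{u, w} G ⥤ TambaraFunctor.{u, w} G where
  obj R := R.famTambara.shrink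
  map α := (famMap α).shrink
  map_id R := TambaraFunctor.Hom.shrink_id R.famTambara
  map_comp α β := TambaraFunctor.Hom.shrink_comp (famMap α) (famMap β)

end MCSys

/-- A commutative additive monoid is rational if every element has an additive inverse, and
multiplication by `n` is bijective for all positive integers `n`. -/
def IsRational (A : Type*) [AddCommMonoid A] : Prop :=
  (∀ a : A, ∃ b, a + b = 0) ∧ ∀ n : ℕ, 0 < n → Function.Bijective fun a : A => n • a

/-- Rational Mackey functors. -/
def MackeyFunctor.rational (G : Type u) [Group G] : ObjectProperty (MackeyFunctor.{u, w} G) :=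
  fun M => ∀ X : FinGSet.{u} G, IsRational (M.obj X)

/-- Rational Tambara functors. -/
def TambaraFunctor.rational (G : Type u) [Group G] : ObjectProperty (TambaraFunctor.{u, w} G) :=
  fun S => ∀ X : FinGSet.{u} G, IsRational (S.obj X)

/-- Rational coefficient systems. -/
def CSys.rational (G : Type u) [Group G] : ObjectProperty (CSys.{u, w} G) :=
  fun N => ∀ U : Orb.{u} G, IsRational (N.obj ⟨U⟩)

/-- Rational multiplicative coefficient systems. -/
def MCSys.rational (G : Type u) [Group G] : ObjectProperty (MCSys.{u, w} G) :=
  fun R => ∀ U : Orb.{u} G, IsRational (R.obj U)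

/-- The functors `F : C ⥤ D` and `H : D ⥤ C` send objects with property `P` to objects with
property `Q` and conversely, and the functors between the full subcategories obtained in this way
are the two functors of an equivalence of categories. -/
def RestrictToEquivalence {C D : Type*} [Category C] [Category D] (F : C ⥤ D) (H : D ⥤ C)
    (P : ObjectProperty C) (Q : ObjectProperty D) : Prop :=
  ∃ (hF : ∀ X, P X → Q (F.obj X)) (hH : ∀ Y, Q Y → P (H.obj Y))
    (e : P.FullSubcategory ≌ Q.FullSubcategory),
    e.functor = Q.lift (P.ι ⋙ F) (fun X => hF X.obj X.property) ∧
    e.inverse = P.lift (Q.ι ⋙ H) (fun Y => hH Y.obj Y.property)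

/-!
The unit `M → r (q M)` sends `m ∈ M(X)` to the family `(U, x) ↦ [R_x m]`, and the counit
`q (r N) → N` sends the class of a family `n` on `U` to `n(U, 1)`. The unit commutes with transfers
because, modulo transfers along non-isomorphisms, a transfer to a transitive `G`-set is the sum of
the restrictions along its sections (`MackeyFunctor.mk_tr`); it commutes with norms because a norm
is the product of the norms from the orbits of its source (`TambaraFunctor.nm_eq_prod_orbits`). The
counit is well defined because a non-isomorphism of transitive `G`-sets has no section
(`CSys.ev_tr_of_not_isIso`). The triangle identities are then immediate. Forgetting norms turns the
unit and counit for Tambara functors into those for Mackey functors, up to the identification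
`TambaraFunctor.toCSysIso`, so it suffices to treat rational Mackey functors.

Filter `M(X)` by the submonoids `F_k(X)` of sums of transfers from transitive `G`-sets with at least
`k` points. Then `F_1(X) = M(X)`, the transfers to be killed on a transitive `G`-set `U` form
`F_{|U|+1}(U)`, and `F_k(X) = 0` for `k > |G|`. Let `Θ_k = ∑ T_x R_x`, the sum over all maps
`x : G/H → X` with `|G/H| = k`. It acts on `F_k / F_{k+1}` as multiplication by `k`
(`MackeyFunctor.cosetOp_tr`), since a transitive `G`-set with `k` points is identified with a coset
space `G/H` in exactly `k` ways (`Orb.sum_card_lifts`).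

* If `[R_x d] = 0` for all `x`, then `Θ_k d ∈ F_{k+1}`. By induction on `k`, a multiple of `d` is in
  every `F_k`, so `d = 0` in the rational case: the unit is injective
  (`MackeyFunctor.unitHom_app_injective`).
* On `r N`, the operator `Θ_k` multiplies the values at sets with `k` points by `k`. So if `d`
  vanishes at all sets with fewer than `k` points, `k d - Θ_k d` vanishes at those with `k` points as
  well, while `Θ_k d ∈ F_k`. By downward induction, a multiple of `d` is in `F_k`
  (`CSys.exists_nsmul_mem_filtration`). For `d ∈ (r N)(U)` with `d(U, 1) = 0` this gives a
  multiple in `F_{|U|+1}(U)`, so the counit is injective; it is surjective without any hypothesis.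
* The same fact shows, by downward induction on `k`, that `F_k` of `r (q M)` lies in the image of the
  unit (`MackeyFunctor.filtration_le_mrange`): the unit is surjective.
-/

open FinGSet

/-! ### Values of Mackey functors on orbits -/

namespace MackeyFunctor

variable {G : Type u} [Group G] (M : MackeyFunctor.{u, w} G) {X Y Z : FinGSet.{u} G}

/-- Restrictions are additive. -/
noncomputable def resHom (f : X →[G] Y) : M.obj Y →+ M.obj X where
  toFun := M.res f
  map_zero' := M.res_zero f
  map_add' := M.res_add f

theorem res_sum (f : X →[G] Y) {I : Type*} (s : Finset I) (m : I → M.obj Y) :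
    M.res f (∑ i ∈ s, m i) = ∑ i ∈ s, M.res f (m i) :=
  map_sum (M.resHom f) m s

theorem tr_sum (f : X →[G] Y) {I : Type*} (s : Finset I) (m : I → M.obj X) :
    M.tr f (∑ i ∈ s, m i) = ∑ i ∈ s, M.tr f (m i) :=
  map_sum (M.trHom f) m s

theorem tr_add' (f : X →[G] Y) (a b : M.obj X) : M.tr f (a + b) = M.tr f a + M.tr f b :=
  M.tr_add f a b

theorem tr_nsmul (f : X →[G] Y) (n : ℕ) (a : M.obj X) : M.tr f (n • a) = n • M.tr f a :=
  map_nsmul (M.trHom f) n a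

theorem subsingleton_of_isEmpty [IsEmpty X] : Subsingleton (M.obj X) := by
  have hb : Function.Bijective (fromEmpty X) :=
    ⟨fun x => x.elim, fun x => (IsEmpty.false x).elim⟩
  refine ⟨fun a b => ?_⟩
  rw [← M.tr_res_self _ hb a, ← M.tr_res_self _ hb b, M.eq_pt (M.res _ a), M.eq_pt (M.res _ b)]

theorem tr_of_isEmpty [IsEmpty X] (f : X →[G] Y) (m : M.obj X) : M.tr f m = 0 := by
  have := M.subsingleton_of_isEmpty (X := X)
  rw [Subsingleton.elim m 0]
  exact map_zero (M.trHom f)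

/-- An element of `M(X)` is determined by its restrictions along all maps from transitive
`G`-sets, since `X` is a disjoint union of orbits. -/
theorem eq_of_res_eq (n : ℕ) : ∀ (X : FinGSet.{u} G), Nat.card X ≤ n → ∀ a b : M.obj X,
    (∀ (U : Orb.{u} G) (x : U.toFinGSet →[G] X), M.res x a = M.res x b) → a = b := by
  induction n with
  | zero =>
    intro X hX a b _
    have : IsEmpty X := Finite.card_eq_zero_iff.1 (Nat.le_zero.1 hX)
    exact M.subsingleton_of_isEmpty.elim a b
  | succ n ih =>
    intro X hX a b h
    rcases isEmpty_or_nonempty X with hE | ⟨⟨p⟩⟩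
    · exact M.subsingleton_of_isEmpty.elim a b
    have hC : ∀ (γ : G), ∀ x ∈ (MulAction.orbit G p)ᶜ, γ • x ∈ (MulAction.orbit G p)ᶜ := by
      intro γ x hx hx'
      exact hx (by simpa using Orb.orbit_smul_mem p γ⁻¹ _ hx')
    let C := X.sub (MulAction.orbit G p)ᶜ hC
    let iC : C →[G] X := X.subIncl _ hC
    have hcard : Nat.card C ≤ n := by
      have h1 : Nat.card C < Nat.card X :=
        Finite.card_subtype_lt (x := p) (p := fun x => x ∈ (MulAction.orbit G p)ᶜ)
          (fun h => h (MulAction.mem_orbit_self p))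
      omega
    let ι := copair (Orb.orbitIncl p) iC
    have hι : Function.Bijective ι := by
      constructor
      · rintro (x | x) (y | y) e
        · exact congrArg Sum.inl (Subtype.ext e)
        · exact (y.2 (by rw [← show x.1 = y.1 from e]; exact x.2)).elim
        · exact (x.2 (by rw [show x.1 = y.1 from e]; exact y.2)).elim
        · exact congrArg Sum.inr (Subtype.ext e)
      · intro x
        by_cases hx : x ∈ MulAction.orbit G p
        · exact ⟨Sum.inl ⟨x, hx⟩, rfl⟩
        · exact ⟨Sum.inr ⟨x, hx⟩, rfl⟩
    have hres : ∀ m : M.obj X, M.res ι m = M.glue (M.res (Orb.orbitIncl p) m) (M.res iC m) := by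
      intro m
      apply M.eq_glue <;> rw [← M.res_comp] <;> rfl
    have hC' : M.res iC a = M.res iC b :=
      ih C hcard _ _ fun U x => by rw [← M.res_comp, ← M.res_comp, h]
    rw [← M.tr_res_self ι hι a, ← M.tr_res_self ι hι b, hres, hres, hC', h]

theorem ext_res {a b : M.obj X}
    (h : ∀ (U : Orb.{u} G) (x : U.toFinGSet →[G] X), M.res x a = M.res x b) : a = b :=
  M.eq_of_res_eq _ X le_rfl a b h

theorem res_incl_tr_incl [DecidableEq (MCSys.Orbits X)] (o o' : MCSys.Orbits X)
    (m : M.obj X) : M.res (MCSys.incl o) (M.tr (MCSys.incl o') (M.res (MCSys.incl o') m)) =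
      if o = o' then M.res (MCSys.incl o) m else 0 := by
  rw [← M.tr_res (isCartesian_pullback (MCSys.incl o') (MCSys.incl o))]
  split_ifs with h
  · subst h
    have hb : Function.Bijective (pullbackFst (MCSys.incl o) (MCSys.incl o)) := by
      constructor
      · rintro ⟨⟨x, y⟩, h⟩ ⟨⟨x', y'⟩, h'⟩ (rfl : x = x')
        obtain rfl : x = y := MCSys.incl_injective o h
        obtain rfl : x = y' := MCSys.incl_injective o h'
        rfl
      · exact fun x => ⟨⟨(x, x), rfl⟩, rfl⟩
    have : pullbackSnd (MCSys.incl o) (MCSys.incl o) = pullbackFst (MCSys.incl o) (MCSys.incl o) :=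
      MulActionHom.ext fun p => (MCSys.incl_injective o p.2).symm
    rw [this, M.tr_res_self _ hb]
  · have : IsEmpty (pullback (MCSys.incl o') (MCSys.incl o)) :=
      ⟨fun p => h ((MCSys.cls_incl p.1.2).symm.trans
        ((congrArg MCSys.cls p.2.symm).trans (MCSys.cls_incl p.1.1)))⟩
    exact M.tr_of_isEmpty _ _

/-- Every element is the sum of the transfers of its restrictions to the orbits. -/
theorem sum_tr_incl (m : M.obj X) :
    ∑ o : MCSys.Orbits X, M.tr (MCSys.incl o) (M.res (MCSys.incl o) m) = m := by
  classical
  refine M.ext_res fun U x => ?_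
  obtain ⟨p⟩ := U.nonempty
  let o := MCSys.cls (x p)
  have ho : ∀ q, MCSys.cls (x q) = o := by
    intro q
    obtain ⟨γ, rfl⟩ := MulAction.exists_smul_eq G p q
    exact MCSys.cls_eq.2 ⟨γ, (map_smul x γ p).symm⟩
  let x' : U.toFinGSet →[G] (MCSys.orb o).toFinGSet :=
    ⟨fun q => MCSys.orbMk (x q) (ho q), fun γ q => MCSys.incl_injective o (map_smul x γ q)⟩
  have hx : x = (MCSys.incl o).comp x' := rfl
  rw [hx, M.res_comp, M.res_comp, M.res_sum]
  congr 1
  simp only [M.res_incl_tr_incl]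
  exact (Fintype.sum_ite_eq o _)

/-- A transfer is the sum of the transfers from the orbits of its source. -/
theorem tr_eq_sum_orbits (f : X →[G] Y) (m : M.obj X) : M.tr f m =
    ∑ o : MCSys.Orbits X, M.tr (f.comp (MCSys.incl o)) (M.res (MCSys.incl o) m) := by
  conv_lhs => rw [← M.sum_tr_incl m]
  rw [M.tr_sum]
  exact Finset.sum_congr rfl fun o _ => (M.tr_comp _ _ _).symm

end MackeyFunctor

namespace TambaraFunctor

variable {G : Type u} [Group G] (S : TambaraFunctor.{u, w} G) {X Y Z : FinGSet.{u} G}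

theorem mulMackey_sum {I : Type*} (s : Finset I) (m : I → S.obj X) :
    (∑ i ∈ s, (m i : S.mulMackey.obj X) : S.mulMackey.obj X) = (∏ i ∈ s, m i : S.obj X) := by
  classical
  induction s using Finset.induction_on with
  | empty => rfl
  | insert a s ha ih =>
    refine (Finset.sum_insert (M := S.mulMackey.obj X) ha).trans ?_
    rw [Finset.prod_insert ha, ← ih]
    rfl

/-- A norm is the product of the norms from the orbits of its source. -/
theorem nm_eq_prod_orbits (f : X →[G] Y) (m : S.obj X) : S.nm f m =
    ∏ o : MCSys.Orbits X, S.nm (f.comp (MCSys.incl o)) (S.res (MCSys.incl o) m) :=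
  (S.mulMackey.tr_eq_sum_orbits f m).trans (S.mulMackey_sum _ _)

theorem nm_eq_res_inv (f : X →[G] Y) (hf : Function.Bijective f) (m : S.obj X) :
    S.nm f m = S.res (FinGSet.inv f hf) m :=
  S.mulMackey.tr_eq_res_inv f hf m

end TambaraFunctor

/-! ### Elements of the inverse limit -/

namespace CSys

section

variable {G : Type u} [Group G] {X Y : FinGSet.{u} G}

/-- The two lifts of a map from a transitive `G`-set along the fold map. -/
theorem lifts_fold_bijective (U : Orb.{u} G) (x : U.toFinGSet →[G] X) :
    Function.Bijective fun i : Bool =>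
      (bif i then ⟨(inl X X).comp x, rfl⟩ else ⟨(inr X X).comp x, rfl⟩ : Lifts (fold X) x) := by
  obtain ⟨p⟩ := U.nonempty
  constructor
  · rintro (_ | _) (_ | _) e
    · rfl
    · cases DFunLike.congr_fun (congrArg Subtype.val e) p
    · cases DFunLike.congr_fun (congrArg Subtype.val e) p
    · rfl
  · rintro ⟨y, rfl⟩
    rcases exists_factor y with ⟨a, rfl⟩ | ⟨a, rfl⟩
    · exact ⟨true, Subtype.ext rfl⟩
    · exact ⟨false, Subtype.ext rfl⟩

end

variable {G : Type u} [Group G] [Finite G] {N : CSys.{u, w} G} {X Y Z : FinGSet.{u} G}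

/-- The value at `(U, x)` of an element of `(r N)(X)`, regarded as a family. -/
noncomputable def ev (n : ((r G).obj N).obj X) (U : Orb.{u} G) (x : U.toFinGSet →[G] X) :
    N.obj ⟨U⟩ :=
  ((equivShrink.{w} (N.famMackey.obj X)).symm n).1 U x

/-- The element of `(r N)(X)` given by a family. -/
noncomputable def ofFam (m : N.Fam X) : ((r G).obj N).obj X :=
  equivShrink.{w} (N.famMackey.obj X) m

theorem ev_ofFam (m : N.Fam X) (U : Orb.{u} G) (x : U.toFinGSet →[G] X) :
    ev (ofFam m) U x = m.1 U x :=
  congrArg (fun n : N.Fam X => n.1 U x)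
    ((equivShrink.{w} (N.famMackey.obj X)).symm_apply_apply m)

theorem ext_ev {m n : ((r G).obj N).obj X} (h : ∀ U x, ev m U x = ev n U x) : m = n :=
  (equivShrink.{w} (N.famMackey.obj X)).symm.injective (Fam.ext h)

theorem ev_res (f : X →[G] Y) (n : ((r G).obj N).obj Y) (U : Orb.{u} G)
    (x : U.toFinGSet →[G] X) : ev (((r G).obj N).res f n) U x = ev n U (f.comp x) :=
  ev_ofFam (Fam.res f ((equivShrink.{w} (N.famMackey.obj Y)).symm n)) U x

theorem ev_tr (f : X →[G] Y) (n : ((r G).obj N).obj X) (U : Orb.{u} G)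
    (y : U.toFinGSet →[G] Y) :
    ev (((r G).obj N).tr f n) U y = ∑ x : Lifts f y, ev n U x.1 :=
  ev_ofFam (Fam.tr f ((equivShrink.{w} (N.famMackey.obj X)).symm n)) U y

theorem push_ev (n : ((r G).obj N).obj X) {U V : Orb.{u} G} (e : U ≅ V)
    (x : V.toFinGSet →[G] X) : N.push e (ev n U (x.comp (Orb.toMap e.hom))) = ev n V x :=
  ((equivShrink.{w} (N.famMackey.obj X)).symm n).2 U V e x

theorem ev_map {N' : CSys.{u, w} G} (α : N ⟶ N') (n : ((r G).obj N).obj X) (U : Orb.{u} G)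
    (x : U.toFinGSet →[G] X) :
    ev (((r G).map α : MackeyFunctor.Hom _ _).app X n) U x = (α.app ⟨U⟩).hom (ev n U x) :=
  ev_ofFam (Fam.map α ((equivShrink.{w} (N.famMackey.obj X)).symm n)) U x

theorem ev_zero (U : Orb.{u} G) (x : U.toFinGSet →[G] X) :
    ev (0 : ((r G).obj N).obj X) U x = 0 := by
  have : IsEmpty (Lifts (fromEmpty X) x) :=
    ⟨fun y => (y.1 (Classical.arbitrary U.toFinGSet)).elim⟩
  rw [MackeyFunctor.zero_def, ev_tr, Fintype.sum_empty]

theorem ev_add (m n : ((r G).obj N).obj X) (U : Orb.{u} G) (x : U.toFinGSet →[G] X) :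
    ev (m + n) U x = ev m U x + ev n U x := by
  rw [MackeyFunctor.add_def, ev_tr,
    ← (Equiv.ofBijective _ (lifts_fold_bijective U x)).sum_comp, Fintype.sum_bool]
  congr 1
  · exact (ev_res (inl X X) _ U x).symm.trans (by rw [MackeyFunctor.res_inl_glue])
  · exact (ev_res (inr X X) _ U x).symm.trans (by rw [MackeyFunctor.res_inr_glue])

variable (N) in
/-- Evaluation at `(U, x)` is additive. -/
noncomputable def evHom (U : Orb.{u} G) (x : U.toFinGSet →[G] X) :
    ((r G).obj N).obj X →+ N.obj ⟨U⟩ where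
  toFun n := ev n U x
  map_zero' := ev_zero U x
  map_add' m n := ev_add m n U x

theorem ev_nsmul (k : ℕ) (n : ((r G).obj N).obj X) (U : Orb.{u} G) (x : U.toFinGSet →[G] X) :
    ev (k • n) U x = k • ev n U x :=
  map_nsmul (evHom N U x) k n

theorem ev_sum {I : Type*} (s : Finset I) (n : I → ((r G).obj N).obj X) (U : Orb.{u} G)
    (x : U.toFinGSet →[G] X) : ev (∑ i ∈ s, n i) U x = ∑ i ∈ s, ev (n i) U x :=
  map_sum (evHom N U x) n s

end CSys

/-! ### The adjunction for Mackey functors -/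

namespace MackeyFunctor

variable {G : Type u} [Group G] [Finite G]

/-- The family `(U, x) ↦ [R_x m]` of classes of restrictions of `m`. -/
noncomputable def unitFam (M : MackeyFunctor.{u, w} G) {X : FinGSet.{u} G} (m : M.obj X) :
    M.toCSys.Fam X :=
  ⟨fun U x => (M.qCon U).mk' (M.res x m), fun U V e x => by
    refine (M.qIso_mk e _).trans ?_
    rw [M.res_comp, M.tr_res_self _ (Orb.bijective e)]⟩

/-- The value at `M` of the unit `M → r (q M)`. -/
noncomputable def unitHom (M : MackeyFunctor.{u, w} G) : M ⟶ (CSys.r G).obj M.toCSys :=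
  Hom.mk (M' := (CSys.r G).obj M.toCSys) (fun _ m => CSys.ofFam (M.unitFam m))
    (fun f m => CSys.ext_ev fun U x => by
      rw [CSys.ev_ofFam, CSys.ev_res, CSys.ev_ofFam]
      exact congrArg (M.qCon U).mk' (M.res_comp f x m).symm)
    (fun {X Y} f m => CSys.ext_ev fun U y => by
      rw [CSys.ev_ofFam, CSys.ev_tr]
      let Φ : Sections (pullbackSnd f y) → CSys.Lifts f y := fun s =>
        ⟨(pullbackFst f y).comp s.1, MulActionHom.ext fun u =>
          (s.1 u).2.trans (congrArg y (s.2 u))⟩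
      have hΦ : Function.Bijective Φ := by
        constructor
        · intro s s' e
          refine Subtype.ext (MulActionHom.ext fun u => Subtype.ext (Prod.ext ?_ ?_))
          · exact DFunLike.congr_fun (congrArg Subtype.val e) u
          · exact (s.2 u).trans (s'.2 u).symm
        · intro x
          refine ⟨⟨⟨fun u => ⟨(x.1 u, u), DFunLike.congr_fun x.2 u⟩, fun γ u =>
            Subtype.ext (Prod.ext (map_smul x.1 γ u) rfl)⟩, fun u => rfl⟩, rfl⟩
      have key : (M.qCon U).mk' (M.res y (M.tr f m)) =
          ∑ s : Sections (pullbackSnd f y), (M.qCon U).mk' (M.res (Φ s).1 m) := by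
        rw [← M.tr_res (isCartesian_pullback f y), M.mk_tr U _ _ le_rfl]
        exact Finset.sum_congr rfl fun s _ => congrArg _ (M.res_comp _ _ _).symm
      refine key.trans (((Equiv.ofBijective Φ hΦ).sum_comp
        (fun x : CSys.Lifts f y => (M.qCon U).mk' (M.res x.1 m))).trans
        (Finset.sum_congr rfl fun x _ => ?_))
      exact (CSys.ev_ofFam (M.unitFam m) U x.1).symm)

theorem ev_unitHom (M : MackeyFunctor.{u, w} G) {X : FinGSet.{u} G} (m : M.obj X) (U : Orb.{u} G)
    (x : U.toFinGSet →[G] X) :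
    CSys.ev ((M.unitHom : Hom _ _).app X m) U x = (M.qCon U).mk' (M.res x m) :=
  CSys.ev_ofFam _ U x

end MackeyFunctor

namespace CSys

variable {G : Type u} [Group G] [Finite G]

/-- Transfers along non-isomorphisms of transitive `G`-sets vanish at the identity, because such a
map has no section. -/
theorem ev_tr_of_not_isIso {N : CSys.{u, w} G} {U V : Orb.{u} G} (f : V ⟶ U) (hf : ¬ IsIso f)
    (n : ((r G).obj N).obj V.toFinGSet) :
    ev (((r G).obj N).tr (Orb.toMap f) n) U (MulActionHom.id G) = 0 := by
  have : IsEmpty (Lifts (Orb.toMap f) (MulActionHom.id G)) := by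
    refine ⟨fun s => hf ((Orb.isIso_iff f).2 ⟨fun x y e => ?_, Orb.surjective (Orb.toMap f)⟩)⟩
    have hs : ∀ u, Orb.toMap f (s.1 u) = u := fun u => DFunLike.congr_fun s.2 u
    obtain ⟨x', rfl⟩ := Orb.surjective s.1 x
    obtain ⟨y', rfl⟩ := Orb.surjective s.1 y
    rw [hs, hs] at e
    rw [e]
  rw [ev_tr, Fintype.sum_empty]

/-- The map `q (r N) (U) → N(U)` sending the class of a family `n` to `n(U, 1)`. -/
noncomputable def counitMap (N : CSys.{u, w} G) (U : Orb.{u} G) :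
    (((r G).obj N).qCon U).Quotient →+ N.obj ⟨U⟩ :=
  ((r G).obj N).qLift (evHom N U (MulActionHom.id G)) fun _ f hf n => ev_tr_of_not_isIso f hf n

theorem counitMap_mk (N : CSys.{u, w} G) (U : Orb.{u} G)
    (n : ((r G).obj N).obj U.toFinGSet) :
    N.counitMap U ((((r G).obj N).qCon U).mk' n) = ev n U (MulActionHom.id G) := rfl

/-- Transfer along an isomorphism acts on the values at the identity by the functoriality of `N`. -/
theorem ev_tr_iso {N : CSys.{u, w} G} {U V : Orb.{u} G} (e : U ≅ V)
    (n : ((r G).obj N).obj U.toFinGSet) :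
    ev (((r G).obj N).tr (Orb.toMap e.hom) n) V (MulActionHom.id G) =
      N.push e (ev n U (MulActionHom.id G)) := by
  rw [MackeyFunctor.tr_eq_res_inv _ _ (Orb.bijective e), ev_res, ← push_ev _ e]
  congr 2
  exact MulActionHom.ext fun u => FinGSet.inv_apply _ (Orb.bijective e) u

/-- The value at `N` of the counit `q (r N) → N`. -/
noncomputable def counitHom (N : CSys.{u, w} G) :
    (MackeyFunctor.q G).obj ((r G).obj N) ⟶ N where
  app U := AddCommMonCat.ofHom (N.counitMap U.of)
  naturality U V f := by
    refine AddCommMonCat.hom_ext (AddMonoidHom.ext fun x => ?_)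
    obtain ⟨n, rfl⟩ := AddCon.mk'_surjective x
    exact ev_tr_iso f.iso n

/-- The adjunction between `q` and `r`, with unit `m ↦ ((U, x) ↦ [R_x m])` and counit
`[n] ↦ n(U, 1)`. -/
noncomputable def adj (G : Type u) [Group G] [Finite G] : MackeyFunctor.q.{u, w} G ⊣ r.{u, w} G :=
  Adjunction.mkOfUnitCounit
    { unit :=
        { app := fun M => M.unitHom
          naturality := fun M M' φ => MackeyFunctor.Hom.ext (funext fun X => funext fun m =>
            ext_ev fun U x => by
              refine (M'.ev_unitHom (MackeyFunctor.Hom.app φ X m) U x).trans ?_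
              refine Eq.trans ?_ (ev_map ((MackeyFunctor.q G).map φ) (M.unitHom.app X m) U x).symm
              refine Eq.trans ?_ (congrArg (((MackeyFunctor.q G).map φ).app ⟨U⟩).hom
                (M.ev_unitHom m U x)).symm
              exact congrArg (M'.qCon U).mk' (MackeyFunctor.Hom.app_res φ x m).symm) }
      counit :=
        { app := fun N => N.counitHom
          naturality := fun N N' α => by
            refine NatTrans.ext (funext fun U => AddCommMonCat.hom_ext
              (AddMonoidHom.ext fun x => ?_))
            obtain ⟨n, rfl⟩ := AddCon.mk'_surjective x
            exact ev_map α n U.of (MulActionHom.id G) }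
      left_triangle := by
        refine NatTrans.ext (funext fun M => NatTrans.ext (funext fun U => AddCommMonCat.hom_ext
          (AddMonoidHom.ext fun x => ?_)))
        obtain ⟨m, rfl⟩ := AddCon.mk'_surjective x
        refine (M.ev_unitHom m U.of (MulActionHom.id G)).trans ?_
        exact congrArg (M.qCon U.of).mk' (M.res_id m)
      right_triangle := by
        refine NatTrans.ext (funext fun N => MackeyFunctor.Hom.ext (funext fun X => funext fun n =>
          ext_ev fun U x => ?_))
        refine (ev_map N.counitHom (((r G).obj N).unitHom.app X n) U x).trans ?_
        refine (congrArg (N.counitHom.app ⟨U⟩).hom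
          (((r G).obj N).ev_unitHom n U x)).trans ?_
        exact ev_res x n U (MulActionHom.id G) }

end CSys

/-! ### The adjunction for Tambara functors -/

namespace MCSys

variable {G : Type u} [Group G] [Finite G] {R : MCSys.{u, w} G} {X Y Z : FinGSet.{u} G}

/-- The value at `(U, x)` of an element of `(r R)(X)`, as an element of the semiring `R(U)`. -/
noncomputable def ev (n : ((r G).obj R).obj X) (U : Orb.{u} G) (x : U.toFinGSet →[G] X) :
    R.obj U :=
  CSys.ev (N := (toCSys G).obj R) n U x

/-- The norm in `r R`, computed from any cartesian square over `y` and any decomposition of its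
corner into orbits. -/
theorem ev_nm (f : X →[G] Y) (n : ((r G).obj R).obj X) {W : FinGSet.{u} G} {T : Orb.{u} G}
    {v : W →[G] T.toFinGSet} {u : W →[G] X} {y : T.toFinGSet →[G] Y} (hc : IsCartesian u v f y)
    {I : Type*} [Fintype I] (U : I → Orb.{u} G) (j : ∀ i, (U i).toFinGSet →[G] W)
    (hj : Function.Bijective fun p : Σ i, (U i).toFinGSet => j p.1 p.2) :
    ev (((r G).obj R).nm f n) T y = ∏ i, R.nrm (v.comp (j i)) (ev n (U i) (u.comp (j i))) := by
  let m : R.Fam X := (equivShrink.{w} (R.famTambara.obj X)).symm n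
  refine (CSys.ev_ofFam (N := (toCSys G).obj R) (nm f m) T y).trans ?_
  exact (val_nm f m hc).trans (orbProd_eq m v u U j hj)

theorem ev_mul (m n : ((r G).obj R).obj X) (U : Orb.{u} G) (x : U.toFinGSet →[G] X) :
    ev (m * n) U x = ev m U x * ev n U x := by
  have h := ev_nm (fold X) (((r G).obj R).glue m n) (isCartesian_fold x) (I := Bool)
    (fun _ => U) (fun i => bif i then inl _ _ else inr _ _) (by
      constructor
      · rintro ⟨_ | _, a⟩ ⟨_ | _, b⟩ e
        · obtain rfl : a = b := Sum.inr_injective e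
          rfl
        · cases e
        · cases e
        · obtain rfl : a = b := Sum.inl_injective e
          rfl
      · rintro (a | a)
        · exact ⟨⟨true, a⟩, rfl⟩
        · exact ⟨⟨false, a⟩, rfl⟩)
  rw [Fintype.prod_bool] at h
  refine h.trans (congrArg₂ (· * ·) ?_ ?_)
  · refine (nrm_id _).trans ?_
    refine (CSys.ev_res (N := (toCSys G).obj R) (inl X X) _ U x).symm.trans ?_
    exact congrArg (fun n => CSys.ev (N := (toCSys G).obj R) n U x)
      (((r G).obj R).res_inl_glue m n)
  · refine (nrm_id _).trans ?_
    refine (CSys.ev_res (N := (toCSys G).obj R) (inr X X) _ U x).symm.trans ?_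
    exact congrArg (fun n => CSys.ev (N := (toCSys G).obj R) n U x)
      (((r G).obj R).res_inr_glue m n)

theorem ev_one (U : Orb.{u} G) (x : U.toFinGSet →[G] X) :
    ev (1 : ((r G).obj R).obj X) U x = 1 := by
  have h := ev_nm (fromEmpty X) ((r G).obj R).pt (isCartesian_fromEmpty x) (I := PEmpty.{1})
    (fun i => i.elim) (fun i => i.elim) ⟨fun p => p.1.elim, fun p => p.elim⟩
  exact h.trans (Fintype.prod_empty _)

/-- The norm along a map of transitive `G`-sets acts on the values at the identity by the
functoriality of `R`. -/
theorem ev_nm_id {T U : Orb.{u} G} (f : T ⟶ U) (n : ((r G).obj R).obj T.toFinGSet) :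
    ev (((r G).obj R).nm (Orb.toMap f) n) U (MulActionHom.id G) =
      R.nrm (Orb.toMap f) (ev n T (MulActionHom.id G)) := by
  have hc : IsCartesian (MulActionHom.id G) (Orb.toMap f) (Orb.toMap f) (MulActionHom.id G) :=
    ⟨fun _ => rfl, fun x y h => ⟨x, ⟨rfl, h⟩, fun z hz => hz.1⟩⟩
  refine (ev_nm _ n hc (fun _ : Unit => T) (fun _ => MulActionHom.id G)
    ⟨by rintro ⟨⟨⟩, x⟩ ⟨⟨⟩, x'⟩ (rfl : x = x'); rfl, fun x => ⟨⟨(), x⟩, rfl⟩⟩).trans ?_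
  exact Fintype.prod_unique _

variable (R) in
/-- Evaluation at `(U, x)` is a semiring homomorphism. -/
noncomputable def evRingHom (U : Orb.{u} G) (x : U.toFinGSet →[G] X) :
    ((r G).obj R).obj X →+* R.obj U where
  toFun n := ev n U x
  map_zero' := CSys.ev_zero (N := (toCSys G).obj R) U x
  map_add' m n := CSys.ev_add (N := (toCSys G).obj R) m n U x
  map_one' := ev_one U x
  map_mul' m n := ev_mul m n U x

/-- The semiring map `q (r R) (U) → R(U)` sending the class of `n` to `n(U, 1)`. -/
noncomputable def counitMap (R : MCSys.{u, w} G) (U : Orb.{u} G) :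
    (((r G).obj R).qRingCon U).Quotient →+* R.obj U :=
  (((r G).obj R).qRingCon U).lift (evRingHom R U (MulActionHom.id G)) fun _ _ h =>
    ((r G).obj R).qRingCon_le_ker (evRingHom R U (MulActionHom.id G))
      (fun _ f hf n => CSys.ev_tr_of_not_isIso (N := (toCSys G).obj R) f hf n) h

/-- The value at `R` of the counit `q (r R) → R`. -/
noncomputable def counitHom (R : MCSys.{u, w} G) :
    (TambaraFunctor.q G).obj ((r G).obj R) ⟶ R where
  app U := CommSemiRingCat.ofHom (R.counitMap U)
  naturality U V f := by
    refine CommSemiRingCat.hom_ext (RingHom.ext fun x => ?_)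
    obtain ⟨n, rfl⟩ := RingCon.mk'_surjective _ x
    exact ev_nm_id f n

end MCSys

namespace TambaraFunctor

variable {G : Type u} [Group G]

/-- The coefficient system underlying `q S` is `q` of the Mackey functor underlying `S`: the
quotients are the same, and norm and transfer agree along isomorphisms. -/
noncomputable def toCSysIso (S : TambaraFunctor.{u, w} G) :
    S.toMackeyFunctor.toCSys ≅ (MCSys.toCSys G).obj S.toMCSys :=
  NatIso.ofComponents (fun U => Iso.refl (S.toMackeyFunctor.toCSys.obj U)) fun {U V} f => by
    refine AddCommMonCat.hom_ext (AddMonoidHom.ext fun x => ?_)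
    obtain ⟨m, rfl⟩ := AddCon.mk'_surjective x
    have h := Orb.bijective f.iso
    exact congrArg (S.qRingCon V.of).mk' ((S.tr_eq_res_inv _ h m).trans
      (S.nm_eq_res_inv _ h m).symm)

/-- The class of a restricted norm is given by the formula defining norms in `r (q S)`. -/
theorem mk_res_nm (S : TambaraFunctor.{u, w} G) {X Y : FinGSet.{u} G} (f : X →[G] Y)
    (m : S.obj X) (U : Orb.{u} G) (y : U.toFinGSet →[G] Y) :
    (S.qRingCon U).mk' (S.res y (S.nm f m)) =
      ∏ o : MCSys.Orbits (pullback f y),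
        S.toMCSys.nrm ((pullbackSnd f y).comp (MCSys.incl o))
          ((S.qRingCon (MCSys.orb o)).mk' (S.res ((pullbackFst f y).comp (MCSys.incl o)) m)) := by
  rw [← S.nm_res (isCartesian_pullback f y), S.nm_eq_prod_orbits, map_prod]
  refine Finset.prod_congr rfl fun o _ => ?_
  rw [S.res_comp]
  rfl

variable [Finite G]

/-- The value at `S` of the unit `S → r (q S)`. -/
noncomputable def unitHom (S : TambaraFunctor.{u, w} G) : S ⟶ (MCSys.r G).obj S.toMCSys :=
  { (S.toMackeyFunctor.unitHom ≫ (CSys.r G).map S.toCSysIso.hom :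
      MackeyFunctor.Hom S.toMackeyFunctor ((MCSys.r G).obj S.toMCSys).toMackeyFunctor) with
    app_nm := fun {X Y} f m => by
      refine CSys.ext_ev (N := (MCSys.toCSys G).obj S.toMCSys) fun U y => ?_
      have hev : ∀ {Z : FinGSet.{u} G} (m : S.obj Z) (V : Orb.{u} G) (z : V.toFinGSet →[G] Z),
          MCSys.ev (R := S.toMCSys) (MackeyFunctor.Hom.app (S.toMackeyFunctor.unitHom ≫
            (CSys.r G).map S.toCSysIso.hom : S.toMackeyFunctor ⟶ _) Z m) V z =
          (S.qRingCon V).mk' (S.res z m) := fun m V z =>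
        (CSys.ev_map S.toCSysIso.hom _ V z).trans
          (congrArg (S.toCSysIso.hom.app ⟨V⟩).hom (S.toMackeyFunctor.ev_unitHom m V z))
      refine (hev _ U y).trans ((S.mk_res_nm f m U y).trans ?_)
      refine Eq.trans ?_ (MCSys.ev_nm (R := S.toMCSys) f _ (isCartesian_pullback f y)
        MCSys.orb MCSys.incl (MCSys.incl_bijective _)).symm
      exact Finset.prod_congr rfl fun o _ => congrArg _ (hev m _ _).symm }

theorem ev_unitHom (S : TambaraFunctor.{u, w} G) {X : FinGSet.{u} G} (m : S.obj X) (U : Orb.{u} G)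
    (x : U.toFinGSet →[G] X) :
    MCSys.ev (R := S.toMCSys) ((S.unitHom : Hom _ _).app X m) U x =
      (S.qRingCon U).mk' (S.res x m) :=
  (CSys.ev_map S.toCSysIso.hom _ U x).trans
    (congrArg (S.toCSysIso.hom.app ⟨U⟩).hom (S.toMackeyFunctor.ev_unitHom m U x))

end TambaraFunctor

namespace MCSys

variable {G : Type u} [Group G] [Finite G]

theorem ev_map {R R' : MCSys.{u, w} G} (α : R ⟶ R') {X : FinGSet.{u} G}
    (n : ((r G).obj R).obj X) (U : Orb.{u} G) (x : U.toFinGSet →[G] X) :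
    ev (((r G).map α : TambaraFunctor.Hom _ _).app X n) U x = (α.app U).hom (ev n U x) :=
  CSys.ev_map ((toCSys G).map α) n U x

theorem hom_ext_ev {S : TambaraFunctor.{u, w} G} {R : MCSys.{u, w} G}
    {φ ψ : TambaraFunctor.Hom S ((r G).obj R)}
    (h : ∀ X m U x, ev (R := R) (φ.app X m) U x = ev (ψ.app X m) U x) : φ = ψ :=
  TambaraFunctor.Hom.ext (funext fun X => funext fun m =>
    CSys.ext_ev (N := (toCSys G).obj R) fun U x => h X m U x)

/-- The adjunction between `q` and `r`, with unit `m ↦ ((U, x) ↦ [R_x m])` and counit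
`[n] ↦ n(U, 1)`. -/
noncomputable def adj (G : Type u) [Group G] [Finite G] : TambaraFunctor.q.{u, w} G ⊣ r.{u, w} G :=
  Adjunction.mkOfUnitCounit
    { unit :=
        { app := fun S => S.unitHom
          naturality := fun S S' φ => hom_ext_ev fun X m U x => by
            refine (S'.ev_unitHom (TambaraFunctor.Hom.toHom φ |>.app X m) U x).trans ?_
            refine Eq.trans ?_ (ev_map ((TambaraFunctor.q G).map φ)
              (TambaraFunctor.Hom.toHom S.unitHom |>.app X m) U x).symm
            refine Eq.trans ?_ (congrArg (((TambaraFunctor.q G).map φ).app U).hom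
                (S.ev_unitHom m U x)).symm
            exact congrArg (S'.qRingCon U).mk' (TambaraFunctor.Hom.toHom φ |>.app_res x m).symm }
      counit :=
        { app := fun R => R.counitHom
          naturality := fun R R' α => by
            refine NatTrans.ext (funext fun U => CommSemiRingCat.hom_ext
              (RingHom.ext fun x => ?_))
            obtain ⟨n, rfl⟩ := RingCon.mk'_surjective _ x
            exact ev_map α n U (MulActionHom.id G) }
      left_triangle := by
        refine NatTrans.ext (funext fun S => NatTrans.ext (funext fun U => CommSemiRingCat.hom_ext
          (RingHom.ext fun x => ?_)))
        obtain ⟨m, rfl⟩ := RingCon.mk'_surjective _ x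
        refine (S.ev_unitHom m U (MulActionHom.id G)).trans ?_
        exact congrArg (S.qRingCon U).mk' (S.res_id m)
      right_triangle := by
        refine NatTrans.ext (funext fun R => hom_ext_ev fun X n U x => ?_)
        refine (ev_map R.counitHom (TambaraFunctor.Hom.toHom ((r G).obj R).unitHom |>.app X n)
          U x).trans ?_
        refine (congrArg (R.counitHom.app U).hom
          (((r G).obj R).ev_unitHom n U x)).trans ?_
        exact CSys.ev_res (N := (toCSys G).obj R) x n U (MulActionHom.id G) }

end MCSys

/-! ### Rational semigroups -/

namespace IsRational

variable {A : Type*} [AddCommMonoid A]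

theorem add_right_cancel (hA : IsRational A) {a b c : A} (h : a + c = b + c) : a = b := by
  obtain ⟨d, hd⟩ := hA.1 c
  rw [← add_zero a, ← hd, ← add_assoc, h, add_assoc, hd, add_zero]

theorem eq_zero_of_nsmul (hA : IsRational A) {n : ℕ} (hn : 0 < n) {a : A} (h : n • a = 0) :
    a = 0 :=
  (hA.2 n hn).1 (h.trans (smul_zero n).symm)

end IsRational

/-! ### Filtration by the size of orbits -/

namespace Orb

variable {G : Type u} [Group G]

theorem bijective_of_card_le {U V : Orb.{u} G} (f : U.toFinGSet →[G] V.toFinGSet)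
    (h : Nat.card U.toFinGSet ≤ Nat.card V.toFinGSet) : Function.Bijective f :=
  (surjective f).bijective_of_nat_card_le h

theorem card_pos (U : Orb.{u} G) : 0 < Nat.card U.toFinGSet := Nat.card_pos

theorem card_le_card_group [Finite G] (U : Orb.{u} G) : Nat.card U.toFinGSet ≤ Nat.card G := by
  obtain ⟨p⟩ := U.nonempty
  exact Nat.card_le_card_of_surjective (fun γ : G => γ • p) (MulAction.exists_smul_eq G p)

variable [Finite G]

/-- The maps to `X` from the transitive `G`-sets `G/H` with `k` elements. -/
abbrev CosetMaps (k : ℕ) (X : FinGSet.{u} G) : Type u :=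
  Σ H : {H : Subgroup G // Nat.card (coset H).toFinGSet = k}, (coset H.1).toFinGSet →[G] X

noncomputable instance (k : ℕ) (X : FinGSet.{u} G) : Fintype (CosetMaps k X) :=
  Fintype.ofFinite _

/-- The trivial coset. -/
def base (H : Subgroup G) : (coset H).toFinGSet := ((1 : G) : G ⧸ H)

theorem smul_base_eq {H : Subgroup G} {γ : G} : γ • base H = base H ↔ γ ∈ H := by
  change ((γ * 1 : G) : G ⧸ H) = ((1 : G) : G ⧸ H) ↔ γ ∈ H
  rw [mul_one, QuotientGroup.eq, mul_one, inv_mem_iff]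

/-- The maps from the coset spaces `G/H` to `W` with as many points as `W` are parametrized by the
images of the trivial coset, since `H` is the stabilizer of this image. -/
theorem sum_card_lifts {X : FinGSet.{u} G} {W : Orb.{u} G} (y : W.toFinGSet →[G] X) :
    ∑ p : CosetMaps (Nat.card W.toFinGSet) X, Fintype.card (CSys.Lifts y p.2) =
      Nat.card W.toFinGSet := by
  rw [← Fintype.card_sigma, ← Nat.card_eq_fintype_card]
  refine Nat.card_eq_of_bijective (fun q => q.2.1 (base q.1.1.1)) ⟨?_, fun b => ?_⟩
  · have hmem : ∀ (H : {H : Subgroup G // Nat.card (coset H).toFinGSet = Nat.card W.toFinGSet})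
        (σ : (coset H.1).toFinGSet →[G] W.toFinGSet) (γ : G),
        γ ∈ H.1 ↔ γ • σ (base H.1) = σ (base H.1) := by
      intro H σ γ
      rw [← map_smul, (bijective_of_card_le σ H.2.le).1.eq_iff, smul_base_eq]
    rintro ⟨⟨H, x⟩, ⟨(σ : (coset H.1).toFinGSet →[G] W.toFinGSet), (hσ : y.comp σ = x)⟩⟩
      ⟨⟨H', x'⟩, ⟨(σ' : (coset H'.1).toFinGSet →[G] W.toFinGSet), (hσ' : y.comp σ' = x')⟩⟩
      (e : σ (base H.1) = σ' (base H'.1))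
    obtain rfl : H = H' := Subtype.ext (Subgroup.ext fun γ => by
      rw [hmem H σ, hmem H' σ', e])
    obtain rfl : σ = σ' := hom_ext_of_apply _ e
    subst hσ hσ'
    rfl
  · let f : (coset (MulAction.stabilizer G b)).toFinGSet →[G] W.toFinGSet :=
      ⟨MulAction.ofQuotientStabilizer G b, fun γ z =>
        MulAction.ofQuotientStabilizer_smul G b γ z⟩
    have hf : Function.Bijective f :=
      ⟨MulAction.injective_ofQuotientStabilizer G b, surjective f⟩
    exact ⟨⟨⟨⟨_, Nat.card_eq_of_bijective f hf⟩, y.comp f⟩, ⟨f, rfl⟩⟩, one_smul G b⟩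

end Orb

namespace MackeyFunctor

variable {G : Type u} [Group G] (M : MackeyFunctor.{u, w} G) {X Y : FinGSet.{u} G}

/-- The congruence of agreeing up to addition of transfers. -/
noncomputable def transferCon (U : Orb.{u} G) : AddCon (M.obj U.toFinGSet) where
  r a b := ∃ s ∈ M.transfers U, ∃ t ∈ M.transfers U, a + s = b + t
  iseqv.refl _ := ⟨0, zero_mem _, 0, zero_mem _, rfl⟩
  iseqv.symm := fun ⟨s, hs, t, ht, e⟩ => ⟨t, ht, s, hs, e.symm⟩
  iseqv.trans := by
    rintro a b d ⟨s, hs, t, ht, e⟩ ⟨s', hs', t', ht', e'⟩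
    refine ⟨s + s', add_mem hs hs', t' + t, add_mem ht' ht, ?_⟩
    rw [← add_assoc, e, add_right_comm, e', add_assoc]
  add' := by
    rintro a b a' b' ⟨s, hs, t, ht, e⟩ ⟨s', hs', t', ht', e'⟩
    refine ⟨s + s', add_mem hs hs', t + t', add_mem ht ht', ?_⟩
    rw [add_add_add_comm, e, e', add_add_add_comm]

/-- The congruence `qCon` is contained in `transferCon`. -/
theorem exists_add_eq_of_mk_eq {U : Orb.{u} G} {a b : M.obj U.toFinGSet}
    (h : (M.qCon U).mk' a = (M.qCon U).mk' b) :
    ∃ s ∈ M.transfers U, ∃ t ∈ M.transfers U, a + s = b + t := by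
  have hle : M.qCon U ≤ M.transferCon U := by
    refine AddCon.addConGen_le.2 ?_
    rintro a b ⟨ha, rfl⟩
    exact ⟨0, zero_mem _, a, ha, by rw [add_zero, zero_add]⟩
  exact hle ((AddCon.eq _).1 h)

theorem mk_eq_zero_of_mem_transfers {U : Orb.{u} G} {a : M.obj U.toFinGSet}
    (h : a ∈ M.transfers U) : (M.qCon U).mk' a = 0 :=
  (AddCon.eq (M.qCon U)).2 (AddConGen.Rel.of _ _ ⟨h, rfl⟩)

/-- The sums of transfers from transitive `G`-sets with at least `k` points. -/
noncomputable def filtration (k : ℕ) (X : FinGSet.{u} G) : AddSubmonoid (M.obj X) :=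
  AddSubmonoid.closure {m | ∃ (V : Orb.{u} G) (x : V.toFinGSet →[G] X) (n : M.obj V.toFinGSet),
    k ≤ Nat.card V.toFinGSet ∧ M.tr x n = m}

theorem tr_mem_filtration {k : ℕ} {V : Orb.{u} G} (hk : k ≤ Nat.card V.toFinGSet)
    (x : V.toFinGSet →[G] X) (n : M.obj V.toFinGSet) : M.tr x n ∈ M.filtration k X :=
  AddSubmonoid.subset_closure ⟨V, x, n, hk, rfl⟩

theorem filtration_anti {k l : ℕ} (h : k ≤ l) : M.filtration l X ≤ M.filtration k X := by
  refine AddSubmonoid.closure_mono ?_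
  rintro _ ⟨V, x, n, hl, rfl⟩
  exact ⟨V, x, n, h.trans hl, rfl⟩

theorem tr_mem_filtration_of_mem {k : ℕ} (f : X →[G] Y) {m : M.obj X}
    (hm : m ∈ M.filtration k X) : M.tr f m ∈ M.filtration k Y := by
  have h : M.filtration k X ≤ (M.filtration k Y).comap (M.trHom f) := by
    refine (AddSubmonoid.closure_le).2 ?_
    rintro _ ⟨V, x, n, hk, rfl⟩
    change M.tr f (M.tr x n) ∈ M.filtration k Y
    rw [← M.tr_comp]
    exact M.tr_mem_filtration hk _ _
  exact h hm

theorem mem_filtration_one (m : M.obj X) : m ∈ M.filtration 1 X := by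
  rw [← M.sum_tr_incl m]
  exact sum_mem fun o _ => M.tr_mem_filtration (Orb.card_pos _) _ _

theorem filtration_eq_bot [Finite G] {k : ℕ} (hk : Nat.card G < k) : M.filtration k X = ⊥ := by
  refine (eq_bot_iff).2 ((AddSubmonoid.closure_le).2 ?_)
  rintro _ ⟨V, x, n, h, rfl⟩
  exact absurd (h.trans V.card_le_card_group) hk.not_ge

theorem transfers_eq_filtration (U : Orb.{u} G) :
    M.transfers U = M.filtration (Nat.card U.toFinGSet + 1) U.toFinGSet := by
  apply le_antisymm
  · refine iSup_le fun V => iSup_le fun f => iSup_le fun hf => ?_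
    rintro _ ⟨n, rfl⟩
    refine M.tr_mem_filtration ?_ _ _
    by_contra h
    exact hf ((Orb.isIso_iff f).2 (Orb.bijective_of_card_le _ (by omega)))
  · refine (AddSubmonoid.closure_le).2 ?_
    rintro _ ⟨V, x, n, h, rfl⟩
    refine M.tr_mem_transfers (Orb.ofMap x) (fun hx => ?_) n
    have := Nat.card_eq_of_bijective _ ((Orb.isIso_iff _).1 hx)
    omega

variable [Finite G]

/-- The operator `∑ T_x R_x`, summed over the maps `x : G/H → X` with `|G/H| = k`. -/
noncomputable def cosetOp (k : ℕ) (X : FinGSet.{u} G) : M.obj X →+ M.obj X :=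
  ∑ p : Orb.CosetMaps k X, (M.trHom p.2).comp (M.resHom p.2)

theorem cosetOp_apply (k : ℕ) (m : M.obj X) :
    M.cosetOp k X m = ∑ p : Orb.CosetMaps k X, M.tr p.2 (M.res p.2 m) := by
  rw [cosetOp, AddMonoidHom.finsetSum_apply]
  rfl

/-- The class of a restricted transfer is given by the formula for transfers in `r (q M)`. -/
theorem mk_res_tr {U W : Orb.{u} G} (y : W.toFinGSet →[G] X) (x : U.toFinGSet →[G] X)
    (n : M.obj W.toFinGSet) : (M.qCon U).mk' (M.res x (M.tr y n)) =
      ∑ σ : CSys.Lifts y x, (M.qCon U).mk' (M.res σ.1 n) := by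
  refine (M.ev_unitHom (M.tr y n) U x).symm.trans ?_
  rw [Hom.app_tr, CSys.ev_tr]
  exact Finset.sum_congr rfl fun σ _ => M.ev_unitHom n U σ.1

/-- `cosetOp k` acts on the graded piece of degree `k` of the filtration as multiplication by
`k`. -/
theorem cosetOp_tr {k : ℕ} {W : Orb.{u} G} (hk : k ≤ Nat.card W.toFinGSet)
    (y : W.toFinGSet →[G] X) (n : M.obj W.toFinGSet) :
    ∃ s ∈ M.filtration (k + 1) X, ∃ t ∈ M.filtration (k + 1) X,
      M.cosetOp k X (M.tr y n) + s = k • M.tr y n + t := by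
  have key : ∀ p : Orb.CosetMaps k X, ∃ s ∈ M.filtration (k + 1) X,
      ∃ t ∈ M.filtration (k + 1) X, M.tr p.2 (M.res p.2 (M.tr y n)) + s =
        Fintype.card (CSys.Lifts y p.2) • M.tr y n + t := by
    rintro ⟨⟨H, hH⟩, x⟩
    have h := M.mk_res_tr y x n
    rw [← map_sum] at h
    obtain ⟨s, hs, t, ht, e⟩ := M.exists_add_eq_of_mk_eq h
    rw [transfers_eq_filtration, hH] at hs ht
    refine ⟨_, M.tr_mem_filtration_of_mem x hs, _, M.tr_mem_filtration_of_mem x ht, ?_⟩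
    rw [← M.tr_add', e, M.tr_add', M.tr_sum]
    congr 1
    rw [← Finset.card_univ, ← Finset.sum_const]
    refine Finset.sum_congr rfl fun σ _ => ?_
    have hσ : Function.Bijective σ.1 := Orb.bijective_of_card_le σ.1 (hH.trans_le hk)
    obtain ⟨σ, rfl⟩ := σ
    exact (M.tr_comp y σ _).trans (congrArg (M.tr y) (M.tr_res_self σ hσ n))
  choose s hs t ht e using key
  have hsum : M.cosetOp k X (M.tr y n) + ∑ p, s p =
      (∑ p : Orb.CosetMaps k X, Fintype.card (CSys.Lifts y p.2)) • M.tr y n + ∑ p, t p := by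
    rw [cosetOp_apply, ← Finset.sum_add_distrib, Finset.sum_smul, ← Finset.sum_add_distrib]
    exact Finset.sum_congr rfl fun p _ => e p
  have hs' := sum_mem (S := M.filtration (k + 1) X) (t := Finset.univ) fun p _ => hs p
  have ht' := sum_mem (S := M.filtration (k + 1) X) (t := Finset.univ) fun p _ => ht p
  rcases hk.eq_or_lt with rfl | hlt
  · exact ⟨_, hs', _, ht', hsum.trans (by rw [Orb.sum_card_lifts])⟩
  -- If `W` has more than `k` points, both `cosetOp k (T_y n)` and `k • T_y n` are in the next step.
  · refine ⟨∑ p, s p + k • M.tr y n, add_mem hs' (nsmul_mem (M.tr_mem_filtration hlt y n) _),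
      (∑ p : Orb.CosetMaps k X, Fintype.card (CSys.Lifts y p.2)) • M.tr y n + ∑ p, t p,
      add_mem (nsmul_mem (M.tr_mem_filtration hlt y n) _) ht', ?_⟩
    rw [← add_assoc, hsum, add_comm]

theorem cosetOp_of_mem {k : ℕ} {m : M.obj X} (hm : m ∈ M.filtration k X) :
    ∃ s ∈ M.filtration (k + 1) X, ∃ t ∈ M.filtration (k + 1) X,
      M.cosetOp k X m + s = k • m + t := by
  induction hm using AddSubmonoid.closure_induction with
  | mem m hm =>
    obtain ⟨V, x, n, hk, rfl⟩ := hm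
    exact M.cosetOp_tr hk x n
  | zero => exact ⟨0, zero_mem _, 0, zero_mem _, by rw [map_zero, smul_zero]⟩
  | add a b _ _ ha hb =>
    obtain ⟨s, hs, t, ht, e⟩ := ha
    obtain ⟨s', hs', t', ht', e'⟩ := hb
    refine ⟨s + s', add_mem hs hs', t + t', add_mem ht ht', ?_⟩
    rw [map_add, add_add_add_comm, e, e', add_add_add_comm, smul_add]

variable {M}

/-- If all restrictions of `d` to transitive `G`-sets vanish modulo transfers along
non-isomorphisms, then in every step of the filtration there are elements whose difference is a
positive multiple of `d`. -/
theorem exists_nsmul_add_eq (hM : rational G M) {d : M.obj X}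
    (hd : ∀ (U : Orb.{u} G) (x : U.toFinGSet →[G] X), (M.qCon U).mk' (M.res x d) = 0) (k : ℕ) :
    ∃ j : ℕ, 0 < j ∧ ∃ s ∈ M.filtration (k + 1) X, ∃ t ∈ M.filtration (k + 1) X,
      j • d + s = t := by
  induction k with
  | zero => exact ⟨1, one_pos, 0, zero_mem _, _, M.mem_filtration_one _, rfl⟩
  | succ k ih =>
    obtain ⟨j, hj, a, ha, b, hb, e⟩ := ih
    have hΘ : ∃ s ∈ M.filtration (k + 1 + 1) X, ∃ t ∈ M.filtration (k + 1 + 1) X,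
        M.cosetOp (k + 1) X d + s = t := by
      have key : ∀ p : Orb.CosetMaps (k + 1) X, ∃ s ∈ M.filtration (k + 1 + 1) X,
          ∃ t ∈ M.filtration (k + 1 + 1) X, M.tr p.2 (M.res p.2 d) + s = t := by
        rintro ⟨⟨H, hH⟩, x⟩
        obtain ⟨s, hs, t, ht, e⟩ := M.exists_add_eq_of_mk_eq
          ((hd _ x).trans (map_zero (M.qCon (Orb.coset H)).mk').symm)
        rw [transfers_eq_filtration, hH] at hs ht
        refine ⟨_, M.tr_mem_filtration_of_mem x hs, _, M.tr_mem_filtration_of_mem x ht, ?_⟩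
        rw [← M.tr_add', e, zero_add]
      choose s hs t ht e using key
      refine ⟨∑ p, s p, sum_mem fun p _ => hs p, ∑ p, t p, sum_mem fun p _ => ht p, ?_⟩
      rw [cosetOp_apply, ← Finset.sum_add_distrib]
      exact Finset.sum_congr rfl fun p _ => e p
    obtain ⟨s, hs, t, ht, e0⟩ := hΘ
    obtain ⟨u, hu, v, hv, e1⟩ := M.cosetOp_of_mem ha
    obtain ⟨u', hu', v', hv', e2⟩ := M.cosetOp_of_mem hb
    refine ⟨(k + 1) * j, Nat.mul_pos k.succ_pos hj, v' + u + j • s,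
      add_mem (add_mem hv' hu) (nsmul_mem hs j), j • t + v + u',
      add_mem (add_mem (nsmul_mem ht j) hv) hu', ?_⟩
    -- Adding `cosetOp a` to both sides reduces the claim to the relations for `a`, `b` and `d`.
    apply (hM X).add_right_cancel (c := M.cosetOp (k + 1) X a)
    have e3 : j • M.cosetOp (k + 1) X d + M.cosetOp (k + 1) X a = M.cosetOp (k + 1) X b := by
      rw [← map_nsmul, ← map_add, e]
    calc (((k + 1) * j) • d + (v' + u + j • s)) + M.cosetOp (k + 1) X a
        = ((k + 1) * j) • d + (M.cosetOp (k + 1) X a + u) + v' + j • s := by abel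
      _ = (k + 1) • (j • d + a) + v + v' + j • s := by
          rw [e1, mul_smul, smul_add]; abel
      _ = (M.cosetOp (k + 1) X b + u') + v + j • s := by rw [e, e2]; abel
      _ = j • (M.cosetOp (k + 1) X d + s) + v + u' + M.cosetOp (k + 1) X a := by
          rw [← e3, smul_add]; abel
      _ = j • t + v + u' + M.cosetOp (k + 1) X a := by rw [e0]

theorem unitHom_app_injective (hM : rational G M) (X : FinGSet.{u} G) :
    Function.Injective ((M.unitHom : Hom _ _).app X) := by
  have hzero : ∀ d : M.obj X, (M.unitHom : Hom _ _).app X d = 0 → d = 0 := by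
    intro d hd
    obtain ⟨j, hj, s, hs, t, ht, e⟩ := exists_nsmul_add_eq hM (d := d) (fun U x => by
      refine (M.ev_unitHom d U x).symm.trans ?_
      rw [hd]
      exact CSys.ev_zero U x) (Nat.card G)
    rw [M.filtration_eq_bot (Nat.lt_succ_self _)] at hs ht
    rw [(AddSubmonoid.mem_bot).1 hs, (AddSubmonoid.mem_bot).1 ht, add_zero] at e
    exact (hM X).eq_zero_of_nsmul hj e
  intro a b h
  obtain ⟨c, hc⟩ := (hM X).1 b
  have h0 : a + c = 0 := by
    apply hzero
    rw [Hom.app_add, h, ← Hom.app_add, hc, Hom.app_zero]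
  exact (hM X).add_right_cancel (h0.trans hc.symm)

end MackeyFunctor

/-! ### Rational objects -/

namespace MackeyFunctor

variable {G : Type u} [Group G] {M : MackeyFunctor.{u, w} G} {X Y : FinGSet.{u} G}

/-- In the rational case every step of the filtration is divisible. -/
theorem exists_nsmul_eq_of_mem_filtration (hM : rational G M) {n : ℕ} (hn : 0 < n) {k : ℕ}
    {m : M.obj X} (hm : m ∈ M.filtration k X) : ∃ m' ∈ M.filtration k X, n • m' = m := by
  induction hm using AddSubmonoid.closure_induction with
  | mem m hm =>
    obtain ⟨V, x, a, hk, rfl⟩ := hm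
    obtain ⟨b, rfl⟩ := ((hM _).2 n hn).2 a
    exact ⟨_, M.tr_mem_filtration hk x b, (M.tr_nsmul x n b).symm⟩
  | zero => exact ⟨0, zero_mem _, smul_zero n⟩
  | add a b _ _ ha hb =>
    obtain ⟨a', ha', rfl⟩ := ha
    obtain ⟨b', hb', rfl⟩ := hb
    exact ⟨a' + b', add_mem ha' hb', smul_add n a' b'⟩

theorem rational_q (hM : rational G M) : CSys.rational G ((q G).obj M) := by
  intro U
  change IsRational (M.qCon U).Quotient
  refine ⟨fun x => ?_, fun n hn => ⟨fun x y h => ?_, fun x => ?_⟩⟩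
  · obtain ⟨a, rfl⟩ := AddCon.mk'_surjective x
    obtain ⟨b, hb⟩ := (hM _).1 a
    exact ⟨(M.qCon U).mk' b, by rw [← map_add, hb, map_zero]⟩
  · obtain ⟨a, rfl⟩ := AddCon.mk'_surjective x
    obtain ⟨b, rfl⟩ := AddCon.mk'_surjective y
    change n • (M.qCon U).mk' a = n • (M.qCon U).mk' b at h
    rw [← map_nsmul, ← map_nsmul] at h
    obtain ⟨s, hs, t, ht, e⟩ := M.exists_add_eq_of_mk_eq h
    rw [transfers_eq_filtration] at hs ht
    obtain ⟨s, hs', rfl⟩ := exists_nsmul_eq_of_mem_filtration hM hn hs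
    obtain ⟨t, ht', rfl⟩ := exists_nsmul_eq_of_mem_filtration hM hn ht
    rw [← transfers_eq_filtration] at hs' ht'
    rw [← smul_add, ← smul_add] at e
    have e' := congrArg (M.qCon U).mk' (((hM _).2 n hn).1 e)
    rwa [map_add, map_add, M.mk_eq_zero_of_mem_transfers hs', M.mk_eq_zero_of_mem_transfers ht',
      add_zero, add_zero] at e'
  · obtain ⟨a, rfl⟩ := AddCon.mk'_surjective x
    obtain ⟨b, rfl⟩ := ((hM _).2 n hn).2 a
    exact ⟨(M.qCon U).mk' b, (map_nsmul _ n b).symm⟩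

/-- A morphism of Mackey functors with bijective components is an isomorphism. -/
theorem isIso_of_bijective {M M' : MackeyFunctor.{u, w} G} (φ : M ⟶ M')
    (h : ∀ X, Function.Bijective (Hom.app φ X)) : IsIso φ := by
  let e : ∀ X, M.obj X ≃ M'.obj X := fun X => Equiv.ofBijective _ (h X)
  let ψ : Hom M' M :=
    { app := fun X => (e X).symm
      app_res := fun {X Y} f m => (e X).injective (by
        rw [Equiv.apply_symm_apply]
        refine Eq.trans ?_ (Hom.app_res φ f _).symm
        exact congrArg (M'.res f) ((e Y).apply_symm_apply m).symm)
      app_tr := fun {X Y} f m => (e Y).injective (by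
        rw [Equiv.apply_symm_apply]
        refine Eq.trans ?_ (Hom.app_tr φ f _).symm
        exact congrArg (M'.tr f) ((e X).apply_symm_apply m).symm) }
  exact ⟨ψ, Hom.ext (funext fun X => funext (e X).symm_apply_apply),
    Hom.ext (funext fun X => funext (e X).apply_symm_apply)⟩

end MackeyFunctor

namespace TambaraFunctor

variable {G : Type u} [Group G]

/-- A morphism of Tambara functors with bijective components is an isomorphism. -/
theorem isIso_of_bijective {S S' : TambaraFunctor.{u, w} G} (φ : Hom S S')
    (h : ∀ X, Function.Bijective (φ.app X)) : IsIso (show S ⟶ S' from φ) := by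
  let e : ∀ X, S.obj X ≃ S'.obj X := fun X => Equiv.ofBijective _ (h X)
  let ψ : Hom S' S :=
    { app := fun X => (e X).symm
      app_res := fun {X Y} f m => (e X).injective (by
        rw [Equiv.apply_symm_apply]
        refine Eq.trans ?_ (φ.app_res f _).symm
        exact congrArg (S'.res f) ((e Y).apply_symm_apply m).symm)
      app_tr := fun {X Y} f m => (e Y).injective (by
        rw [Equiv.apply_symm_apply]
        refine Eq.trans ?_ (φ.app_tr f _).symm
        exact congrArg (S'.tr f) ((e X).apply_symm_apply m).symm)
      app_nm := fun {X Y} f m => (e Y).injective (by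
        rw [Equiv.apply_symm_apply]
        refine Eq.trans ?_ (φ.app_nm f _).symm
        exact congrArg (S'.nm f) ((e X).apply_symm_apply m).symm) }
  exact ⟨ψ, Hom.ext (funext fun X => funext (e X).symm_apply_apply),
    Hom.ext (funext fun X => funext (e X).apply_symm_apply)⟩

end TambaraFunctor

namespace Orb

variable {G : Type u} [Group G] {X : FinGSet.{u} G}

/-- A map between transitive `G`-sets with the same number of points is bijective, and inverting it
exchanges lifts of `y` along `x` and lifts of `x` along `y`. -/
theorem card_lifts_comm {V W : Orb.{u} G} (h : Nat.card V.toFinGSet = Nat.card W.toFinGSet)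
    (x : V.toFinGSet →[G] X) (y : W.toFinGSet →[G] X) :
    Fintype.card (CSys.Lifts x y) = Fintype.card (CSys.Lifts y x) := by
  refine Fintype.card_congr
    { toFun := fun τ => ⟨FinGSet.inv τ.1 (bijective_of_card_le τ.1 h.ge), ?_⟩
      invFun := fun σ => ⟨FinGSet.inv σ.1 (bijective_of_card_le σ.1 h.le), ?_⟩
      left_inv := fun τ => Subtype.ext (MulActionHom.ext fun w => ?_)
      right_inv := fun σ => Subtype.ext (MulActionHom.ext fun v => ?_) }
  · refine MulActionHom.ext fun v => ?_
    refine (DFunLike.congr_fun τ.2 _).symm.trans ?_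
    exact congrArg x (apply_inv τ.1 _ v)
  · refine MulActionHom.ext fun w => ?_
    refine (DFunLike.congr_fun σ.2 _).symm.trans ?_
    exact congrArg y (apply_inv σ.1 _ w)
  · have hτ := bijective_of_card_le τ.1 h.ge
    refine (bijective_of_card_le (FinGSet.inv τ.1 hτ) h.le).1 ?_
    exact (apply_inv (FinGSet.inv τ.1 hτ) _ w).trans (inv_apply τ.1 hτ w).symm
  · have hσ := bijective_of_card_le σ.1 h.le
    refine (bijective_of_card_le (FinGSet.inv σ.1 hσ) h.ge).1 ?_
    exact (apply_inv (FinGSet.inv σ.1 hσ) _ v).trans (inv_apply σ.1 hσ v).symm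

end Orb

namespace CSys

section

variable {G : Type u} [Group G] (N : CSys.{u, w} G)

theorem push_refl (U : Orb.{u} G) (a : N.obj ⟨U⟩) : N.push (Iso.refl U) a = a :=
  ConcreteCategory.congr_hom (N.map_id ⟨U⟩) a

theorem push_trans {U V W : Orb.{u} G} (e : U ≅ V) (f : V ≅ W) (a : N.obj ⟨U⟩) :
    N.push (e ≪≫ f) a = N.push f (N.push e a) :=
  ConcreteCategory.congr_hom (N.map_comp (CoreHom.mk e : (⟨U⟩ : Core (Orb.{u} G)) ⟶ ⟨V⟩)
    (CoreHom.mk f : (⟨V⟩ : Core (Orb.{u} G)) ⟶ ⟨W⟩)) a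

theorem push_injective {U V : Orb.{u} G} (e : U ≅ V) : Function.Injective (N.push e) := by
  intro a b h
  rw [← N.push_refl U a, ← N.push_refl U b, ← e.self_symm_id, N.push_trans, N.push_trans, h]

end

variable {G : Type u} [Group G] [Finite G] {N : CSys.{u, w} G} {X Y : FinGSet.{u} G}

theorem rational_r (hN : rational G N) : MackeyFunctor.rational G ((r G).obj N) := by
  intro X
  refine ⟨fun a => ?_, fun n hn => ⟨fun a b h => ?_, fun a => ?_⟩⟩
  · choose b hb using fun (U : Orb.{u} G) (x : U.toFinGSet →[G] X) => (hN U).1 (ev a U x)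
    refine ⟨ofFam ⟨b, fun U V e x => ?_⟩, ext_ev fun U x => ?_⟩
    · apply (hN V).add_right_cancel (c := ev a V x)
      rw [add_comm (b V x), hb, ← push_ev a e x, ← map_add, add_comm, hb, map_zero]
    · refine (ev_add _ _ U x).trans (Eq.trans ?_ (ev_zero U x).symm)
      exact (congrArg (ev a U x + ·) (ev_ofFam _ U x)).trans (hb U x)
  · refine ext_ev fun U x => ((hN U).2 n hn).1 ?_
    have h' := congrArg (fun m => ev m U x) h
    simp only [ev_nsmul] at h'
    exact h'
  · choose b hb using fun (U : Orb.{u} G) (x : U.toFinGSet →[G] X) =>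
      ((hN U).2 n hn).2 (ev a U x)
    refine ⟨ofFam ⟨b, fun U V e x => ?_⟩, ext_ev fun U x => ?_⟩
    · refine ((hN V).2 n hn).1 ?_
      refine Eq.trans ?_ ((push_ev a e x).trans (hb V x).symm)
      exact (map_nsmul (N.push e) n _).symm.trans (congrArg (N.push e) (hb U _))
    · refine (ev_nsmul n _ U x).trans ?_
      exact (congrArg (n • ·) (ev_ofFam _ U x)).trans (hb U x)

theorem ev_cosetOp (k : ℕ) (d : ((r G).obj N).obj X) (V : Orb.{u} G) (y : V.toFinGSet →[G] X) :
    ev (((r G).obj N).cosetOp k X d) V y =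
      (∑ p : Orb.CosetMaps k X, Fintype.card (Lifts p.2 y)) • ev d V y := by
  rw [MackeyFunctor.cosetOp_apply, ev_sum, Finset.sum_smul]
  refine Finset.sum_congr rfl fun p _ => ?_
  rw [ev_tr, ← Finset.card_univ, ← Finset.sum_const]
  refine Finset.sum_congr rfl fun τ _ => ?_
  rw [ev_res]
  exact congrArg (ev d V) τ.2

theorem ev_cosetOp_card (d : ((r G).obj N).obj X) (V : Orb.{u} G) (y : V.toFinGSet →[G] X) :
    ev (((r G).obj N).cosetOp (Nat.card V.toFinGSet) X d) V y =
      Nat.card V.toFinGSet • ev d V y := by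
  rw [ev_cosetOp]
  congr 1
  refine Eq.trans ?_ (Orb.sum_card_lifts y)
  exact Finset.sum_congr rfl fun p _ => Orb.card_lifts_comm p.1.2 p.2 y

theorem cosetOp_mem_filtration (k : ℕ) (d : ((r G).obj N).obj X) :
    ((r G).obj N).cosetOp k X d ∈ ((r G).obj N).filtration k X := by
  rw [MackeyFunctor.cosetOp_apply]
  exact sum_mem fun p _ => MackeyFunctor.tr_mem_filtration _ p.1.2.ge _ _

/-- A family vanishing on all transitive `G`-sets with fewer than `k` points has a multiple in the
`k`-th step of the filtration. -/
theorem exists_nsmul_mem_filtration (hN : rational G N) (l : ℕ) :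
    ∀ k, Nat.card G + 1 = k + l → ∀ d : ((r G).obj N).obj X,
    (∀ (V : Orb.{u} G) (x : V.toFinGSet →[G] X), Nat.card V.toFinGSet < k → ev d V x = 0) →
    ∃ j : ℕ, 0 < j ∧ j • d ∈ ((r G).obj N).filtration k X := by
  induction l with
  | zero =>
    intro k hk d hd
    have : d = 0 := ext_ev fun U x => by
      rw [ev_zero, hd]
      have := U.card_le_card_group
      omega
    exact ⟨1, one_pos, by rw [this, smul_zero]; exact zero_mem _⟩
  | succ l ih =>
    intro k hk d hd
    rcases Nat.eq_zero_or_pos k with rfl | hk0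
    · exact ⟨1, one_pos, MackeyFunctor.filtration_anti _ (Nat.zero_le 1)
        (MackeyFunctor.mem_filtration_one _ _)⟩
    obtain ⟨d', hd'⟩ := (rational_r hN X).1 d
    have hev : ∀ (V : Orb.{u} G) (x : V.toFinGSet →[G] X), ev d V x + ev d' V x = 0 := by
      intro V x
      rw [← ev_add, hd', ev_zero]
    -- Subtracting `cosetOp k d` from `k • d` kills the values on sets with `k` points.
    obtain ⟨j, hj, hmem⟩ := ih (k + 1) (by omega) (k • d + ((r G).obj N).cosetOp k X d') (by
      intro V x hV
      rcases (Nat.lt_succ_iff.1 hV).eq_or_lt with rfl | hlt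
      · rw [ev_add, ev_nsmul, ev_cosetOp_card, ← smul_add, hev, smul_zero]
      · have h0 := hev V x
        rw [hd V x hlt, zero_add] at h0
        rw [ev_add, ev_nsmul, ev_cosetOp, h0, hd V x hlt, smul_zero, smul_zero, add_zero])
    refine ⟨j * k, Nat.mul_pos hj hk0, ?_⟩
    have h : (j * k) • d =
        j • (k • d + ((r G).obj N).cosetOp k X d') + j • ((r G).obj N).cosetOp k X d := by
      rw [← smul_add, add_assoc, ← map_add, add_comm d', hd', map_zero, add_zero, mul_smul]
    rw [h]
    exact add_mem (MackeyFunctor.filtration_anti _ k.le_succ hmem)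
      (nsmul_mem (cosetOp_mem_filtration k d) j)

/-- A family on a transitive `G`-set `U` vanishing at the identity has a multiple that is a sum of
transfers along non-isomorphisms. -/
theorem exists_nsmul_mem_filtration_of_id (hN : rational G N) {U : Orb.{u} G}
    (d : ((r G).obj N).obj U.toFinGSet) (hd : ev d U (MulActionHom.id G) = 0) :
    ∃ j : ℕ, 0 < j ∧
      j • d ∈ ((r G).obj N).filtration (Nat.card U.toFinGSet + 1) U.toFinGSet := by
  have hU := U.card_le_card_group
  refine exists_nsmul_mem_filtration hN (Nat.card G - Nat.card U.toFinGSet) _ (by omega) d ?_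
  intro V x hV
  have hx := Orb.bijective_of_card_le x (Nat.lt_succ_iff.1 hV)
  apply N.push_injective (Orb.isoOfBijective x hx)
  rw [map_zero, ← hd]
  exact push_ev d (Orb.isoOfBijective x hx) (MulActionHom.id G)

theorem counitMap_injective (hN : rational G N) (U : Orb.{u} G) :
    Function.Injective (N.counitMap U) := by
  intro x y h
  obtain ⟨n, rfl⟩ := AddCon.mk'_surjective x
  obtain ⟨n', rfl⟩ := AddCon.mk'_surjective y
  rw [counitMap_mk, counitMap_mk] at h
  obtain ⟨m, hm⟩ := (rational_r hN _).1 n'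
  obtain ⟨j, hj, hmem⟩ := exists_nsmul_mem_filtration_of_id hN (n + m) (by
    rw [ev_add, h, ← ev_add, hm, ev_zero])
  rw [← MackeyFunctor.transfers_eq_filtration] at hmem
  have hq : IsRational (((r G).obj N).qCon U).Quotient :=
    MackeyFunctor.rational_q (rational_r hN) U
  have h0 : (((r G).obj N).qCon U).mk' (n + m) = 0 := by
    apply hq.eq_zero_of_nsmul hj
    rw [← map_nsmul]
    exact MackeyFunctor.mk_eq_zero_of_mem_transfers _ hmem
  apply hq.add_right_cancel (c := (((r G).obj N).qCon U).mk' m)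
  rw [← map_add, ← map_add, h0, hm, map_zero]

/-- The family on `U` with value `a` at the identity, vanishing at all non-isomorphisms. -/
noncomputable def single {U : Orb.{u} G} (a : N.obj ⟨U⟩) : N.Fam U.toFinGSet :=
  open scoped Classical in
  ⟨fun V x => if h : Function.Bijective x then N.push (Orb.isoOfBijective x h).symm a else 0,
    fun V W e x => by
      beta_reduce
      by_cases h : Function.Bijective x
      · have h' : Function.Bijective (x.comp (Orb.toMap e.hom)) := h.comp (Orb.bijective e)
        rw [dif_pos h, dif_pos h', ← N.push_trans]
        have he : Orb.isoOfBijective _ h' = e ≪≫ Orb.isoOfBijective x h := Iso.ext rfl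
        rw [he, Iso.trans_symm, Iso.trans_assoc, Iso.symm_self_id, Iso.trans_refl]
      · have h' : ¬ Function.Bijective (x.comp (Orb.toMap e.hom)) := fun h' =>
          h ((Function.Bijective.of_comp_iff x (Orb.bijective e)).1 h')
        rw [dif_neg h, dif_neg h', map_zero]⟩

theorem counitMap_surjective (N : CSys.{u, w} G) (U : Orb.{u} G) :
    Function.Surjective (N.counitMap U) := by
  intro a
  refine ⟨(((r G).obj N).qCon U).mk' (ofFam (single a)), ?_⟩
  rw [counitMap_mk, ev_ofFam]
  have h : Function.Bijective (MulActionHom.id G : U.toFinGSet →[G] U.toFinGSet) :=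
    Function.bijective_id
  refine (dif_pos h).trans ?_
  rw [show Orb.isoOfBijective _ h = Iso.refl U from Iso.ext rfl]
  exact N.push_refl U a

theorem isIso_counitHom (hN : rational G N) : IsIso N.counitHom := by
  rw [NatTrans.isIso_iff_isIso_app]
  intro U
  have h : Function.Bijective (N.counitHom.app U) :=
    ⟨counitMap_injective hN U.of, N.counitMap_surjective U.of⟩
  exact (ConcreteCategory.isIso_iff_bijective _).2 h

end CSys

namespace MackeyFunctor

variable {G : Type u} [Group G] [Finite G] {M : MackeyFunctor.{u, w} G}

/-- The filtration of `r (q M)` is contained in the image of the unit, by downward induction on the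
step. -/
theorem filtration_le_mrange (hM : rational G M) (l : ℕ) : ∀ k, Nat.card G + 1 ≤ k + l →
    ∀ X : FinGSet.{u} G, ((CSys.r G).obj M.toCSys).filtration k X ≤
      AddMonoidHom.mrange (Hom.appHom M.unitHom X) := by
  induction l with
  | zero =>
    intro k hk X
    rw [filtration_eq_bot _ (by omega)]
    exact bot_le
  | succ l ih =>
    intro k hk X
    refine (AddSubmonoid.closure_le).2 ?_
    rintro _ ⟨W, y, n, hW, rfl⟩
    have hr : rational G ((CSys.r G).obj M.toCSys) := CSys.rational_r (rational_q hM)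
    obtain ⟨m, hm⟩ := AddCon.mk'_surjective (c := M.qCon W) (CSys.ev n W (MulActionHom.id G))
    have hηm : CSys.ev (Hom.app M.unitHom _ m) W (MulActionHom.id G) =
        CSys.ev n W (MulActionHom.id G) :=
      (M.ev_unitHom m W _).trans ((congrArg (M.qCon W).mk' (M.res_id m)).trans hm)
    obtain ⟨m', hm'⟩ := (hr _).1 (Hom.app M.unitHom _ m)
    obtain ⟨j, hj, hmem⟩ := CSys.exists_nsmul_mem_filtration_of_id (N := M.toCSys)
      (rational_q hM) (n + m') (by
      rw [CSys.ev_add, ← hηm, ← CSys.ev_add, hm', CSys.ev_zero])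
    obtain ⟨c, hc⟩ := ih (Nat.card W.toFinGSet + 1) (by omega) _ hmem
    obtain ⟨c', rfl⟩ := ((hM _).2 j hj).2 c
    have hd : Hom.appHom M.unitHom _ c' = n + m' := by
      apply ((hr _).2 j hj).1
      exact (map_nsmul (Hom.appHom M.unitHom _) j c').symm.trans hc
    refine ⟨M.tr y (c' + m), ?_⟩
    refine (Hom.app_tr M.unitHom y _).trans (congrArg _ ?_)
    refine (Hom.app_add M.unitHom c' m).trans ?_
    refine (congrArg (· + Hom.app M.unitHom _ m) hd).trans ?_
    rw [add_assoc, add_comm m', hm', add_zero]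

theorem unitHom_app_bijective (hM : rational G M) (X : FinGSet.{u} G) :
    Function.Bijective (Hom.app M.unitHom X) :=
  ⟨unitHom_app_injective hM X, fun m =>
    filtration_le_mrange hM (Nat.card G) 1 (by omega) X (mem_filtration_one _ m)⟩

end MackeyFunctor

/-! ### The equivalences -/

/-- An adjunction whose unit and counit are isomorphisms on objects satisfying `P` and `Q` restricts
to an equivalence of the corresponding full subcategories. -/
theorem CategoryTheory.Adjunction.restrictToEquivalence {C D : Type*} [Category C] [Category D]
    {F : C ⥤ D} {H : D ⥤ C} (adj : F ⊣ H) {P : ObjectProperty C} {Q : ObjectProperty D}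
    (hF : ∀ X, P X → Q (F.obj X)) (hH : ∀ Y, Q Y → P (H.obj Y))
    (hunit : ∀ X, P X → IsIso (adj.unit.app X)) (hcounit : ∀ Y, Q Y → IsIso (adj.counit.app Y)) :
    RestrictToEquivalence F H P Q := by
  let F' : P.FullSubcategory ⥤ Q.FullSubcategory :=
    Q.lift (P.ι ⋙ F) fun X => hF X.obj X.property
  let H' : Q.FullSubcategory ⥤ P.FullSubcategory :=
    P.lift (Q.ι ⋙ H) fun Y => hH Y.obj Y.property
  let adj' : F' ⊣ H' := adj.restrictFullyFaithful P.fullyFaithfulι Q.fullyFaithfulι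
    (Iso.refl _) (Iso.refl _)
  have hu : ∀ X, IsIso (adj'.unit.app X) := fun X => by
    have := hunit X.obj X.property
    have h : P.ι.map (adj'.unit.app X) = adj.unit.app X.obj := by
      refine (adj.map_restrictFullyFaithful_unit_app _ _ _ _ X).trans ?_
      simp [F', H']
    have : IsIso (P.ι.map (adj'.unit.app X)) := by rw [h]; assumption
    exact isIso_of_reflects_iso _ P.ι
  have hc : ∀ Y, IsIso (adj'.counit.app Y) := fun Y => by
    have := hcounit Y.obj Y.property
    have h : Q.ι.map (adj'.counit.app Y) = adj.counit.app Y.obj := by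
      refine (adj.map_restrictFullyFaithful_counit_app _ _ _ _ Y).trans ?_
      simp [F', H']
    have : IsIso (Q.ι.map (adj'.counit.app Y)) := by rw [h]; assumption
    exact isIso_of_reflects_iso _ Q.ι
  exact ⟨hF, hH, adj'.toEquivalence, rfl, rfl⟩

namespace TambaraFunctor

variable {G : Type u} [Group G] {S : TambaraFunctor.{u, w} G}

theorem rational_q (hS : rational G S) : MCSys.rational G ((q G).obj S) :=
  fun U => MackeyFunctor.rational_q (M := S.toMackeyFunctor) hS U

variable [Finite G]

theorem isIso_unitHom (hS : rational G S) : IsIso S.unitHom := by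
  refine isIso_of_bijective S.unitHom fun X => ?_
  have h1 := MackeyFunctor.unitHom_app_bijective (M := S.toMackeyFunctor) hS X
  let α := (CSys.r G).mapIso S.toCSysIso
  have h2 : Function.Bijective (MackeyFunctor.Hom.app α.hom X) :=
    Function.bijective_iff_has_inverse.2 ⟨MackeyFunctor.Hom.app α.inv X,
      fun m => congrFun (congrFun (congrArg MackeyFunctor.Hom.app α.hom_inv_id) X) m,
      fun m => congrFun (congrFun (congrArg MackeyFunctor.Hom.app α.inv_hom_id) X) m⟩
  exact h2.comp h1

end TambaraFunctor

namespace MCSys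

variable {G : Type u} [Group G] [Finite G] {R : MCSys.{u, w} G}

theorem rational_r (hR : rational G R) : TambaraFunctor.rational G ((r G).obj R) :=
  CSys.rational_r (N := (toCSys G).obj R) hR

theorem isIso_counitHom (hR : rational G R) : IsIso R.counitHom := by
  rw [NatTrans.isIso_iff_isIso_app]
  intro U
  have h : Function.Bijective (R.counitHom.app U) :=
    ⟨CSys.counitMap_injective (N := (toCSys G).obj R) hR U,
      CSys.counitMap_surjective ((toCSys G).obj R) U⟩
  exact (ConcreteCategory.isIso_iff_bijective _).2 h

end MCSys

theorem mainTheorem6 (G : Type u) [Group G] [Finite G] :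
    (∃ adj : MackeyFunctor.q.{u, w} G ⊣ CSys.r.{u, w} G,
      (∀ M, MackeyFunctor.rational.{u, w} G M → IsIso (adj.unit.app M)) ∧
      (∀ N, CSys.rational.{u, w} G N → IsIso (adj.counit.app N)) ∧
      RestrictToEquivalence (MackeyFunctor.q.{u, w} G) (CSys.r.{u, w} G)
        (MackeyFunctor.rational G) (CSys.rational G)) ∧
    (∃ adj : TambaraFunctor.q.{u, w} G ⊣ MCSys.r.{u, w} G,
      (∀ S, TambaraFunctor.rational.{u, w} G S → IsIso (adj.unit.app S)) ∧
      (∀ R, MCSys.rational.{u, w} G R → IsIso (adj.counit.app R)) ∧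
      RestrictToEquivalence (TambaraFunctor.q.{u, w} G) (MCSys.r.{u, w} G)
        (TambaraFunctor.rational G) (MCSys.rational G)) := by
  have hM : ∀ M, MackeyFunctor.rational.{u, w} G M → IsIso ((CSys.adj G).unit.app M) :=
    fun M hM => MackeyFunctor.isIso_of_bijective M.unitHom
      (MackeyFunctor.unitHom_app_bijective hM)
  have hN : ∀ N, CSys.rational.{u, w} G N → IsIso ((CSys.adj G).counit.app N) :=
    fun N hN => CSys.isIso_counitHom hN
  have hS : ∀ S, TambaraFunctor.rational.{u, w} G S → IsIso ((MCSys.adj G).unit.app S) :=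
    fun S hS => TambaraFunctor.isIso_unitHom hS
  have hR : ∀ R, MCSys.rational.{u, w} G R → IsIso ((MCSys.adj G).counit.app R) :=
    fun R hR => MCSys.isIso_counitHom hR
  exact ⟨⟨CSys.adj G, hM, hN, (CSys.adj G).restrictToEquivalence
      (fun _ => MackeyFunctor.rational_q) (fun _ => CSys.rational_r) hM hN⟩,
    ⟨MCSys.adj G, hS, hR, (MCSys.adj G).restrictToEquivalence
      (fun _ => TambaraFunctor.rational_q) (fun _ => MCSys.rational_r) hS hR⟩⟩
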